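/- **Setting.** Let $d\ge 1$ and let $K$ be a finite simplicial complex in $\mathbb R^d$, every simplex of which is a face of a $d$-simplex of $K$, and whose underlying space $M=|K|$ is non-empty and connected (a *space mesh*). The hyperbolic PDE with its initial and boundary data enters through its causal slope $S$ (the reciprocal of the wavespeed), a function on spacetime with $S\ge s$ on $M\times[0,\infty)$ for a constant $s>0$; no other property of $S$ is used. *Fronts.* A front over a triangulation assigns a time $\tau(v)$ to each vertex $v$ and is extended linearly on each simplex; $\nabla\tau|_f$ is the gradient of its restriction to a simplex $f$. A vertex $p$ is a local minimum if $\tau(p)\le\tau(q)$ for all vertices $q$ of simplices containing $p$. Advancing $p$ by $\delta>0$ changes $\tau(p)$ to $\tau(p)+\delta$; for each $d$-simplex $\sigma\ni p$ this erects the spacetime element $\operatorname{conv}\big(\{(v,\tau(v)):v\in\sigma\}\cup\{(p,\tau(p)+\delta)\}\big)$. The elements erected by one advance form a tent. *Weak simplicial complex.* A collection of simplices, closed under taking faces (including the empty face), in which the intersection of any two simplices is a face of at least one of them. *Causal outflow facet.* A facet $F$ of an element $e$ is a causal outflow facet if it lies on the graph of an affine function $x\mapsto\langle g,x\rangle+c_0$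 such that $e$ lies on or below this graph and $\|g\|<S(P)$ for all $P\in F$. *Temporal aspect ratio.* For an element $e$: the length of a longest vertical (time) segment contained in $e$, divided by the length of the shortest time interval containing the interior of $e$. *Mesh criteria with constant $c>0$* for a set $\mathcal E$ of $(d+1)$-simplices in $M\times[0,\infty)$: (0) the elements have pairwise disjoint interiors and $\bigcup\mathcal E=M\times[0,\infty)$; (1) the faces of the elements form a weak simplicial complex that conforms to $K$: every element lies over a simplex of $K$, and for every simplex $f$ of $K$ both $f\times\{0\}$ and $f\times[0,\infty)$ are unions of faces of elements; (2) every element has a causal outflow facet; (3) for every $T\ge0$, $M\times[0,T]$ is covered by finitely many elements of $\mathcal E$; (4) every element has temporal aspect ratio at least $c$. **Algorithm in dimension $d$**, with parameters $\varepsilon,\kappa\in(0,1)$ and $s>0$. For a simplex $f$ of positive dimension let $\phi(f)=\min_{p}\operatorname{dist}(p,\operatorname{aff}\Delta_p)/\operatorname{dist}(p,\Delta_p)$, where $p$ runs over the vertices of $f$ and $\Delta_p$ is the facet opposite to $p$. Slope bounds are imposed inductively: the bound $s$ on every $d$-simplex, and whenever a bound $b$ is imposed on $g$, the bound $(1-\varepsilon)\phi(g)b$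 on every (non-empty) facet of $g$. A front over $K$ is progressive if $\|\nabla\tau|_\sigma\|<s$ for every $d$-simplex $\sigma$, and $\|\nabla\tau|_f\|\le b$ for every bound $b$ imposed on a simplex $f$. The initial front is $\tau_0=0$. In each step, some local minimum $p$ is advanced by some $\delta>0$ such that the new front is progressive and $\delta\ge\kappa\delta'$ for every $\delta'$ for which advancing $p$ by $\delta'$ gives a progressive front. A run is an infinite sequence of steps; its mesh is the set of all elements of all its tents. **Adaptive algorithm for $d=2$**, with parameters $0<\varepsilon<\varphi<\frac{1+\varepsilon}2<1$, $\kappa\in(0,1)$, $s>0$. Each triangle of $K$ gets an arbitrarily chosen marked vertex, its apex; the opposite edge is its base. Newest vertex bisection splits a triangle $abc$ with apex $a$ at the midpoint $m$ of $bc$ into $mab$ and $mac$, both with apex $m$. Refining a set of triangles of a triangulation bisects the bases of these triangles and, by propagation, the base of every triangle that has an edge to be bisected; inside each triangle this is carried out by bisecting the triangle and then each child whose base is to be bisected. The time function of the front does not change. For a triangle $abc$ put $w(a;b,c)=\min\{(1-\varepsilon)\operatorname{dist}(a,bc),(1-\varphi)\operatorname{dist}(b,ac),(1-\varphi)\operatorname{dist}(c,ab)\}$,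 with distances to lines. A front is progressive if every triangle has $\|\nabla\tau\|<s$ and, for every triangle $abc$ with apex $a$ and $m=\frac{b+c}2$, $n=\frac{a+c}2$, $$|\tau(a)-\tau(b)|\le2w(m;c,a)s,\qquad |\tau(a)-\tau(m)|\le w(a;b,c)s,$$ $$|\tau(a)-\tau(c)|\le2w(m;a,b)s,\qquad |\tau(b)-\tau(c)|\le4w(n;a,m)s.$$ The initial front is $\tau_0=0$ on $K$. An error indicator accepts or rejects tetrahedra; its verdicts are arbitrary and may change from one iteration to the next. In each iteration, a local minimum $p$ of the front is tentatively advanced as above (new front progressive, $\delta>0$ and at least $\kappa$ times any other admissible progress). If the indicator accepts all elements of the tent, they are added to the mesh, the front advances, and it may then be coarsened: groups of triangles may be merged into common ancestors (descendants under bisection of triangles of $K$) on which the front is affine, provided that the result is again a conforming triangulation. Otherwise no element is added, and the triangles of the front below the rejected elements are refined. A run is an infinite sequence of iterations; its mesh is the set of all elements added. **Theorem.** (I) Let $d\ge1$, let $K$ be a space mesh in $\mathbb R^d$, and let $\varepsilon,\kappa\in(0,1)$, $s>0$. Every front that the algorithm can reach has a local minimum, and every local minimum of it can be advanced in a step; so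 infinite runs exist. There is $c>0$, depending only on $d,K,\varepsilon,\kappa,s$, such that for every slope field $S\ge s$ the mesh of every run satisfies the mesh criteria with constant $c$; moreover, $f\times\{0\}$ is itself a face of the mesh for every $f\in K$, and for every $T$ the front is at or above time $T$ at all vertices after finitely many steps. (II) Let $K$ be a space mesh in $\mathbb R^2$ with marked triangles, and let $\varepsilon,\varphi,\kappa,s$ be as above. Every front that the adaptive algorithm can reach has a local minimum, and for every local minimum of it and all verdicts of the indicator an iteration is possible; so infinite runs exist for every error indicator. For every error indicator and every run, the elements of the mesh are tetrahedra in $M\times[0,\infty)$ with disjoint interiors, each over a simplex of $K$, their faces form a weak simplicial complex, each element has a causal outflow facet for every slope field $S\ge s$, and each was accepted by the indicator; in particular, its diameter is no larger than the indicator allows. Moreover, for every $\mu>0$ there is $c>0$, depending only on $K$, its marking, $\varepsilon,\varphi,\kappa,s,\mu$, such that for every error indicator that rejects no tetrahedron of diameter less than $\mu$, every slope field $S\ge s$ and every run, the mesh satisfies the mesh criteria with constant $c$, and for every $T\ge0$ after finitely many iterations the front is at or above time $T$ everywhere and the finitely many elements built so far cover $M\times[0,T]$. -/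

import Mathlib

open Set

noncomputable section

/-! ### Space, spacetime, simplices -/

/-- The Euclidean space of dimension `d`. -/
abbrev Space (d : ℕ) := EuclideanSpace ℝ (Fin d)

/-- Spacetime: a point is a pair (position, time). -/
abbrev SpaceTime (d : ℕ) := Space d × ℝ

/-- The closed simplex with a given finite vertex set. -/
abbrev hull {V : Type*} [AddCommGroup V] [Module ℝ V] (e : Finset V) : Set V :=
  convexHull ℝ (e : Set V)

/-- The diameter of a spacetime simplex, in the Euclidean metric of `ℝ^d × ℝ`. -/
def spacetimeDiam {d : ℕ} (e : Finset (SpaceTime d)) : ℝ :=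
  Metric.diam ((fun P : SpaceTime d => WithLp.toLp 2 P) '' hull e)

/-- A weak simplicial complex: a collection of simplices, closed under passing to faces, in which
the intersection of every two simplices is a face of at least one of them.  A simplex is given by
its set of (affinely independent) vertices; the empty simplex is a face of every simplex. -/
structure IsWeakSimplicialComplex {V : Type*} [AddCommGroup V] [Module ℝ V]
    (C : Set (Finset V)) : Prop where
  simplex : ∀ s ∈ C, AffineIndependent ℝ ((↑) : s → V)
  face : ∀ s ∈ C, ∀ t, t ⊆ s → t ∈ C
  inter : ∀ s ∈ C, ∀ t ∈ C, ∃ u : Finset V, (u ⊆ s ∨ u ⊆ t) ∧ hull s ∩ hull t = hull u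

/-- All faces of a family of simplices. -/
def allFaces {V : Type*} (𝓔 : Set (Finset V)) : Set (Finset V) := {f | ∃ e ∈ 𝓔, f ⊆ e}

/-- A space mesh: a finite `d`-dimensional triangulation of a connected domain of `ℝ^d`
(every simplex is a face of a `d`-simplex). -/
structure IsSpaceMesh {d : ℕ} (K : Geometry.SimplicialComplex ℝ (Space d)) : Prop where
  finite : K.faces.Finite
  pure : ∀ f ∈ K.faces, ∃ g ∈ K.faces, f ⊆ g ∧ g.card = d + 1
  connected : IsConnected K.space

/-! ### The criteria on a spacetime mesh -/

/-- `F` is a causal outflow facet of the spacetime simplex `e` for the causal slope field `S`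
(the reciprocal of the wavespeed): `F` lies on the graph of an affine time function whose gradient
is smaller in norm than the slope `S P` at every point `P` of `F`, and `e` lies below that graph. -/
def IsCausalOutflowFacet {d : ℕ} (S : SpaceTime d → ℝ) (e F : Finset (SpaceTime d)) : Prop :=
  F ⊆ e ∧ F.card + 1 = e.card ∧ ∃ (g : Space d) (c : ℝ),
    (∀ P ∈ F, P.2 = inner ℝ g P.1 + c) ∧
    (∀ P ∈ hull e, P.2 ≤ inner ℝ g P.1 + c) ∧
    ∀ P ∈ hull F, ‖g‖ < S P

/-- The height of a subset of spacetime: the length of a longest time interval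
contained in its closure. -/
def height {d : ℕ} (A : Set (SpaceTime d)) : ℝ :=
  sSup {L : ℝ | 0 ≤ L ∧ ∃ (x : Space d) (a : ℝ), ∀ t ∈ Icc a (a + L), (x, t) ∈ closure A}

/-- The duration of a subset of spacetime: the length of the shortest time interval
containing its interior. -/
def duration {d : ℕ} (A : Set (SpaceTime d)) : ℝ :=
  Metric.diam (Prod.snd '' interior A)

/-- The temporal aspect ratio of a spacetime simplex. -/
def temporalAspectRatio {d : ℕ} (e : Finset (SpaceTime d)) : ℝ :=
  height (hull e) / duration (hull e)

/-- A family of nonoverlapping `(d+1)`-simplices in `|K| × [0,∞)`, each lying over a simplex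
of `K`, whose faces form a weak simplicial complex. -/
structure IsSimplicialFamily {d : ℕ} (K : Geometry.SimplicialComplex ℝ (Space d))
    (𝓔 : Set (Finset (SpaceTime d))) : Prop where
  card : ∀ e ∈ 𝓔, e.card = d + 2
  indep : ∀ e ∈ 𝓔, AffineIndependent ℝ ((↑) : e → SpaceTime d)
  nonoverlapping : ∀ e ∈ 𝓔, ∀ e' ∈ 𝓔, e ≠ e' →
    Disjoint (interior (hull e)) (interior (hull e'))
  nonneg : ∀ e ∈ 𝓔, ∀ P ∈ hull e, 0 ≤ P.2
  lies_over : ∀ e ∈ 𝓔, ∃ f ∈ K.faces, Prod.fst '' hull e ⊆ hull f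
  weakComplex : IsWeakSimplicialComplex (allFaces 𝓔)

/-- The set `A` is a union of simplices of the collection `C`. -/
def IsUnionOf {d : ℕ} (C : Set (Finset (SpaceTime d))) (A : Set (SpaceTime d)) : Prop :=
  ∀ P ∈ A, ∃ g ∈ C, P ∈ hull g ∧ hull g ⊆ A

/-- The criteria on a simplicial mesh `𝓔` of `|K| × [0,∞)`, for the slope field `S`, with lower
bound `c` on the temporal aspect ratios.  Conformity to `K` means that every element lies over a
simplex of `K` and that, for every simplex `f` of `K`, both `f × {0}` and `f × [0,∞)` are unions
of faces of the mesh. -/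
structure MeshCriteria {d : ℕ} (K : Geometry.SimplicialComplex ℝ (Space d))
    (S : SpaceTime d → ℝ) (c : ℝ) (𝓔 : Set (Finset (SpaceTime d))) : Prop where
  family : IsSimplicialFamily K 𝓔
  covers : (⋃ e ∈ 𝓔, hull e) = K.space ×ˢ Ici (0 : ℝ)
  conforms_initial : ∀ f ∈ K.faces, IsUnionOf (allFaces 𝓔) (hull f ×ˢ {(0 : ℝ)})
  conforms_column : ∀ f ∈ K.faces, IsUnionOf (allFaces 𝓔) (hull f ×ˢ Ici (0 : ℝ))
  causal_outflow : ∀ e ∈ 𝓔, ∃ F, IsCausalOutflowFacet S e F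
  finite_prefix : ∀ T : ℝ, 0 ≤ T → ∃ 𝓕 ⊆ 𝓔, 𝓕.Finite ∧
    K.space ×ˢ Icc (0 : ℝ) T ⊆ ⋃ e ∈ 𝓕, hull e
  aspect : ∀ e ∈ 𝓔, c ≤ temporalAspectRatio e

/-! ### Fronts and tents

A front over a triangulation is given by the times `τ v` of the vertices `v`, and is extended
linearly over each simplex. -/

/-- `g` is the gradient of the restriction of the front `τ` to the affine hull of the simplex `f`. -/
def IsGradient {d : ℕ} (τ : Space d → ℝ) (f : Finset (Space d)) (g : Space d) : Prop :=
  g ∈ vectorSpan ℝ (f : Set (Space d)) ∧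
    ∀ u ∈ f, ∀ v ∈ f, τ v - τ u = inner ℝ g (v - u)

open scoped Classical in
/-- The front after advancing the vertex `p` by `δ`. -/
def advance {d : ℕ} (τ : Space d → ℝ) (p : Space d) (δ : ℝ) : Space d → ℝ :=
  Function.update τ p (τ p + δ)

open scoped Classical in
/-- The element of the tent over the simplex `σ` of the front `τ` when the vertex `p` of `σ` is
advanced by `δ`: its vertices are those of `σ` on the old front and the top of the tentpole. -/
def tentElement {d : ℕ} (τ : Space d → ℝ) (p : Space d) (δ : ℝ) (σ : Finset (Space d)) :
    Finset (SpaceTime d) :=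
  insert (p, τ p + δ) (σ.image fun v => (v, τ v))

/-! ### The advancing front algorithm in arbitrary dimension -/

/-- The shape factor of a simplex: the minimum over the vertices `p` of the sine of the angle
`p u p̄`, where `p̄` is the orthogonal projection of `p` to the affine hull of the opposite facet
`Δ` and `u` is the point of `Δ` nearest to `p̄` (hence nearest to `p`).  This sine is the quotient
of the distances from `p` to the affine hull of `Δ` and to `Δ`. -/
def shapeFactor {d : ℕ} (f : Finset (Space d)) : ℝ :=
  ⨅ p : f, Metric.infDist (p : Space d) (affineSpan ℝ ((f : Set (Space d)) \ {(p : Space d)})) /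
    Metric.infDist (p : Space d) (convexHull ℝ ((f : Set (Space d)) \ {(p : Space d)}))

/-- `SlopeBound K ε s f b`: the bound `b` is imposed on the gradient of a front along the simplex
`f` of `K`.  The bound on a `d`-simplex is `s` (causality); a bound `b` on a simplex `g` imposes
the bound `(1 - ε) φ(g) b` on every facet of `g` (progress constraint). -/
inductive SlopeBound {d : ℕ} (K : Geometry.SimplicialComplex ℝ (Space d)) (ε s : ℝ) :
    Finset (Space d) → ℝ → Prop
  | top {f : Finset (Space d)} (hf : f ∈ K.faces) (hcard : f.card = d + 1) : SlopeBound K ε s f s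
  | facet {g f : Finset (Space d)} {b : ℝ} (hg : SlopeBound K ε s g b) (hfg : f ⊆ g)
      (hcard : f.card + 1 = g.card) (hf : f.Nonempty) :
      SlopeBound K ε s f ((1 - ε) * shapeFactor g * b)

/-- A progressive front: every `d`-simplex has gradient smaller than `s`, and the gradients of all
faces obey the bounds imposed on them. -/
def IsProgressive {d : ℕ} (K : Geometry.SimplicialComplex ℝ (Space d)) (ε s : ℝ)
    (τ : Space d → ℝ) : Prop :=
  (∀ σ ∈ K.faces, σ.card = d + 1 → ∃ g, IsGradient τ σ g ∧ ‖g‖ < s) ∧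
  ∀ f b, SlopeBound K ε s f b → ∃ g, IsGradient τ f g ∧ ‖g‖ ≤ b

/-- `p` is a local minimum vertex of the front `τ` over `K`. -/
def IsLocalMinVertex {d : ℕ} (K : Geometry.SimplicialComplex ℝ (Space d)) (τ : Space d → ℝ)
    (p : Space d) : Prop :=
  {p} ∈ K.faces ∧ ∀ f ∈ K.faces, p ∈ f → ∀ q ∈ f, τ p ≤ τ q

/-- One step of the algorithm: a local minimum vertex `p` is advanced by `δ > 0` so that the new
front is progressive, with `δ` at least `κ` times as large as any other admissible progress.
(Causality is an open condition, so the maximal progress need not be attained.) -/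
structure IsPitch {d : ℕ} (K : Geometry.SimplicialComplex ℝ (Space d)) (ε κ s : ℝ)
    (τ : Space d → ℝ) (p : Space d) (δ : ℝ) : Prop where
  localMin : IsLocalMinVertex K τ p
  pos : 0 < δ
  progressive : IsProgressive K ε s (advance τ p δ)
  nearMax : ∀ δ', IsProgressive K ε s (advance τ p δ') → κ * δ' ≤ δ

/-- The fronts that the algorithm can reach from the initial front `τ₀ = 0`. -/
def IsReachableFront {d : ℕ} (K : Geometry.SimplicialComplex ℝ (Space d)) (ε κ s : ℝ)
    (τ : Space d → ℝ) : Prop :=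
  Relation.ReflTransGen (fun τ τ' => ∃ p δ, IsPitch K ε κ s τ p δ ∧ τ' = advance τ p δ)
    (fun _ => 0) τ

/-- An (infinite) run of the algorithm: the fronts `τ i`, and the vertex `p i` and the progress
`δ i` of the `i`-th step. -/
structure IsTentRun {d : ℕ} (K : Geometry.SimplicialComplex ℝ (Space d)) (ε κ s : ℝ)
    (τ : ℕ → Space d → ℝ) (p : ℕ → Space d) (δ : ℕ → ℝ) : Prop where
  init : τ 0 = fun _ => 0
  pitch : ∀ i, IsPitch K ε κ s (τ i) (p i) (δ i)
  next : ∀ i, τ (i + 1) = advance (τ i) (p i) (δ i)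

/-- The spacetime mesh built by a run: one element for every step and every `d`-simplex of `K`
incident on the advanced vertex. -/
def tentMesh {d : ℕ} (K : Geometry.SimplicialComplex ℝ (Space d)) (τ : ℕ → Space d → ℝ)
    (p : ℕ → Space d) (δ : ℕ → ℝ) : Set (Finset (SpaceTime d)) :=
  {e | ∃ i, ∃ σ ∈ K.faces, σ.card = d + 1 ∧ p i ∈ σ ∧ e = tentElement (τ i) (p i) (δ i) σ}

/-! ### Newest vertex bisection in the plane -/

/-- A triangle with a marked vertex, the apex; the opposite edge is its base. -/
@[ext]
structure MarkedTriangle where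
  apex : Space 2
  left : Space 2
  right : Space 2

namespace MarkedTriangle

open scoped Classical in
/-- The vertices of a marked triangle. -/
def verts (t : MarkedTriangle) : Finset (Space 2) := {t.apex, t.left, t.right}

/-- The base edge. -/
def base (t : MarkedTriangle) : Sym2 (Space 2) := s(t.left, t.right)

/-- The set of edges. -/
def edges (t : MarkedTriangle) : Set (Sym2 (Space 2)) :=
  {t.base, s(t.apex, t.left), s(t.apex, t.right)}

/-- The child, containing the left base vertex, obtained by newest vertex bisection: the midpoint
of the base is its apex. -/
def leftChild (t : MarkedTriangle) : MarkedTriangle :=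
  ⟨midpoint ℝ t.left t.right, t.apex, t.left⟩

/-- The child containing the right base vertex. -/
def rightChild (t : MarkedTriangle) : MarkedTriangle :=
  ⟨midpoint ℝ t.left t.right, t.apex, t.right⟩

/-- `t'` is obtained from `t` by zero or more newest vertex bisections. -/
def IsDescendant (t t' : MarkedTriangle) : Prop :=
  Relation.ReflTransGen (fun a b => b = a.leftChild ∨ b = a.rightChild) t t'

open scoped Classical in
/-- The part of a refinement inside the triangle `t`, if the edges in `M` are to be bisected:
if the base of `t` is in `M`, then `t` is bisected, and then so is every child whose base is
in `M`. -/
def subdivide (M : Set (Sym2 (Space 2))) (t : MarkedTriangle) : Finset MarkedTriangle :=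
  if t.base ∈ M then
    (if t.leftChild.base ∈ M then {t.leftChild.leftChild, t.leftChild.rightChild}
      else {t.leftChild}) ∪
    (if t.rightChild.base ∈ M then {t.rightChild.leftChild, t.rightChild.rightChild}
      else {t.rightChild})
  else {t}

end MarkedTriangle

/-- The edges bisected when the triangles in `R` of the triangulation `𝒯` are refined: the bases of
the triangles in `R` and, by propagation, the base of every triangle that has an edge to be
bisected. -/
inductive BisectedEdge (𝒯 : Finset MarkedTriangle) (R : Set MarkedTriangle) :
    Sym2 (Space 2) → Prop
  | base {t : MarkedTriangle} (ht : t ∈ 𝒯) (hR : t ∈ R) : BisectedEdge 𝒯 R t.base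
  | propagate {t : MarkedTriangle} {e : Sym2 (Space 2)} (ht : t ∈ 𝒯) (he : e ∈ t.edges)
      (h : BisectedEdge 𝒯 R e) : BisectedEdge 𝒯 R t.base

open scoped Classical in
/-- The triangulation obtained from `𝒯` by newest vertex bisection of all triangles in `R`,
with propagation to neighboring triangles. -/
def refineTriangulation (𝒯 : Finset MarkedTriangle) (R : Set MarkedTriangle) :
    Finset MarkedTriangle :=
  𝒯.biUnion fun t => t.subdivide {e | BisectedEdge 𝒯 R e}

/-- The triangles meet along common faces. -/
def IsConformingTriangulation (𝒯 : Finset MarkedTriangle) : Prop :=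
  ∀ t ∈ 𝒯, ∀ t' ∈ 𝒯, hull t.verts ∩ hull t'.verts =
    convexHull ℝ ((t.verts : Set (Space 2)) ∩ t'.verts)

/-- The triangles of the planar mesh `K`, each with an arbitrarily chosen apex. -/
def IsMarking (K : Geometry.SimplicialComplex ℝ (Space 2)) (𝒯₀ : Finset MarkedTriangle) : Prop :=
  (∀ t ∈ 𝒯₀, t.verts ∈ K.faces ∧ t.verts.card = 3) ∧
  ∀ f ∈ K.faces, f.card = 3 → ∃! t, t ∈ 𝒯₀ ∧ t.verts = f

/-! ### The adaptive algorithm in the plane -/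

/-- A front of the adaptive algorithm: a triangulation by marked triangles, and the times of its
vertices (the values of `time` at other points are irrelevant). -/
structure AdaptiveFront where
  tri : Finset MarkedTriangle
  time : Space 2 → ℝ

/-- The diminished width of the triangle `abc` with apex `a`. -/
def diminishedWidth (ε φ : ℝ) (a b c : Space 2) : ℝ :=
  min ((1 - ε) * Metric.infDist a (affineSpan ℝ {b, c}))
    (min ((1 - φ) * Metric.infDist b (affineSpan ℝ {a, c}))
      ((1 - φ) * Metric.infDist c (affineSpan ℝ {a, b})))

/-- The adaptive progress constraint for a triangle `abc` with apex `a`; here `m` and `n` are the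
midpoints of `bc` and `ac`, and `(τ b + τ c) / 2` is the time of the front at `m`. -/
def SatisfiesAdaptiveConstraint (ε φ s : ℝ) (τ : Space 2 → ℝ) (t : MarkedTriangle) : Prop :=
  let a := t.apex
  let b := t.left
  let c := t.right
  let m := midpoint ℝ b c
  let n := midpoint ℝ a c
  |τ a - τ b| ≤ 2 * diminishedWidth ε φ m c a * s ∧
  |τ a - (τ b + τ c) / 2| ≤ diminishedWidth ε φ a b c * s ∧
  |τ a - τ c| ≤ 2 * diminishedWidth ε φ m a b * s ∧
  |τ b - τ c| ≤ 4 * diminishedWidth ε φ n a m * s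

/-- A progressive front of the adaptive algorithm: every triangle has gradient smaller than `s`
and satisfies the adaptive progress constraint. -/
def IsAdaptivelyProgressive (ε φ s : ℝ) (𝒯 : Finset MarkedTriangle) (τ : Space 2 → ℝ) : Prop :=
  ∀ t ∈ 𝒯, (∃ g, IsGradient τ t.verts g ∧ ‖g‖ < s) ∧ SatisfiesAdaptiveConstraint ε φ s τ t

/-- `p` is a local minimum vertex of the adaptive front `F`. -/
def AdaptiveFront.IsLocalMin (F : AdaptiveFront) (p : Space 2) : Prop :=
  (∃ t ∈ F.tri, p ∈ t.verts) ∧ ∀ t ∈ F.tri, p ∈ t.verts → ∀ q ∈ t.verts, F.time p ≤ F.time q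

/-- A local minimum vertex `p` is advanced by `δ > 0` so that the new front is progressive, with
`δ` at least `κ` times as large as any other admissible progress. -/
structure IsAdaptivePitch (ε φ κ s : ℝ) (F : AdaptiveFront) (p : Space 2) (δ : ℝ) : Prop where
  localMin : F.IsLocalMin p
  pos : 0 < δ
  progressive : IsAdaptivelyProgressive ε φ s F.tri (advance F.time p δ)
  nearMax : ∀ δ', IsAdaptivelyProgressive ε φ s F.tri (advance F.time p δ') → κ * δ' ≤ δ

/-- The tent erected when the vertex `p` is advanced by `δ`. -/
def AdaptiveFront.patch (F : AdaptiveFront) (p : Space 2) (δ : ℝ) : Set (Finset (SpaceTime 2)) :=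
  {e | ∃ t ∈ F.tri, p ∈ t.verts ∧ e = tentElement F.time p δ t.verts}

/-- The triangulation `𝒯'` is obtained from `𝒯` by zero or more coarsenings of the front `τ`:
descendants of triangles of the initial mesh are merged into a common ancestor, provided that they
are coplanar in spacetime. -/
def IsCoarsening (𝒯₀ 𝒯 : Finset MarkedTriangle) (τ : Space 2 → ℝ)
    (𝒯' : Finset MarkedTriangle) : Prop :=
  IsConformingTriangulation 𝒯' ∧
  (∀ t' ∈ 𝒯', ∃ r ∈ 𝒯₀, r.IsDescendant t') ∧
  (∀ t ∈ 𝒯, ∃ t' ∈ 𝒯', t'.IsDescendant t) ∧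
  (∀ t' ∈ 𝒯', ∃ t ∈ 𝒯, t'.IsDescendant t) ∧
  ∀ t' ∈ 𝒯', ∃ A : Space 2 →ᵃ[ℝ] ℝ, (∀ v ∈ t'.verts, τ v = A v) ∧
    ∀ t ∈ 𝒯, t'.IsDescendant t → ∀ v ∈ t.verts, τ v = A v

/-- `F'` is the front `F`, with the triangles in `R` refined: the time function is unchanged. -/
def IsRefinement (F : AdaptiveFront) (R : Set MarkedTriangle) (F' : AdaptiveFront) : Prop :=
  F'.tri = refineTriangulation F.tri R ∧
  (∀ t ∈ F.tri, ∀ v ∈ t.verts, F'.time v = F.time v) ∧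
  ∀ u v, BisectedEdge F.tri R s(u, v) →
    F'.time (midpoint ℝ u v) = (F.time u + F.time v) / 2

/-- One iteration of the adaptive algorithm on the front `F`, at the local minimum `p`, where
`accepts` is the verdict of the error indicator.  If all elements of the tent are accepted, they are added to the
mesh, the front advances, and it may be coarsened; otherwise the triangles of the front below the
rejected elements are refined. `new` is the set of elements added to the mesh and `F'` is the next
front. -/
def AdaptiveStep (𝒯₀ : Finset MarkedTriangle) (accepts : Finset (SpaceTime 2) → Prop)
    (ε φ κ s : ℝ) (F : AdaptiveFront) (p : Space 2) (new : Set (Finset (SpaceTime 2)))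
    (F' : AdaptiveFront) : Prop :=
  ∃ δ, IsAdaptivePitch ε φ κ s F p δ ∧
    (((∀ e ∈ F.patch p δ, accepts e) ∧ new = F.patch p δ ∧
        F'.time = advance F.time p δ ∧ IsCoarsening 𝒯₀ F.tri F'.time F'.tri) ∨
     ((∃ e ∈ F.patch p δ, ¬ accepts e) ∧ new = ∅ ∧
        IsRefinement F
          {t | t ∈ F.tri ∧ p ∈ t.verts ∧ ¬ accepts (tentElement F.time p δ t.verts)} F'))

/-- The fronts that the adaptive algorithm can reach from the initial front, whatever the verdicts
of the error indicator. -/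
def IsReachableAdaptiveFront (𝒯₀ : Finset MarkedTriangle) (ε φ κ s : ℝ) (F : AdaptiveFront) :
    Prop :=
  Relation.ReflTransGen
    (fun F F' => ∃ accepts p new, AdaptiveStep 𝒯₀ accepts ε φ κ s F p new F')
    ⟨𝒯₀, fun _ => 0⟩ F

/-- An (infinite) run of the adaptive algorithm: the fronts `F i`, and the elements `new i` added
to the mesh in the `i`-th iteration.  The verdict `accepts i` of the error indicator may change
from one iteration to the next, as it depends on the solution computed so far. -/
structure IsAdaptiveRun (𝒯₀ : Finset MarkedTriangle) (accepts : ℕ → Finset (SpaceTime 2) → Prop)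
    (ε φ κ s : ℝ) (F : ℕ → AdaptiveFront) (new : ℕ → Set (Finset (SpaceTime 2))) : Prop where
  init : F 0 = ⟨𝒯₀, fun _ => 0⟩
  step : ∀ i, ∃ p, AdaptiveStep 𝒯₀ (accepts i) ε φ κ s (F i) p (new i) (F (i + 1))

/-- The error indicator rejects no tetrahedron of diameter less than `μ`. -/
def AcceptsSmall (accepts : ℕ → Finset (SpaceTime 2) → Prop) (μ : ℝ) : Prop :=
  ∀ i, ∀ e : Finset (SpaceTime 2), e.card = 4 → AffineIndependent ℝ ((↑) : e → SpaceTime 2) →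
    spacetimeDiam e < μ → accepts i e

end

/-! Both algorithms produce a rising sequence of piecewise linear fronts over `|K|`, and the
geometry of the mesh is treated once for all such sequences (`IsFrontSequence`), whose
triangulations may change from step to step. The elements of one tent fill the gap between two
consecutive fronts. Interiors are therefore disjoint, and a point common to elements of different
tents lies on the fronts between them: on top of the earlier element and at the bottom of the later
one. Projected to space, such a contact is an intersection of faces of two spatial simplices, and
`IsFrontSequence.inter_of_lt` lifts it back. So the weak complex property in spacetime reduces to
one in space. For a fixed `K` that is immediate; under bisection it holds because common edges are
cut into dyadic intervals, which are nested or have disjoint interiors (`IsForest.exists_inter`).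

Progress rests on `exists_gradient_advance`. When the lowest vertex of a simplex is raised, the
simplex gets flatter, or its slope is controlled by the slope of the opposite facet, divided by the
sine that enters the shape factor. The bound imposed on the facet leaves a margin proportional to
`ε`, so a single `η` is an admissible progress at every local minimum of every progressive front
(`exists_uniform_progress`). Near-maximality gives tentpoles of length at least `κ * η`.
Connectedness bounds the spread of a front by a constant `B` (`spread_le_of_isPreconnected`), so the
fronts rise beyond every time, and aspect ratios are at least `κ * η / (2 * B)`.

In the plane, the four inequalities of the adaptive constraint are permuted cyclically by bisection
(`satisfiesAdaptiveConstraint_leftChild`); hence refining and coarsening an affine piece of a front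
keep it progressive. The condition on `ε` and `φ` yields the strict inequality
`diminishedWidth_midpoint_lt`, which leaves room to advance base vertices.

If small tetrahedra are accepted, only triangles of bounded generation are rejected. Propagation
preserves this bound, although the markings of the initial triangles are unrelated, because half the
generation of an edge is the same seen from both sides (`IsForest.edge_generation_div_two`). So only
finitely many triangles ever occur, `η` is again uniform, and endless rejection is impossible, since
it would enlarge a subset of a finite set forever. -/

/-! ### Affine functions on simplices -/

section ConvexBasics

variable {V : Type*} [AddCommGroup V] [Module ℝ V]

theorem AffineMap.map_weighted_sum (A : V →ᵃ[ℝ] ℝ) (s : Finset V) (w : V → ℝ)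
    (hw : ∑ v ∈ s, w v = 1) : A (∑ v ∈ s, w v • v) = ∑ v ∈ s, w v * A v := by
  have h : ∀ x, A x = A.linear x + A 0 := fun x => by
    have := A.linearMap_vsub x 0
    simp only [vsub_eq_sub, sub_zero] at this
    linarith
  have h2 : ∀ v ∈ s, w v * A v = A.linear (w v • v) + w v * A 0 := fun v _ => by
    rw [h v, map_smul, smul_eq_mul, mul_add]
  rw [h, map_sum, Finset.sum_congr rfl h2, Finset.sum_add_distrib, ← Finset.sum_mul, hw, one_mul]

/-- Extending the vertices to an affine basis makes the interpolant defined on the whole space. With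
values 0 and 1 it replaces barycentric coordinates in what follows. -/
theorem exists_affine_interpolant {s : Finset V} (hs : AffineIndependent ℝ ((↑) : s → V))
    (τ : V → ℝ) : ∃ A : V →ᵃ[ℝ] ℝ, ∀ v ∈ s, A v = τ v := by
  classical
  obtain ⟨t, hst, hti, htop⟩ := exists_subset_affineIndependent_affineSpan_eq_top
    (k := ℝ) (s := (s : Set V)) hs
  let b : AffineBasis t ℝ V := ⟨((↑) : t → V), hti, by simpa using htop⟩
  refine ⟨∑ v ∈ s.attach, τ v • b.coord ⟨v, hst v.2⟩, fun w hw => ?_⟩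
  have key : ∀ u : t, b.coord u w = if u = (⟨w, hst hw⟩ : t) then 1 else 0 := fun u =>
    b.coord_apply u ⟨w, hst hw⟩
  have happ : (∑ v ∈ s.attach, τ v • b.coord ⟨v, hst v.2⟩) w =
      ∑ v ∈ s.attach, τ v * b.coord ⟨v, hst v.2⟩ w := by
    induction s.attach using Finset.induction_on with
    | empty => simp
    | insert a u ha ih => rw [Finset.sum_insert ha, Finset.sum_insert ha]; simp [ih]
  rw [happ, Finset.sum_eq_single ⟨w, hw⟩]
  · simp [key]
  · intro v _ hv
    rw [key, if_neg, mul_zero]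
    intro h
    exact hv (Subtype.ext (Subtype.mk.inj h))
  · simp

theorem affineIndependent_subset {s t : Finset V} (ht : AffineIndependent ℝ ((↑) : t → V))
    (h : s ⊆ t) : AffineIndependent ℝ ((↑) : s → V) :=
  AffineIndependent.mono (s := (s : Set V)) (t := (t : Set V)) ht (by exact_mod_cast h)

/-- Every point of a simplex lies in a face on which every affine function vanishes that is
nonnegative on the simplex and zero at the point. -/
theorem exists_carrier {f : Finset V} {x : V} (hx : x ∈ hull f) :
    ∃ g ⊆ f, x ∈ hull g ∧ ∀ ℓ : V →ᵃ[ℝ] ℝ, (∀ v ∈ f, 0 ≤ ℓ v) → ℓ x = 0 → ∀ v ∈ g, ℓ v = 0 := by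
  classical
  obtain ⟨w, hw0, hw1, hwx⟩ := Finset.mem_convexHull'.1 hx
  -- The carrier consists of the vertices of nonzero weight: a weighted sum of nonnegative values
  -- vanishes only if each of these values does.
  refine ⟨f.filter (fun v => w v ≠ 0), Finset.filter_subset _ _, ?_, ?_⟩
  · refine Finset.mem_convexHull'.2 ⟨w, fun y hy => hw0 y (Finset.mem_filter.1 hy).1, ?_, ?_⟩
    · rw [Finset.sum_filter_ne_zero, hw1]
    · rw [← hwx]
      refine Finset.sum_subset (Finset.filter_subset _ _) fun v hv hv' => ?_
      have : w v = 0 := by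
        by_contra h
        exact hv' (Finset.mem_filter.2 ⟨hv, h⟩)
      simp [this]
  · intro ℓ hℓ hℓx v hv
    rw [← hwx, AffineMap.map_weighted_sum ℓ f w hw1] at hℓx
    rw [Finset.mem_filter] at hv
    have := (Finset.sum_eq_zero_iff_of_nonneg
      (fun u hu => mul_nonneg (hw0 u hu) (hℓ u hu))).1 hℓx v hv.1
    exact (mul_eq_zero.1 this).resolve_left hv.2

/-- The main tool for intersecting simplices: the zero set, in a simplex, of an affine function that
is nonnegative there is a face. -/
theorem mem_hull_filter_zero {f : Finset V} {x : V} (hx : x ∈ hull f) (ℓ : V →ᵃ[ℝ] ℝ)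
    (hℓ : ∀ v ∈ f, 0 ≤ ℓ v) (hℓx : ℓ x = 0) [DecidablePred fun v => ℓ v = 0] :
    x ∈ hull (f.filter fun v => ℓ v = 0) := by
  obtain ⟨g, hgf, hxg, hg⟩ := exists_carrier hx
  refine convexHull_mono ?_ hxg
  intro v hv
  simp only [Finset.coe_filter, mem_ofPred_eq]
  exact ⟨hgf hv, hg ℓ hℓ hℓx v hv⟩

theorem hull_mono {f g : Finset V} (h : f ⊆ g) : hull f ⊆ hull g :=
  convexHull_mono (by exact_mod_cast h)

theorem mem_hull {f : Finset V} {v : V} (h : v ∈ f) : v ∈ hull f :=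
  subset_convexHull ℝ _ (by exact_mod_cast h)

theorem affine_nonneg_on_hull {f : Finset V} (ℓ : V →ᵃ[ℝ] ℝ) (hℓ : ∀ v ∈ f, 0 ≤ ℓ v) {x : V}
    (hx : x ∈ hull f) : 0 ≤ ℓ x := by
  obtain ⟨w, hw0, hw1, hwx⟩ := Finset.mem_convexHull'.1 hx
  rw [← hwx, AffineMap.map_weighted_sum ℓ f w hw1]
  exact Finset.sum_nonneg fun u hu => mul_nonneg (hw0 u hu) (hℓ u hu)

theorem affine_le_on_hull {f : Finset V} (A B : V →ᵃ[ℝ] ℝ) (h : ∀ v ∈ f, A v ≤ B v) {x : V}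
    (hx : x ∈ hull f) : A x ≤ B x := by
  have := affine_nonneg_on_hull (B - A) (f := f) (fun v hv => by simpa using h v hv) hx
  simpa using this

theorem affine_eq_on_hull {f : Finset V} (A B : V →ᵃ[ℝ] ℝ) (h : ∀ v ∈ f, A v = B v) {x : V}
    (hx : x ∈ hull f) : A x = B x :=
  le_antisymm (affine_le_on_hull A B (fun v hv => (h v hv).le) hx)
    (affine_le_on_hull B A (fun v hv => (h v hv).ge) hx)

/-- The vertex of a simplex is an extreme point of it. -/
theorem mem_of_mem_hull_subset {s t : Finset V} (hs : AffineIndependent ℝ ((↑) : s → V))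
    (hts : t ⊆ s) {v : V} (hv : v ∈ s) (hvt : v ∈ hull t) : v ∈ t := by
  classical
  have h := AffineIndependent.convexHull_inter (R := ℝ) hs hts (Finset.singleton_subset_iff.2 hv)
  have hmem : v ∈ convexHull ℝ ((t : Set V) ∩ ({v} : Finset V)) := by
    rw [h]; exact ⟨hvt, mem_hull (Finset.mem_singleton_self v)⟩
  by_contra hn
  have : ((t : Set V) ∩ (({v} : Finset V) : Set V)) = ∅ := by
    ext y
    simp only [Finset.coe_singleton, mem_inter_iff, Finset.mem_coe, mem_singleton_iff,
      mem_empty_iff_false, iff_false, not_and]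
    rintro hy rfl
    exact hn hy
  rw [this] at hmem
  simp at hmem

theorem hull_inter_hull_of_subset [DecidableEq V] {s t u : Finset V}
    (hs : AffineIndependent ℝ ((↑) : s → V)) (ht : t ⊆ s) (hu : u ⊆ s) :
    hull t ∩ hull u = hull (t ∩ u) := by
  rw [← AffineIndependent.convexHull_inter (R := ℝ) hs ht hu, hull, Finset.coe_inter]

/-- The affine map `x ↦ (x, A x)` to the graph of an affine function. -/
def graphMap (A : V →ᵃ[ℝ] ℝ) : V →ᵃ[ℝ] V × ℝ := (AffineMap.id ℝ V).prod A

@[simp] theorem graphMap_apply (A : V →ᵃ[ℝ] ℝ) (x : V) : graphMap A x = (x, A x) := rfl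

/-- The affine function `(x, t) ↦ A x - t`. -/
def depthBelow (A : V →ᵃ[ℝ] ℝ) : V × ℝ →ᵃ[ℝ] ℝ :=
  A.comp (LinearMap.fst ℝ V ℝ).toAffineMap - (LinearMap.snd ℝ V ℝ).toAffineMap

@[simp] theorem depthBelow_apply (A : V →ᵃ[ℝ] ℝ) (P : V × ℝ) :
    depthBelow A P = A P.1 - P.2 := rfl

/-- Affine maps commute with convex hulls. Faces are lifted from space to a front, and recognized
there, with this equivalence. -/
theorem mem_hull_graph_iff [DecidableEq (V × ℝ)] {s : Finset V} {τ : V → ℝ} {A : V →ᵃ[ℝ] ℝ}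
    (hA : ∀ v ∈ s, A v = τ v) {P : V × ℝ} :
    P ∈ hull (s.image fun v => (v, τ v)) ↔ P.1 ∈ hull s ∧ P.2 = A P.1 := by
  have : ((s.image fun v => (v, τ v) : Finset (V × ℝ)) : Set (V × ℝ)) = graphMap A '' s := by
    rw [Finset.coe_image]
    refine image_congr fun v hv => ?_
    simp [hA v hv]
  rw [hull, this, ← AffineMap.image_convexHull]
  constructor
  · rintro ⟨x, hx, rfl⟩
    exact ⟨hx, rfl⟩
  · rintro ⟨hx, ht⟩
    exact ⟨P.1, hx, by rw [graphMap_apply, ← ht]⟩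

theorem fst_mem_hull_image [DecidableEq V] {f : Finset (V × ℝ)} {P : V × ℝ} (hP : P ∈ hull f) :
    P.1 ∈ hull (f.image Prod.fst) := by
  have := (LinearMap.fst ℝ V ℝ).image_convexHull (f : Set (V × ℝ))
  rw [hull, Finset.coe_image]
  have h2 : (LinearMap.fst ℝ V ℝ) P ∈ (LinearMap.fst ℝ V ℝ) '' convexHull ℝ (f : Set (V × ℝ)) :=
    mem_image_of_mem _ hP
  rw [this] at h2
  exact h2

end ConvexBasics

/-! ### Tents over a simplex -/

section Tent

variable {d : ℕ}

theorem advance_self (τ : Space d → ℝ) (p : Space d) (δ : ℝ) : advance τ p δ p = τ p + δ := by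
  simp [advance]

theorem advance_of_ne (τ : Space d → ℝ) {p v : Space d} (δ : ℝ) (h : v ≠ p) :
    advance τ p δ v = τ v := by
  simp [advance, h]

theorem le_advance (τ : Space d → ℝ) (p : Space d) {δ : ℝ} (hδ : 0 ≤ δ) (v : Space d) :
    τ v ≤ advance τ p δ v := by
  by_cases h : v = p
  · subst h; rw [advance_self]; linarith
  · rw [advance_of_ne _ _ h]

theorem tentElement_congr {τ τ' : Space d → ℝ} {p : Space d} {δ : ℝ} {σ : Finset (Space d)}
    (hp : p ∈ σ) (h : ∀ v ∈ σ, τ v = τ' v) : tentElement τ p δ σ = tentElement τ' p δ σ := by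
  unfold tentElement
  rw [h p hp]
  congr 1
  exact Finset.image_congr fun v hv => by simp [h v hv]

theorem mem_tentElement {τ : Space d → ℝ} {p : Space d} {δ : ℝ} {σ : Finset (Space d)}
    {P : SpaceTime d} :
    P ∈ tentElement τ p δ σ ↔ P = (p, τ p + δ) ∨ ∃ v ∈ σ, (v, τ v) = P := by
  simp [tentElement]

theorem graph_advance_subset_tentElement {τ : Space d → ℝ} {p : Space d} {δ : ℝ}
    {σ : Finset (Space d)} {v : Space d} (hv : v ∈ σ) :
    (v, advance τ p δ v) ∈ tentElement τ p δ σ := by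
  rw [mem_tentElement]
  by_cases h : v = p
  · subst h; left; rw [advance_self]
  · right; exact ⟨v, hv, by rw [advance_of_ne _ _ h]⟩

/-- A tent element consists of the points between the old and the new front. -/
theorem mem_hull_tentElement_iff {τ : Space d → ℝ} {p : Space d} {δ : ℝ} (hδ : 0 ≤ δ)
    {c : Finset (Space d)} (hp : p ∈ c) {A A' : Space d →ᵃ[ℝ] ℝ} (hA : ∀ v ∈ c, A v = τ v)
    (hA' : ∀ v ∈ c, A' v = advance τ p δ v) {P : SpaceTime d} :
    P ∈ hull (tentElement τ p δ c) ↔ P.1 ∈ hull c ∧ A P.1 ≤ P.2 ∧ P.2 ≤ A' P.1 := by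
  classical
  constructor
  · intro hP
    have hfst := fst_mem_hull_image hP
    have hvert : ∀ Q ∈ tentElement τ p δ c, Q.1 ∈ c ∧ A Q.1 ≤ Q.2 ∧ Q.2 ≤ A' Q.1 := by
      intro Q hQ
      rcases mem_tentElement.1 hQ with rfl | ⟨v, hv, rfl⟩
      · refine ⟨hp, ?_, ?_⟩
        · simp only [hA p hp]; linarith
        · simp only [hA' p hp, advance_self]; rfl
      · refine ⟨hv, (hA v hv).le, ?_⟩
        simp only [hA' v hv]
        exact le_advance τ p hδ v
    refine ⟨hull_mono ?_ hfst, ?_, ?_⟩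
    · intro v hv
      obtain ⟨Q, hQ, rfl⟩ := Finset.mem_image.1 hv
      exact (hvert Q hQ).1
    · have := affine_nonneg_on_hull (-depthBelow A) (fun Q hQ => by
        simpa using (hvert Q hQ).2.1) hP
      simpa using this
    · have := affine_nonneg_on_hull (depthBelow A') (fun Q hQ => by
        simpa using (hvert Q hQ).2.2) hP
      simpa using this
  -- The vertical segment between the two graphs has its ends in the lower and in the upper facet,
  -- so convexity puts it into the element.
  · rintro ⟨hx, h1, h2⟩
    have hbot : (P.1, A P.1) ∈ hull (tentElement τ p δ c) := by
      refine hull_mono ?_ ((mem_hull_graph_iff (P := (P.1, A P.1)) hA).2 ⟨hx, rfl⟩)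
      intro Q hQ
      obtain ⟨v, hv, rfl⟩ := Finset.mem_image.1 hQ
      exact mem_tentElement.2 (Or.inr ⟨v, hv, rfl⟩)
    have htop : (P.1, A' P.1) ∈ hull (tentElement τ p δ c) := by
      refine hull_mono ?_ ((mem_hull_graph_iff (P := (P.1, A' P.1)) hA').2 ⟨hx, rfl⟩)
      intro Q hQ
      obtain ⟨v, hv, rfl⟩ := Finset.mem_image.1 hQ
      exact graph_advance_subset_tentElement hv
    have hseg : P ∈ segment ℝ (P.1, A P.1) (P.1, A' P.1) := by
      rw [← Prod.image_mk_segment_right]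
      refine ⟨P.2, ?_, rfl⟩
      rw [segment_eq_Icc (h1.trans h2)]
      exact ⟨h1, h2⟩
    exact (convex_convexHull ℝ _).segment_subset hbot htop hseg

theorem tentElement_card {τ : Space d → ℝ} {p : Space d} {δ : ℝ} (hδ : 0 < δ)
    (c : Finset (Space d)) : (tentElement τ p δ c).card = c.card + 1 := by
  classical
  unfold tentElement
  rw [Finset.card_insert_of_notMem, Finset.card_image_of_injective]
  · exact fun u v h => congrArg Prod.fst h
  · intro h
    obtain ⟨v, -, hv⟩ := Finset.mem_image.1 h
    have h1 : v = p := congrArg Prod.fst hv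
    have h2 : τ v = τ p + δ := congrArg Prod.snd hv
    subst h1
    linarith

/-- The projection to space maps these points to independent ones, and an affine map cannot create
independence. -/
theorem graph_affineIndependent [DecidableEq (SpaceTime d)] {c : Finset (Space d)}
    (hc : AffineIndependent ℝ ((↑) : c → Space d)) (τ : Space d → ℝ) :
    AffineIndependent ℝ ((↑) : (c.image fun v => (v, τ v)) → SpaceTime d) := by
  refine AffineIndependent.of_comp (LinearMap.fst ℝ (Space d) ℝ).toAffineMap ?_
  let e : (c.image fun v => (v, τ v)) ↪ c :=
    ⟨fun P => ⟨P.1.1, by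
      obtain ⟨v, hv, hP⟩ := Finset.mem_image.1 P.2
      rw [← hP]; exact hv⟩, by
      rintro ⟨P, hP⟩ ⟨Q, hQ⟩ h
      obtain ⟨v, hv, rfl⟩ := Finset.mem_image.1 hP
      obtain ⟨u, hu, rfl⟩ := Finset.mem_image.1 hQ
      have : v = u := congrArg Subtype.val h
      subst this; rfl⟩
  exact hc.comp_embedding e

/-- The lifted vertices lie on the graph of the interpolant `A`, and the top of the tentpole lies
strictly above it. -/
theorem tentElement_affineIndependent {τ : Space d → ℝ} {p : Space d} {δ : ℝ} (hδ : 0 < δ)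
    {c : Finset (Space d)} (hp : p ∈ c) (hc : AffineIndependent ℝ ((↑) : c → Space d)) :
    AffineIndependent ℝ ((↑) : tentElement τ p δ c → SpaceTime d) := by
  classical
  obtain ⟨A, hA⟩ := exists_affine_interpolant hc τ
  let top : tentElement τ p δ c := ⟨(p, τ p + δ), mem_tentElement.2 (Or.inl rfl)⟩
  have hsub : ∀ P : tentElement τ p δ c, P ≠ top → P.1 ∈ c.image fun v => (v, τ v) := by
    rintro ⟨P, hP⟩ hne
    rcases mem_tentElement.1 hP with rfl | h
    · exact absurd rfl hne
    · exact Finset.mem_image.2 h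
  refine AffineIndependent.affineIndependent_of_notMem_span (i := top) ?_ ?_
  · let e : {y : tentElement τ p δ c // y ≠ top} ↪ (c.image fun v => (v, τ v)) :=
      ⟨fun P => ⟨P.1.1, hsub P.1 P.2⟩, fun P Q h => Subtype.ext (Subtype.ext
        (Subtype.mk.inj h))⟩
    exact (graph_affineIndependent hc τ).comp_embedding e
  · intro h
    have hle : affineSpan ℝ ((↑) '' {x : tentElement τ p δ c | x ≠ top}) ≤
        (affineSpan ℝ (c : Set (Space d))).map (graphMap A) := by
      rw [AffineSubspace.map_span]
      refine affineSpan_mono ℝ ?_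
      rintro _ ⟨P, hP, rfl⟩
      obtain ⟨v, hv, hvP⟩ := Finset.mem_image.1 (hsub P hP)
      exact ⟨v, hv, by rw [graphMap_apply, hA v hv, hvP]⟩
    obtain ⟨x, -, hx⟩ := hle h
    have h1 : x = p := congrArg Prod.fst hx
    have h2 : A x = τ p + δ := congrArg Prod.snd hx
    subst h1
    rw [hA x hp] at h2
    linarith

theorem interior_hull_nonempty {d : ℕ} {V : Type*} [NormedAddCommGroup V] [NormedSpace ℝ V]
    [FiniteDimensional ℝ V] (hV : Module.finrank ℝ V = d) {e : Finset V} (hcard : e.card = d + 1)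
    (he : AffineIndependent ℝ ((↑) : e → V)) : (interior (hull e)).Nonempty := by
  rw [interior_convexHull_nonempty_iff_affineSpan_eq_top]
  have := (he.affineSpan_eq_top_iff_card_eq_finrank_add_one).2 (by simp [hcard, hV])
  simpa using this

theorem interior_hull_eq_empty {d : ℕ} {V : Type*} [NormedAddCommGroup V] [NormedSpace ℝ V]
    [FiniteDimensional ℝ V] (hV : Module.finrank ℝ V = d) {e : Finset V} (hcard : e.card ≤ d)
    (he : AffineIndependent ℝ ((↑) : e → V)) : interior (hull e) = ∅ := by
  by_contra h
  rw [← ne_eq, ← nonempty_iff_ne_empty, interior_convexHull_nonempty_iff_affineSpan_eq_top] at h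
  have := (he.affineSpan_eq_top_iff_card_eq_finrank_add_one).1 (by simpa using h)
  simp [hV] at this
  omega

end Tent

/-! ### Sequences of fronts -/

/-- A sequence of piecewise linear fronts `h i` over `|K|`, affine on the simplices of
triangulations `C i`. In every step, either nothing happens, or the vertex `p i` of `C i` is
advanced by `δ i` and the elements of the tent are collected in `new i`. -/
structure IsFrontSequence {d : ℕ} (K : Geometry.SimplicialComplex ℝ (Space d))
    (C : ℕ → Set (Finset (Space d))) (h : ℕ → Space d → ℝ) (p : ℕ → Space d) (δ : ℕ → ℝ)
    (new : ℕ → Set (Finset (SpaceTime d))) : Prop where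
  card : ∀ i, ∀ σ ∈ C i, σ.card = d + 1
  indep : ∀ i, ∀ σ ∈ C i, AffineIndependent ℝ ((↑) : σ → Space d)
  lies_over : ∀ i, ∀ σ ∈ C i, ∃ ρ ∈ K.faces, hull σ ⊆ hull ρ
  cover : ∀ i, ∀ x ∈ K.space, ∃ σ ∈ C i, x ∈ hull σ
  conform : ∀ i, ∀ σ ∈ C i, ∀ σ' ∈ C i, hull σ ∩ hull σ' ⊆
    convexHull ℝ ((σ : Set (Space d)) ∩ σ')
  -- The only compatibility required between triangulations of different steps; an edge of one may,
  -- for instance, be half an edge of the other.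
  inter : ∀ i j, ∀ σ ∈ C i, ∀ σ' ∈ C j, ∀ a ⊆ σ, ∀ b ⊆ σ',
    ∃ u : Finset (Space d), (u ⊆ a ∨ u ⊆ b) ∧ hull a ∩ hull b = hull u
  affine : ∀ i, ∀ σ ∈ C i, ∃ A : Space d →ᵃ[ℝ] ℝ, ∀ x ∈ hull σ, h i x = A x
  init : ∀ x ∈ K.space, h 0 x = 0
  step : ∀ i, (new i = ∅ ∧ ∀ x ∈ K.space, h (i + 1) x = h i x) ∨
    (0 < δ i ∧ new i = {e | ∃ σ ∈ C i, p i ∈ σ ∧ e = tentElement (h i) (p i) (δ i) σ} ∧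
      -- The new front is examined on the old triangulation. Coarsening does no harm, since it
      -- merges only simplices on which the new front is jointly affine.
      ∀ σ ∈ C i, (∀ v ∈ σ, h (i + 1) v = advance (h i) (p i) (δ i) v) ∧
        ∃ A : Space d →ᵃ[ℝ] ℝ, ∀ x ∈ hull σ, h (i + 1) x = A x)

namespace IsFrontSequence

variable {d : ℕ} {K : Geometry.SimplicialComplex ℝ (Space d)}
  {C : ℕ → Set (Finset (Space d))} {h : ℕ → Space d → ℝ} {p : ℕ → Space d} {δ : ℕ → ℝ}
  {new : ℕ → Set (Finset (SpaceTime d))} (H : IsFrontSequence K C h p δ new)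

include H

theorem hull_subset_space {i : ℕ} {σ : Finset (Space d)} (hσ : σ ∈ C i) : hull σ ⊆ K.space := by
  obtain ⟨ρ, hρ, hsub⟩ := H.lies_over i σ hσ
  exact hsub.trans (K.convexHull_subset_space hρ)

theorem le_succ (i : ℕ) {x : Space d} (hx : x ∈ K.space) : h i x ≤ h (i + 1) x := by
  rcases H.step i with ⟨-, hEq⟩ | ⟨hδ, -, hσ⟩
  · exact (hEq x hx).ge
  · obtain ⟨σ, hσC, hxσ⟩ := H.cover i x hx
    obtain ⟨A, hA⟩ := H.affine i σ hσC
    obtain ⟨hadv, A', hA'⟩ := hσ σ hσC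
    rw [hA x hxσ, hA' x hxσ]
    refine affine_le_on_hull A A' (fun v hv => ?_) hxσ
    rw [← hA v (mem_hull hv), ← hA' v (mem_hull hv), hadv v hv]
    exact le_advance _ _ hδ.le v

theorem le_of_le {i j : ℕ} (hij : i ≤ j) {x : Space d} (hx : x ∈ K.space) : h i x ≤ h j x := by
  induction hij with
  | refl => exact le_rfl
  | step _ ih => exact ih.trans (H.le_succ _ hx)

theorem nonneg (i : ℕ) {x : Space d} (hx : x ∈ K.space) : 0 ≤ h i x := by
  rw [← H.init x hx]
  exact H.le_of_le (Nat.zero_le i) hx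

theorem exists_base {i : ℕ} {e : Finset (SpaceTime d)} (he : e ∈ new i) :
    0 < δ i ∧ ∃ σ ∈ C i, p i ∈ σ ∧ e = tentElement (h i) (p i) (δ i) σ := by
  rcases H.step i with ⟨hnew, -⟩ | ⟨hδ, hnew, -⟩
  · rw [hnew] at he; exact absurd he (notMem_empty e)
  · rw [hnew] at he; exact ⟨hδ, he⟩

theorem exists_affine_next {i : ℕ} {e : Finset (SpaceTime d)} (he : e ∈ new i)
    {σ : Finset (Space d)} (hσ : σ ∈ C i) :
    (∀ v ∈ σ, h (i + 1) v = advance (h i) (p i) (δ i) v) ∧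
      ∃ A : Space d →ᵃ[ℝ] ℝ, ∀ x ∈ hull σ, h (i + 1) x = A x := by
  rcases H.step i with ⟨hnew, -⟩ | ⟨-, -, hnext⟩
  · rw [hnew] at he; exact absurd he (notMem_empty e)
  · exact hnext σ hσ

/-- Proper faces `c` are allowed because two elements of one tent meet over the common face of their
bases. -/
theorem mem_hull_iff {i : ℕ} (hne : (new i).Nonempty) {σ c : Finset (Space d)} (hσ : σ ∈ C i)
    (hc : c ⊆ σ) (hp : p i ∈ c) {P : SpaceTime d} :
    P ∈ hull (tentElement (h i) (p i) (δ i) c) ↔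
      P.1 ∈ hull c ∧ h i P.1 ≤ P.2 ∧ P.2 ≤ h (i + 1) P.1 := by
  obtain ⟨e, he⟩ := hne
  obtain ⟨hδ, -⟩ := H.exists_base he
  obtain ⟨A, hA⟩ := H.affine i σ hσ
  obtain ⟨hadv, A', hA'⟩ := H.exists_affine_next he hσ
  rw [mem_hull_tentElement_iff hδ.le hp (A := A) (A' := A')
    (fun v hv => (hA v (mem_hull (hc hv))).symm)
    (fun v hv => by rw [← hA' v (mem_hull (hc hv)), hadv v (hc hv)])]
  refine and_congr_right fun hx => ?_
  rw [hA _ (hull_mono hc hx), hA' _ (hull_mono hc hx)]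

theorem bounds_of_mem_hull {i : ℕ} {e : Finset (SpaceTime d)} (he : e ∈ new i) {P : SpaceTime d}
    (hP : P ∈ hull e) : P.1 ∈ K.space ∧ h i P.1 ≤ P.2 ∧ P.2 ≤ h (i + 1) P.1 := by
  obtain ⟨hδ, σ, hσ, hp, rfl⟩ := H.exists_base he
  have := (H.mem_hull_iff ⟨_, he⟩ hσ subset_rfl hp).1 hP
  exact ⟨H.hull_subset_space hσ this.1, this.2⟩

theorem element_card {i : ℕ} {e : Finset (SpaceTime d)} (he : e ∈ new i) : e.card = d + 2 := by
  obtain ⟨hδ, σ, hσ, hp, rfl⟩ := H.exists_base he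
  rw [tentElement_card hδ, H.card i σ hσ]

theorem element_indep {i : ℕ} {e : Finset (SpaceTime d)} (he : e ∈ new i) :
    AffineIndependent ℝ ((↑) : e → SpaceTime d) := by
  obtain ⟨hδ, σ, hσ, hp, rfl⟩ := H.exists_base he
  exact tentElement_affineIndependent hδ hp (H.indep i σ hσ)

theorem element_over {i : ℕ} {e : Finset (SpaceTime d)} (he : e ∈ new i) :
    ∃ ρ ∈ K.faces, ∀ P ∈ hull e, P.1 ∈ hull ρ := by
  obtain ⟨hδ, σ, hσ, hp, rfl⟩ := H.exists_base he
  obtain ⟨ρ, hρ, hsub⟩ := H.lies_over i σ hσ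
  exact ⟨ρ, hρ, fun P hP => hsub ((H.mem_hull_iff ⟨_, he⟩ hσ subset_rfl hp).1 hP).1⟩

/-- An interior point of the earlier element can be moved up inside it, so it lies strictly below
the front that follows; the later element lies on or above that front. -/
theorem disjoint_interior_of_lt {i j : ℕ} (hij : i < j) {e e' : Finset (SpaceTime d)}
    (he : e ∈ new i) (he' : e' ∈ new j) :
    Disjoint (interior (hull e)) (interior (hull e')) := by
  rw [Set.disjoint_left]
  intro P hP hP'
  have hcont : Filter.Tendsto (fun t : ℝ => ((P.1, t) : SpaceTime d)) (nhds P.2) (nhds P) :=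
    (Continuous.prodMk_right P.1).tendsto P.2
  have hev : ∀ᶠ t in nhds P.2, ((P.1, t) : SpaceTime d) ∈ interior (hull e) :=
    hcont (isOpen_interior.mem_nhds hP)
  obtain ⟨η, hη, hball⟩ := Metric.eventually_nhds_iff.1 hev
  have hup := interior_subset (hball (y := P.2 + η / 2) (by
    rw [Real.dist_eq]; simp only [add_sub_cancel_left]; rw [abs_of_pos] <;> linarith))
  have h1 := H.bounds_of_mem_hull he hup
  have h2 := H.bounds_of_mem_hull he' (interior_subset hP')
  have h3 := H.le_of_le (Nat.succ_le_of_lt hij) h2.1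
  simp only [Nat.succ_eq_add_one] at h3
  have h4 := h1.2.2
  simp only at h4
  linarith [h2.2.1]

/-- A common open set would project to an open subset of the common face of the bases, which has at
most `d` vertices. -/
theorem disjoint_interior_same {i : ℕ} {e e' : Finset (SpaceTime d)}
    (he : e ∈ new i) (he' : e' ∈ new i) (hne : e ≠ e') :
    Disjoint (interior (hull e)) (interior (hull e')) := by
  classical
  obtain ⟨hδ, σ, hσ, hp, rfl⟩ := H.exists_base he
  obtain ⟨-, σ', hσ', hp', rfl⟩ := H.exists_base he'
  have hσne : σ ≠ σ' := fun h => hne (by rw [h])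
  rw [Set.disjoint_left]
  intro P hP hP'
  set U := interior (hull (tentElement (h i) (p i) (δ i) σ)) ∩
    interior (hull (tentElement (h i) (p i) (δ i) σ'))
  have hUopen : IsOpen U := isOpen_interior.inter isOpen_interior
  have hsub : Prod.fst '' U ⊆ hull (σ ∩ σ') := by
    rintro _ ⟨Q, hQ, rfl⟩
    rw [hull, Finset.coe_inter]
    exact H.conform i σ hσ σ' hσ'
      ⟨((H.mem_hull_iff ⟨_, he⟩ hσ subset_rfl hp).1 (interior_subset hQ.1)).1,
        ((H.mem_hull_iff ⟨_, he⟩ hσ' subset_rfl hp').1 (interior_subset hQ.2)).1⟩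
  have hmem : P.1 ∈ interior (hull (σ ∩ σ')) :=
    interior_maximal hsub (isOpenMap_fst U hUopen) (mem_image_of_mem _ ⟨hP, hP'⟩)
  have hcard : (σ ∩ σ').card ≤ d := by
    have h1 : (σ ∩ σ').card < σ.card := by
      refine Finset.card_lt_card ⟨Finset.inter_subset_left, fun hle => hσne ?_⟩
      refine Finset.eq_of_subset_of_card_le (fun v hv => (Finset.mem_inter.1 (hle hv)).2) ?_
      rw [H.card i σ hσ, H.card i σ' hσ']
    rw [H.card i σ hσ] at h1
    omega
  rw [interior_hull_eq_empty (by simp) hcard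
    (affineIndependent_subset (H.indep i σ hσ) Finset.inter_subset_left)] at hmem
  exact hmem

/-- Over the common face of the bases both elements lie between the same two fronts, so they meet in
the hull of their common vertices. The rest takes place among faces of one simplex. -/
theorem inter_same {i : ℕ} {e e' f f' : Finset (SpaceTime d)} (he : e ∈ new i) (he' : e' ∈ new i)
    (hf : f ⊆ e) (hf' : f' ⊆ e') :
    ∃ u : Finset (SpaceTime d), (u ⊆ f ∨ u ⊆ f') ∧ hull f ∩ hull f' = hull u := by
  classical
  have hind := H.element_indep he
  have hind' := H.element_indep he'
  refine ⟨f ∩ f', Or.inl Finset.inter_subset_left, subset_antisymm ?_ (subset_inter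
    (hull_mono Finset.inter_subset_left) (hull_mono Finset.inter_subset_right))⟩
  rintro P ⟨hPf, hPf'⟩
  have hP : P ∈ hull (e ∩ e') := by
    have hPe := hull_mono hf hPf
    have hPe' := hull_mono hf' hPf'
    obtain ⟨hδ, σ, hσ, hp, rfl⟩ := H.exists_base he
    obtain ⟨-, σ', hσ', hp', rfl⟩ := H.exists_base he'
    have h1 := (H.mem_hull_iff ⟨_, he⟩ hσ subset_rfl hp).1 hPe
    have h2 := (H.mem_hull_iff ⟨_, he⟩ hσ' subset_rfl hp').1 hPe'
    have h3 : P.1 ∈ hull (σ ∩ σ') := by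
      rw [hull, Finset.coe_inter]; exact H.conform i σ hσ σ' hσ' ⟨h1.1, h2.1⟩
    have h4 := (H.mem_hull_iff ⟨_, he⟩ hσ (c := σ ∩ σ') Finset.inter_subset_left
      (Finset.mem_inter.2 ⟨hp, hp'⟩)).2 ⟨h3, h1.2⟩
    refine hull_mono ?_ h4
    intro Q hQ
    rw [Finset.mem_inter]
    rcases mem_tentElement.1 hQ with rfl | ⟨v, hv, rfl⟩
    · exact ⟨mem_tentElement.2 (Or.inl rfl), mem_tentElement.2 (Or.inl rfl)⟩
    · rw [Finset.mem_inter] at hv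
      exact ⟨mem_tentElement.2 (Or.inr ⟨v, hv.1, rfl⟩), mem_tentElement.2 (Or.inr ⟨v, hv.2, rfl⟩)⟩
  have hf1 : P ∈ hull (f ∩ (e ∩ e')) := by
    rw [← hull_inter_hull_of_subset hind hf Finset.inter_subset_left]; exact ⟨hPf, hP⟩
  have hf2 : P ∈ hull (f' ∩ (e ∩ e')) := by
    rw [← hull_inter_hull_of_subset hind' hf' Finset.inter_subset_right]; exact ⟨hPf', hP⟩
  have h5 : P ∈ hull ((f ∩ (e ∩ e')) ∩ (f' ∩ (e ∩ e'))) := by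
    rw [← hull_inter_hull_of_subset hind (Finset.inter_subset_left.trans hf)
      (Finset.inter_subset_right.trans Finset.inter_subset_left)]
    exact ⟨hf1, hf2⟩
  refine hull_mono ?_ h5
  intro Q hQ
  simp only [Finset.mem_inter] at hQ ⊢
  exact ⟨hQ.1.1, hQ.2.1⟩

/-- A common point is not above the front after step `i` and not below the front before step `j`. As
fronts only rise, it lies on both. Hence only the top part of `f` and the bottom part of `f'`
matter; they project to faces `a`, `b` of spatial simplices, and it remains to find where the two
fronts agree on the intersection of these. -/
theorem inter_of_lt {i j : ℕ} (hij : i < j) {e e' f f' : Finset (SpaceTime d)} (he : e ∈ new i)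
    (he' : e' ∈ new j) (hf : f ⊆ e) (hf' : f' ⊆ e') :
    ∃ u : Finset (SpaceTime d), (u ⊆ f ∨ u ⊆ f') ∧ hull f ∩ hull f' = hull u := by
  classical
  have hbe := fun P (hP : P ∈ hull e) => H.bounds_of_mem_hull he hP
  have hbe' := fun P (hP : P ∈ hull e') => H.bounds_of_mem_hull he' hP
  obtain ⟨hδ, σ, hσ, hp, hee⟩ := H.exists_base he
  obtain ⟨hδ', σ', hσ', hp', hee'⟩ := H.exists_base he'
  obtain ⟨hadv, A, hA⟩ := H.exists_affine_next he hσ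
  obtain ⟨B, hB⟩ := H.affine j σ' hσ'
  have hfstσ : ∀ P ∈ hull e, P.1 ∈ hull σ := fun P hP =>
    ((H.mem_hull_iff ⟨_, he⟩ hσ subset_rfl hp).1 (hee ▸ hP)).1
  have hfstσ' : ∀ P ∈ hull e', P.1 ∈ hull σ' := fun P hP =>
    ((H.mem_hull_iff ⟨_, he'⟩ hσ' subset_rfl hp').1 (hee' ▸ hP)).1
  have hvert : ∀ P ∈ e, P.1 ∈ σ := fun P hP => by
    rw [hee] at hP
    rcases mem_tentElement.1 hP with rfl | ⟨v, hv, rfl⟩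
    exacts [hp, hv]
  have hvert' : ∀ P ∈ e', P.1 ∈ σ' := fun P hP => by
    rw [hee'] at hP
    rcases mem_tentElement.1 hP with rfl | ⟨v, hv, rfl⟩
    exacts [hp', hv]
  -- the faces of `f` and `f'` on the common front, and their projections
  set f₁ := f.filter fun P => depthBelow A P = 0 with hf₁
  set f₂ := f'.filter fun P => (-depthBelow B) P = 0 with hf₂
  have hf₁P : ∀ P ∈ f₁, P.2 = A P.1 := fun P hP => by
    have := (Finset.mem_filter.1 hP).2
    simp only [depthBelow_apply] at this
    linarith
  have hf₂P : ∀ P ∈ f₂, P.2 = B P.1 := fun P hP => by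
    have := (Finset.mem_filter.1 hP).2
    simp only [AffineMap.coe_neg, Pi.neg_apply, depthBelow_apply] at this
    linarith
  set a := f₁.image Prod.fst with ha
  set b := f₂.image Prod.fst with hb
  have haσ : a ⊆ σ := fun v hv => by
    obtain ⟨P, hP, rfl⟩ := Finset.mem_image.1 hv
    exact hvert P (hf (Finset.mem_filter.1 hP).1)
  have hbσ : b ⊆ σ' := fun v hv => by
    obtain ⟨P, hP, rfl⟩ := Finset.mem_image.1 hv
    exact hvert' P (hf' (Finset.mem_filter.1 hP).1)
  have hmem_a : ∀ v ∈ a, (v, A v) ∈ f := fun v hv => by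
    obtain ⟨P, hP, rfl⟩ := Finset.mem_image.1 hv
    rw [← hf₁P P hP]
    exact (Finset.mem_filter.1 hP).1
  have hmem_b : ∀ v ∈ b, (v, B v) ∈ f' := fun v hv => by
    obtain ⟨P, hP, rfl⟩ := Finset.mem_image.1 hv
    rw [← hf₂P P hP]
    exact (Finset.mem_filter.1 hP).1
  obtain ⟨u, hu, hab⟩ := H.inter i j σ hσ σ' hσ' a haσ b hbσ
  have huab : hull u ⊆ hull a ∩ hull b := hab.ge
  -- As the fronts are ordered, `B - A` is nonnegative on the projected intersection, and the set of
  -- agreement is a face of it.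
  have hle : ∀ x ∈ hull u, A x ≤ B x := fun x hx => by
    have hxa := hull_mono haσ (huab hx).1
    rw [← hA x hxa, ← hB x (hull_mono hbσ (huab hx).2)]
    exact H.le_of_le (Nat.succ_le_of_lt hij) (H.hull_subset_space hσ hxa)
  set u₀ := u.filter fun v => (B - A) v = 0 with hu₀
  have hu₀AB : ∀ v ∈ u₀, B v = A v := fun v hv => by
    have := (Finset.mem_filter.1 hv).2
    simp only [AffineMap.coe_sub, Pi.sub_apply] at this
    linarith
  -- On `u₀` both interpolants agree, so its lift consists of vertices of `f` if `u ⊆ a`, and of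
  -- `f'` if `u ⊆ b`.
  refine ⟨u₀.image fun v => (v, B v), ?_, subset_antisymm ?_ (subset_inter ?_ ?_)⟩
  · rcases hu with hu | hu
    · left
      intro P hP
      obtain ⟨v, hv, rfl⟩ := Finset.mem_image.1 hP
      rw [hu₀AB v hv]
      exact hmem_a v (hu (Finset.mem_filter.1 hv).1)
    · right
      intro P hP
      obtain ⟨v, hv, rfl⟩ := Finset.mem_image.1 hP
      exact hmem_b v (hu (Finset.mem_filter.1 hv).1)
  · rintro P ⟨hPf, hPf'⟩
    have hPe := hull_mono hf hPf
    have hPe' := hull_mono hf' hPf'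
    have h1 := hbe P hPe
    have h2 := hbe' P hPe'
    have h3 := H.le_of_le (Nat.succ_le_of_lt hij) h1.1
    rw [Nat.succ_eq_add_one] at h3
    have hPA : P.2 = A P.1 := by rw [← hA _ (hfstσ P hPe)]; linarith
    have hPB : P.2 = B P.1 := by rw [← hB _ (hfstσ' P hPe')]; linarith
    have hP₁ : P ∈ hull f₁ := mem_hull_filter_zero hPf _ (fun Q hQ => by
      have hQe := mem_hull (hf hQ)
      rw [depthBelow_apply, ← hA _ (hfstσ Q hQe)]
      linarith [(hbe Q hQe).2.2]) (by rw [depthBelow_apply]; linarith)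
    have hP₂ : P ∈ hull f₂ := mem_hull_filter_zero hPf' _ (fun Q hQ => by
      have hQe := mem_hull (hf' hQ)
      rw [AffineMap.coe_neg, Pi.neg_apply, depthBelow_apply, ← hB _ (hfstσ' Q hQe)]
      linarith [(hbe' Q hQe).2.1]) (by
        rw [AffineMap.coe_neg, Pi.neg_apply, depthBelow_apply]; linarith)
    have hPu : P.1 ∈ hull u := by
      rw [← hab]; exact ⟨fst_mem_hull_image hP₁, fst_mem_hull_image hP₂⟩
    have hPu₀ : P.1 ∈ hull u₀ := mem_hull_filter_zero hPu (B - A) (fun v hv => by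
      simpa using hle v (mem_hull hv)) (by simp only [AffineMap.coe_sub, Pi.sub_apply]; linarith)
    exact (mem_hull_graph_iff (fun v _ => rfl)).2 ⟨hPu₀, hPB⟩
  · intro P hP
    obtain ⟨hPu, hPB⟩ := (mem_hull_graph_iff (fun v _ => rfl)).1 hP
    have hPa := (huab (hull_mono (Finset.filter_subset _ _) hPu)).1
    have hAB : B P.1 = A P.1 := affine_eq_on_hull B A hu₀AB hPu
    have := (mem_hull_graph_iff (s := a) (τ := A) (A := A) (fun v _ => rfl)).2
      ⟨hPa, hPB.trans hAB⟩
    refine hull_mono ?_ this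
    intro Q hQ
    obtain ⟨v, hv, rfl⟩ := Finset.mem_image.1 hQ
    exact hmem_a v hv
  · intro P hP
    obtain ⟨hPu, hPB⟩ := (mem_hull_graph_iff (fun v _ => rfl)).1 hP
    have hPb := (huab (hull_mono (Finset.filter_subset _ _) hPu)).2
    have := (mem_hull_graph_iff (s := b) (τ := B) (A := B) (fun v _ => rfl)).2 ⟨hPb, hPB⟩
    refine hull_mono ?_ this
    intro Q hQ
    obtain ⟨v, hv, rfl⟩ := Finset.mem_image.1 hQ
    exact hmem_b v hv

theorem isSimplicialFamily : IsSimplicialFamily K (⋃ i, new i) where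
  card e he := by
    obtain ⟨i, hi⟩ := mem_iUnion.1 he
    exact H.element_card hi
  indep e he := by
    obtain ⟨i, hi⟩ := mem_iUnion.1 he
    exact H.element_indep hi
  nonoverlapping e he e' he' hne := by
    obtain ⟨i, hi⟩ := mem_iUnion.1 he
    obtain ⟨j, hj⟩ := mem_iUnion.1 he'
    rcases lt_trichotomy i j with hij | rfl | hij
    · exact H.disjoint_interior_of_lt hij hi hj
    · exact H.disjoint_interior_same hi hj hne
    · exact (H.disjoint_interior_of_lt hij hj hi).symm
  nonneg e he P hP := by
    obtain ⟨i, hi⟩ := mem_iUnion.1 he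
    have := H.bounds_of_mem_hull hi hP
    exact (H.nonneg i this.1).trans this.2.1
  lies_over e he := by
    obtain ⟨i, hi⟩ := mem_iUnion.1 he
    obtain ⟨ρ, hρ, hsub⟩ := H.element_over hi
    refine ⟨ρ, hρ, ?_⟩
    rintro _ ⟨P, hP, rfl⟩
    exact hsub P hP
  weakComplex := by
    refine ⟨?_, ?_, ?_⟩
    · rintro s ⟨e, he, hse⟩
      obtain ⟨i, hi⟩ := mem_iUnion.1 he
      exact affineIndependent_subset (H.element_indep hi) hse
    · rintro s ⟨e, he, hse⟩ t hts
      exact ⟨e, he, hts.trans hse⟩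
    · rintro s ⟨e, he, hse⟩ t ⟨e', he', hte⟩
      obtain ⟨i, hi⟩ := mem_iUnion.1 he
      obtain ⟨j, hj⟩ := mem_iUnion.1 he'
      rcases lt_trichotomy i j with hij | rfl | hij
      · exact H.inter_of_lt hij hi hj hse hte
      · exact H.inter_same hi hj hse hte
      · obtain ⟨u, hu, hEq⟩ := H.inter_of_lt hij hj hi hte hse
        exact ⟨u, hu.symm, by rw [inter_comm, hEq]⟩

/-- The facet is the part of the new front over the base. The element lies below its graph, and the
facet stays in the region where `S` is at least `s`. -/
theorem exists_causalOutflowFacet {s : ℝ} {S : SpaceTime d → ℝ}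
    (hS : ∀ P ∈ K.space ×ˢ Ici (0 : ℝ), s ≤ S P)
    (hg : ∀ i, (new i).Nonempty → ∀ σ ∈ C i, ∃ g, IsGradient (advance (h i) (p i) (δ i)) σ g ∧
      ‖g‖ < s) {e : Finset (SpaceTime d)} (he : e ∈ ⋃ i, new i) :
    ∃ F, IsCausalOutflowFacet S e F := by
  classical
  obtain ⟨i, hi⟩ := mem_iUnion.1 he
  have hbd := fun P (hP : P ∈ hull e) => H.bounds_of_mem_hull hi hP
  have hcard := H.element_card hi
  obtain ⟨hδ, σ, hσ, hp, rfl⟩ := H.exists_base hi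
  obtain ⟨g, ⟨-, hgrad⟩, hgs⟩ := hg i ⟨_, hi⟩ σ hσ
  set τ' := advance (h i) (p i) (δ i) with hτ'
  have hFsub : (σ.image fun v => (v, τ' v)) ⊆ tentElement (h i) (p i) (δ i) σ := by
    intro Q hQ
    obtain ⟨v, hv, rfl⟩ := Finset.mem_image.1 hQ
    exact graph_advance_subset_tentElement hv
  refine ⟨σ.image fun v => (v, τ' v), hFsub, ?_, g, τ' (p i) - inner ℝ g (p i), ?_, ?_, ?_⟩
  · rw [hcard, Finset.card_image_of_injective _ (fun u v h => congrArg Prod.fst h), H.card i σ hσ]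
  · intro P hP
    obtain ⟨v, hv, rfl⟩ := Finset.mem_image.1 hP
    have := hgrad (p i) hp v hv
    rw [inner_sub_right] at this
    simp only
    linarith
  · let A : Space d →ᵃ[ℝ] ℝ := (innerSL ℝ g).toLinearMap.toAffineMap +
      AffineMap.const ℝ (Space d) (τ' (p i) - inner ℝ g (p i))
    have hA : ∀ x, A x = inner ℝ g x + (τ' (p i) - inner ℝ g (p i)) := fun x => rfl
    have hAτ : ∀ v ∈ σ, A v = τ' v := fun v hv => by
      have := hgrad (p i) hp v hv
      rw [inner_sub_right] at this
      rw [hA]; linarith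
    intro P hP
    rw [← hA]
    obtain ⟨B, hB⟩ := H.affine i σ hσ
    exact ((mem_hull_tentElement_iff hδ.le hp (fun v hv => (hB v (mem_hull hv)).symm) hAτ).1 hP).2.2
  · intro P hP
    have := hbd P (hull_mono hFsub hP)
    exact hgs.trans_le (hS P ⟨this.1, (H.nonneg i this.1).trans this.2.1⟩)

/-- The first front that is strictly above `t` at `x` is not the initial one, and the step that
leads to it sweeps over the point. -/
theorem exists_element_of_lt {n : ℕ} {x : Space d} (hx : x ∈ K.space) {t : ℝ} (ht0 : 0 ≤ t)
    (htn : t < h n x) : ∃ i < n, ∃ e ∈ new i, (x, t) ∈ hull e := by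
  classical
  have hex : ∃ m, t < h m x := ⟨n, htn⟩
  obtain ⟨m, hm, hmin⟩ : ∃ m, t < h m x ∧ ∀ k < m, ¬ t < h k x :=
    ⟨Nat.find hex, Nat.find_spec hex, fun k hk => Nat.find_min hex hk⟩
  have hmn : m ≤ n := by
    by_contra hlt
    exact hmin n (not_le.1 hlt) htn
  cases m with
  | zero => rw [H.init x hx] at hm; linarith
  | succ i =>
    have hi : h i x ≤ t := not_lt.1 (hmin i (Nat.lt_succ_self i))
    refine ⟨i, hmn, ?_⟩
    rcases H.step i with ⟨-, hEq⟩ | ⟨hδ, hnew, hnext⟩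
    · rw [hEq x hx] at hm; linarith
    · obtain ⟨σ, hσ, hxσ⟩ := H.cover i x hx
      obtain ⟨A, hA⟩ := H.affine i σ hσ
      obtain ⟨hadv, A', hA'⟩ := hnext σ hσ
      -- Otherwise the front over `σ` would not have moved.
      have hpσ : p i ∈ σ := by
        by_contra hpn
        have : A' x = A x := affine_eq_on_hull A' A (fun v hv => by
          rw [← hA' v (mem_hull hv), ← hA v (mem_hull hv), hadv v hv, advance_of_ne]
          rintro rfl; exact hpn hv) hxσ
        rw [hA' x hxσ, this, ← hA x hxσ] at hm
        linarith
      have he : tentElement (h i) (p i) (δ i) σ ∈ new i := by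
        rw [hnew]; exact ⟨σ, hσ, hpσ, rfl⟩
      exact ⟨_, he, (H.mem_hull_iff ⟨_, he⟩ hσ subset_rfl hpσ).2 ⟨hxσ, hi, hm.le⟩⟩

/-- The carrier of `P` in the element serves for both kinds of conformity. The total barycentric
weight outside `f` is nonnegative on the element and zero at `P`, hence zero on the carrier; the
same holds for the time coordinate if `P` is at time zero. -/
theorem isUnionOf_of_mem {f : Finset (Space d)} (hf : f ∈ K.faces) {i : ℕ}
    {e : Finset (SpaceTime d)} (he : e ∈ new i) {P : SpaceTime d} (hP : P ∈ hull e)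
    (hPf : P.1 ∈ hull f) :
    ∃ g ⊆ e, P ∈ hull g ∧ hull g ⊆ hull f ×ˢ Ici (0 : ℝ) ∧
      (P.2 = 0 → hull g ⊆ hull f ×ˢ {(0 : ℝ)}) := by
  classical
  obtain ⟨ρ, hρ, hsub⟩ := H.element_over he
  have hnn : ∀ Q ∈ hull e, 0 ≤ Q.2 := fun Q hQ =>
    H.isSimplicialFamily.nonneg e (mem_iUnion.2 ⟨i, he⟩) Q hQ
  obtain ⟨g, hge, hPg, hg⟩ := exists_carrier hP
  have hPρ : P.1 ∈ hull (f ∩ ρ) := by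
    rw [hull, Finset.coe_inter]; exact K.inter_subset_convexHull hf hρ ⟨hPf, hsub P hP⟩
  -- the sum of the barycentric coordinates of the vertices of `ρ` outside `f`
  obtain ⟨ζ, hζ⟩ := exists_affine_interpolant (K.indep hρ) (fun v => if v ∈ f then 0 else 1)
  let ℓ : SpaceTime d →ᵃ[ℝ] ℝ := ζ.comp (LinearMap.fst ℝ (Space d) ℝ).toAffineMap
  have hℓ : ∀ Q, ℓ Q = ζ Q.1 := fun Q => rfl
  have hζnn : ∀ v ∈ ρ, 0 ≤ ζ v := fun v hv => by
    rw [hζ v hv]; split_ifs <;> norm_num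
  have hℓP : ℓ P = 0 := by
    rw [hℓ]
    have := affine_eq_on_hull ζ (AffineMap.const ℝ _ 0) (f := f ∩ ρ) (fun v hv => by
      rw [Finset.mem_inter] at hv
      rw [hζ v hv.2, if_pos hv.1]; rfl) hPρ
    simpa using this
  have hgf : ∀ Q ∈ g, Q.1 ∈ hull f := fun Q hQ => by
    have h0 := hg ℓ (fun R hR => affine_nonneg_on_hull ζ hζnn (hsub R (mem_hull hR))) hℓP Q hQ
    have := mem_hull_filter_zero (hsub Q (mem_hull (hge hQ))) ζ hζnn h0
    refine hull_mono ?_ this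
    intro v hv
    rw [Finset.mem_filter] at hv
    by_contra hvf
    have := hζ v hv.1
    rw [if_neg hvf, hv.2] at this
    norm_num at this
  have hgfst : ∀ Q ∈ hull g, Q.1 ∈ hull f := fun Q hQ => by
    have h1 := fst_mem_hull_image hQ
    refine convexHull_min ?_ (convex_convexHull ℝ _) h1
    intro v hv
    obtain ⟨R, hR, rfl⟩ := Finset.mem_image.1 (Finset.mem_coe.1 hv)
    exact hgf R hR
  refine ⟨g, hge, hPg, fun Q hQ => ⟨hgfst Q hQ, hnn Q (hull_mono hge hQ)⟩, fun hP0 Q hQ =>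
    ⟨hgfst Q hQ, ?_⟩⟩
  let T : SpaceTime d →ᵃ[ℝ] ℝ := (LinearMap.snd ℝ (Space d) ℝ).toAffineMap
  have h0 := hg T (fun R hR => hnn R (mem_hull hR)) hP0
  have := affine_eq_on_hull T (AffineMap.const ℝ _ 0) (fun v hv => by simpa using h0 v hv) hQ
  exact this

theorem finite_new (hfin : ∀ i, (C i).Finite) (i : ℕ) : (new i).Finite := by
  rcases H.step i with ⟨hnew, -⟩ | ⟨hδ, hnew, -⟩
  · rw [hnew]; exact finite_empty
  · rw [hnew]
    refine ((hfin i).image (fun σ => tentElement (h i) (p i) (δ i) σ)).subset ?_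
    rintro e ⟨σ, hσ, -, rfl⟩
    exact ⟨σ, hσ, rfl⟩

/-- The tentpole is a vertical segment of length `δ i` in the element. The duration is at most `B`,
and positive because the element has interior points. -/
theorem temporalAspectRatio_ge {η B : ℝ} (hη : 0 < η) {i : ℕ} {e : Finset (SpaceTime d)}
    (he : e ∈ new i) (hδη : η ≤ δ i) (hB : ∀ P ∈ hull e, ∀ Q ∈ hull e, |P.2 - Q.2| ≤ B) :
    η / B ≤ temporalAspectRatio e := by
  have hcard := H.element_card he
  have hind := H.element_indep he
  have hcpt : IsCompact (hull e) := e.finite_toSet.isCompact_convexHull ℝ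
  have hB0 : 0 ≤ B := by
    obtain ⟨P, hP⟩ : (hull e).Nonempty := by
      rw [hull, convexHull_nonempty_iff]
      exact Finset.card_pos.1 (by omega)
    simpa using hB P hP P hP
  have hheight : η ≤ height (hull e) := by
    refine le_csSup ⟨B, ?_⟩ ⟨hη.le, ?_⟩
    · rintro L ⟨hL, x, a, hx⟩
      rw [hcpt.isClosed.closure_eq] at hx
      have := hB _ (hx (a + L) ⟨by linarith, le_rfl⟩) _ (hx a ⟨le_rfl, by linarith⟩)
      simp only [add_sub_cancel_left] at this
      exact (le_abs_self L).trans this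
    · rw [hcpt.isClosed.closure_eq]
      obtain ⟨hδ, σ, hσ, hp, rfl⟩ := H.exists_base he
      obtain ⟨hadv, -⟩ := H.exists_affine_next he hσ
      refine ⟨p i, h i (p i), fun t ht => ?_⟩
      refine (H.mem_hull_iff ⟨_, he⟩ hσ subset_rfl hp).2 ⟨mem_hull hp, ht.1, ?_⟩
      rw [hadv _ hp, advance_self]
      linarith [ht.2]
  have hint : (interior (hull e)).Nonempty := interior_hull_nonempty (d := d + 1) (by simp) hcard hind
  have hdur : duration (hull e) ≤ B := by
    refine Metric.diam_le_of_forall_dist_le hB0 ?_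
    rintro _ ⟨P, hP, rfl⟩ _ ⟨Q, hQ, rfl⟩
    exact hB P (interior_subset hP) Q (interior_subset hQ)
  have hdur0 : 0 < duration (hull e) := by
    have hopen : IsOpen (Prod.snd '' interior (hull e)) := isOpenMap_snd _ isOpen_interior
    obtain ⟨P, hP⟩ := hint
    obtain ⟨r, hr, hball⟩ := Metric.isOpen_iff.1 hopen P.2 (mem_image_of_mem _ hP)
    have hbdd : Bornology.IsBounded (Prod.snd '' interior (hull e)) :=
      ((hcpt.image continuous_snd).isBounded).subset (image_mono interior_subset)
    have hin : P.2 + r / 2 ∈ Prod.snd '' interior (hull e) := hball (by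
      rw [Metric.mem_ball, Real.dist_eq, add_sub_cancel_left, abs_of_pos] <;> linarith)
    have := Metric.dist_le_diam_of_mem hbdd hin (mem_image_of_mem _ hP)
    rw [Real.dist_eq, add_sub_cancel_left, abs_of_pos (by linarith)] at this
    exact lt_of_lt_of_le (by linarith) this
  unfold temporalAspectRatio
  exact div_le_div₀ (hη.le.trans hheight) hheight hdur0 hdur

theorem meshCriteria {s η B : ℝ} {S : SpaceTime d → ℝ}
    (hS : ∀ P ∈ K.space ×ˢ Ici (0 : ℝ), s ≤ S P)
    (hg : ∀ i, (new i).Nonempty → ∀ σ ∈ C i, ∃ g, IsGradient (advance (h i) (p i) (δ i)) σ g ∧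
      ‖g‖ < s) (hfin : ∀ i, (C i).Finite) (hη : 0 < η) (hδη : ∀ i, (new i).Nonempty → η ≤ δ i)
    (hB : ∀ i, ∀ e ∈ new i, ∀ P ∈ hull e, ∀ Q ∈ hull e, |P.2 - Q.2| ≤ B)
    (hT : ∀ T : ℝ, ∃ n, ∀ x ∈ K.space, T ≤ h n x) :
    MeshCriteria K S (η / B) (⋃ i, new i) where
  family := H.isSimplicialFamily
  covers := by
    ext P
    simp only [mem_iUnion, exists_prop, mem_prod, mem_Ici]
    constructor
    · rintro ⟨e, ⟨i, hi⟩, hP⟩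
      have := H.bounds_of_mem_hull hi hP
      exact ⟨this.1, (H.nonneg i this.1).trans this.2.1⟩
    · rintro ⟨hx, ht⟩
      -- The extra unit provides the strict inequality needed to find an element through `P`.
      obtain ⟨n, hn⟩ := hT (P.2 + 1)
      obtain ⟨i, -, e, he, hP⟩ := H.exists_element_of_lt hx ht
        (lt_of_lt_of_le (lt_add_one P.2) (hn P.1 hx))
      exact ⟨e, ⟨i, he⟩, hP⟩
  conforms_initial f hf P hP := by
    have hx : P.1 ∈ K.space := K.convexHull_subset_space hf hP.1
    have hP0 : P.2 = 0 := hP.2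
    obtain ⟨n, hn⟩ := hT (P.2 + 1)
    obtain ⟨i, -, e, he, hPe⟩ := H.exists_element_of_lt hx hP0.ge
      (lt_of_lt_of_le (lt_add_one P.2) (hn P.1 hx))
    obtain ⟨g, hge, hPg, -, hg0⟩ := H.isUnionOf_of_mem hf he hPe hP.1
    exact ⟨g, ⟨e, mem_iUnion.2 ⟨i, he⟩, hge⟩, hPg, hg0 hP0⟩
  conforms_column f hf P hP := by
    have hx : P.1 ∈ K.space := K.convexHull_subset_space hf hP.1
    obtain ⟨n, hn⟩ := hT (P.2 + 1)
    obtain ⟨i, -, e, he, hPe⟩ := H.exists_element_of_lt hx hP.2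
      (lt_of_lt_of_le (lt_add_one P.2) (hn P.1 hx))
    obtain ⟨g, hge, hPg, hg, -⟩ := H.isUnionOf_of_mem hf he hPe hP.1
    exact ⟨g, ⟨e, mem_iUnion.2 ⟨i, he⟩, hge⟩, hPg, hg⟩
  causal_outflow e he := H.exists_causalOutflowFacet hS hg he
  finite_prefix T hT0 := by
    obtain ⟨n, hn⟩ := hT (T + 1)
    refine ⟨⋃ i ∈ Iio n, new i, ?_, (finite_Iio n).biUnion fun i _ => H.finite_new hfin i, ?_⟩
    · intro e he
      simp only [mem_iUnion, exists_prop] at he ⊢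
      obtain ⟨i, -, hi⟩ := he
      exact ⟨i, hi⟩
    · rintro P ⟨hx, ht⟩
      obtain ⟨i, hi, e, he, hPe⟩ := H.exists_element_of_lt hx ht.1
        (lt_of_le_of_lt ht.2 (lt_of_lt_of_le (lt_add_one T) (hn P.1 hx)))
      simp only [mem_iUnion, exists_prop, mem_Iio]
      exact ⟨e, ⟨i, hi, he⟩, hPe⟩
  aspect e he := by
    obtain ⟨i, hi⟩ := mem_iUnion.1 he
    exact H.temporalAspectRatio_ge hη hi (hδη i ⟨e, hi⟩) (hB i e hi)

/-- If infinitely many steps advance a vertex from a finite set by at least `η`, and the spread of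
the fronts is bounded, then the fronts tend to infinity. -/
theorem exists_forall_le {η B : ℝ} (hη : 0 < η) (V : Finset (Space d)) (hV : ↑V ⊆ K.space)
    (hact : ∀ n, ∃ i ≥ n, (new i).Nonempty ∧ p i ∈ V ∧ η ≤ δ i)
    (hB : ∀ i, ∀ x ∈ K.space, ∀ y ∈ K.space, h i x ≤ h i y + B) (T : ℝ) :
    ∃ n, ∀ x ∈ K.space, T ≤ h n x := by
  have hmono : ∀ i j, i ≤ j → ∑ v ∈ V, h i v ≤ ∑ v ∈ V, h j v := fun i j hij =>
    Finset.sum_le_sum fun v hv => H.le_of_le hij (hV hv)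
  -- The sum of the front over `V` never decreases and gains at least `η` in each of the infinitely
  -- many active steps.
  have hgrow : ∀ k : ℕ, ∃ n, k * η ≤ ∑ v ∈ V, h n v := by
    intro k
    induction k with
    | zero => exact ⟨0, by simpa using Finset.sum_nonneg fun v hv => H.nonneg 0 (hV hv)⟩
    | succ k ih =>
      obtain ⟨n, hn⟩ := ih
      obtain ⟨i, hi, ⟨e, he⟩, hpV, hδ⟩ := hact n
      refine ⟨i + 1, ?_⟩
      have h1 := hmono n i hi
      obtain ⟨-, σ, hσ, hp, -⟩ := H.exists_base he
      have hadv := (H.exists_affine_next he hσ).1 _ hp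
      rw [advance_self] at hadv
      have h2 : ∑ v ∈ V, h i v + η ≤ ∑ v ∈ V, h (i + 1) v := by
        rw [← Finset.add_sum_erase V _ hpV, ← Finset.add_sum_erase V (fun v => h (i + 1) v) hpV]
        have : ∑ v ∈ V.erase (p i), h i v ≤ ∑ v ∈ V.erase (p i), h (i + 1) v :=
          Finset.sum_le_sum fun v hv => H.le_succ i (hV (Finset.mem_of_mem_erase hv))
        rw [hadv]
        linarith
      push_cast
      linarith
  have hVne : V.Nonempty := by
    obtain ⟨i, -, -, hp, -⟩ := hact 0
    exact ⟨_, hp⟩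
  -- A point still below `T` would, by the bound on the spread, keep all of `V` below `T + B`, and
  -- so the sum below `V.card * (T + B)`.
  obtain ⟨k, hk⟩ := exists_nat_gt (V.card * (T + B) / η)
  obtain ⟨n, hn⟩ := hgrow k
  refine ⟨n, fun x hx => ?_⟩
  by_contra hlt
  push Not at hlt
  have h1 : ∑ v ∈ V, h n v ≤ ∑ _v ∈ V, (T + B) := Finset.sum_le_sum fun v hv => by
    have := hB n v (hV hv) x hx
    linarith
  rw [Finset.sum_const, nsmul_eq_mul] at h1
  rw [div_lt_iff₀ hη] at hk
  linarith

end IsFrontSequence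

/-! ### The piecewise linear interpolation of a front -/

section FrontValue

variable {d : ℕ}

open scoped Classical in
/-- The value at `x` of the piecewise linear interpolation of the times `τ` over the
triangulation `C`. -/
noncomputable def frontValue (C : Set (Finset (Space d))) (τ : Space d → ℝ) (x : Space d) : ℝ :=
  if hx : ∃ t, ∃ σ ∈ C, ∃ A : Space d →ᵃ[ℝ] ℝ, (∀ v ∈ σ, A v = τ v) ∧ x ∈ hull σ ∧ A x = t then
    hx.choose else 0

/-- The simplex chosen in the definition is irrelevant: two simplices through `x` share a face that
contains `x`, on which the interpolants agree. -/
theorem frontValue_eq {C : Set (Finset (Space d))}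
    (hC : ∀ σ ∈ C, ∀ σ' ∈ C, hull σ ∩ hull σ' ⊆ convexHull ℝ ((σ : Set (Space d)) ∩ σ'))
    {τ : Space d → ℝ} {σ : Finset (Space d)} (hσ : σ ∈ C) {A : Space d →ᵃ[ℝ] ℝ}
    (hA : ∀ v ∈ σ, A v = τ v) {x : Space d} (hx : x ∈ hull σ) : frontValue C τ x = A x := by
  classical
  have hex : ∃ t, ∃ σ ∈ C, ∃ A : Space d →ᵃ[ℝ] ℝ, (∀ v ∈ σ, A v = τ v) ∧ x ∈ hull σ ∧ A x = t :=
    ⟨A x, σ, hσ, A, hA, hx, rfl⟩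
  rw [frontValue, dif_pos hex]
  obtain ⟨σ', hσ', A', hA', hx', ht⟩ := hex.choose_spec
  rw [← ht]
  have hmem : x ∈ hull (σ ∩ σ') := by
    rw [hull, Finset.coe_inter]; exact hC σ hσ σ' hσ' ⟨hx, hx'⟩
  refine affine_eq_on_hull A' A (fun v hv => ?_) hmem
  rw [Finset.mem_inter] at hv
  rw [hA v hv.1, hA' v hv.2]

theorem frontValue_vertex {C : Set (Finset (Space d))}
    (hC : ∀ σ ∈ C, ∀ σ' ∈ C, hull σ ∩ hull σ' ⊆ convexHull ℝ ((σ : Set (Space d)) ∩ σ'))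
    {τ : Space d → ℝ} {σ : Finset (Space d)} (hσ : σ ∈ C)
    (hind : AffineIndependent ℝ ((↑) : σ → Space d)) {v : Space d} (hv : v ∈ σ) :
    frontValue C τ v = τ v := by
  obtain ⟨A, hA⟩ := exists_affine_interpolant hind τ
  rw [frontValue_eq hC hσ hA (mem_hull hv), hA v hv]

end FrontValue

/-! ### Spread of a front over a connected domain -/

/-- Let `S k` be the set of vertices with time at most `τ v + k * b`. As long as `S (k + 1)` is
incomplete, the simplices that meet `S k` and those that do not form two nonempty closed sets
covering the connected domain. These sets touch, conformity gives a common vertex, and this vertex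
is in `S (k + 1)` but not in `S k`. So the sets grow until nothing is missing, after at most
`V.card` rounds. -/
theorem spread_le_of_isPreconnected {d : ℕ} {C : Set (Finset (Space d))} (hfin : C.Finite)
    (hC : ∀ σ ∈ C, ∀ σ' ∈ C, hull σ ∩ hull σ' ⊆ convexHull ℝ ((σ : Set (Space d)) ∩ σ'))
    (hconn : IsPreconnected (⋃ σ ∈ C, hull σ)) {τ : Space d → ℝ} {b : ℝ}
    (hb : ∀ σ ∈ C, ∀ u ∈ σ, ∀ v ∈ σ, τ u ≤ τ v + b) {V : Finset (Space d)}
    (hV : ∀ σ ∈ C, σ ⊆ V) {σ₁ σ₂ : Finset (Space d)} (hσ₁ : σ₁ ∈ C) (hσ₂ : σ₂ ∈ C) {u v : Space d}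
    (hu : u ∈ σ₁) (hv : v ∈ σ₂) : τ u ≤ τ v + V.card * b := by
  classical
  have hb0 : 0 ≤ b := by linarith [hb σ₁ hσ₁ u hu u hu]
  let W := V.filter fun w => ∃ σ ∈ C, w ∈ σ
  let S : ℕ → Finset (Space d) := fun k => W.filter fun w => τ w ≤ τ v + k * b
  have hW : ∀ σ ∈ C, ∀ w ∈ σ, w ∈ W := fun σ hσ w hw =>
    Finset.mem_filter.2 ⟨hV σ hσ hw, σ, hσ, hw⟩
  have hmono : ∀ k, S k ⊆ S (k + 1) := fun k w hw => by
    simp only [S, Finset.mem_filter] at hw ⊢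
    refine ⟨hw.1, hw.2.trans ?_⟩
    push_cast
    linarith
  have key : ∀ k, S k = W ∨ k + 1 ≤ (S k).card := by
    intro k
    induction k with
    | zero =>
      right
      refine Finset.card_pos.2 ⟨v, Finset.mem_filter.2 ⟨hW σ₂ hσ₂ v hv, by simp⟩⟩
    | succ k ih =>
      rcases ih with hk | hk
      · left
        exact subset_antisymm (Finset.filter_subset _ _) (by rw [← hk]; exact hmono k)
      by_cases hSW : S (k + 1) = W
      · exact Or.inl hSW
      right
      suffices ∃ w ∈ S (k + 1), w ∉ S k by
        obtain ⟨w, hw, hw'⟩ := this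
        have := Finset.card_lt_card ⟨hmono k, fun hle => hw' (hle hw)⟩
        omega
      have hvS : v ∈ S k := Finset.mem_filter.2 ⟨hW σ₂ hσ₂ v hv, by
        have : 0 ≤ (k : ℝ) * b := by positivity
        linarith⟩
      let M₁ := ⋃ σ ∈ {σ ∈ C | ∃ w ∈ σ, w ∈ S k}, hull σ
      let M₂ := ⋃ σ ∈ {σ ∈ C | ∀ w ∈ σ, w ∉ S k}, hull σ
      have hclosed : ∀ C' : Set (Finset (Space d)), C' ⊆ C → IsClosed (⋃ σ ∈ C', hull σ) :=
        fun C' hC' => (hfin.subset hC').isClosed_biUnion fun σ _ =>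
          (σ.finite_toSet.isCompact_convexHull ℝ).isClosed
      obtain ⟨w₀, hw₀W, hw₀⟩ : ∃ w ∈ W, w ∉ S (k + 1) := by
        by_contra hcon
        push Not at hcon
        exact hSW (subset_antisymm (Finset.filter_subset _ _) hcon)
      obtain ⟨-, σ₀, hσ₀, hw₀σ⟩ := Finset.mem_filter.1 hw₀W
      have hσ₀S : ∀ w ∈ σ₀, w ∉ S k := fun w hw hwS => by
        refine hw₀ (Finset.mem_filter.2 ⟨hw₀W, ?_⟩)
        have := (Finset.mem_filter.1 hwS).2
        have := hb σ₀ hσ₀ w₀ hw₀σ w hw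
        push_cast
        linarith
      obtain ⟨x, -, hx₁, hx₂⟩ := isPreconnected_closed_iff.1 hconn M₁ M₂
        (hclosed _ fun σ hσ => hσ.1) (hclosed _ fun σ hσ => hσ.1)
        (by
          intro x hx
          simp only [mem_iUnion, exists_prop] at hx
          obtain ⟨σ, hσ, hxσ⟩ := hx
          by_cases hS : ∃ w ∈ σ, w ∈ S k
          · exact Or.inl (mem_biUnion (x := σ) ⟨hσ, hS⟩ hxσ)
          · push Not at hS
            exact Or.inr (mem_biUnion (x := σ) ⟨hσ, hS⟩ hxσ))
        ⟨v, mem_biUnion hσ₂ (mem_hull hv), mem_biUnion (x := σ₂) ⟨hσ₂, v, hv, hvS⟩ (mem_hull hv)⟩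
        ⟨w₀, mem_biUnion hσ₀ (mem_hull hw₀σ), mem_biUnion (x := σ₀) ⟨hσ₀, hσ₀S⟩ (mem_hull hw₀σ)⟩
      simp only [M₁, M₂, mem_iUnion, exists_prop] at hx₁ hx₂
      obtain ⟨σ, ⟨hσ, y, hyσ, hyS⟩, hxσ⟩ := hx₁
      obtain ⟨σ', ⟨hσ', hσ'S⟩, hxσ'⟩ := hx₂
      obtain ⟨w, hwσ, hwσ'⟩ := convexHull_nonempty_iff.1 ⟨x, hC σ hσ σ' hσ' ⟨hxσ, hxσ'⟩⟩
      refine ⟨w, Finset.mem_filter.2 ⟨hW σ hσ w hwσ, ?_⟩, hσ'S w hwσ'⟩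
      have := (Finset.mem_filter.1 hyS).2
      have := hb σ hσ w hwσ y hyσ
      push_cast
      linarith
  have hfinal : S V.card = W := by
    refine (key V.card).resolve_right fun hcard => ?_
    have : (S V.card).card ≤ V.card :=
      Finset.card_le_card ((Finset.filter_subset _ _).trans (Finset.filter_subset _ _))
    omega
  have huS : u ∈ S V.card := by rw [hfinal]; exact hW σ₁ hσ₁ u hu
  exact (Finset.mem_filter.1 huS).2

/-- The set of admissible values contains one that is nearly maximal. -/
theorem exists_pos_near_max {Adm : Set ℝ} {η B κ : ℝ} (hη : 0 < η) (hηA : η ∈ Adm)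
    (hB : ∀ δ ∈ Adm, δ ≤ B) (hκ0 : 0 < κ) (hκ : κ < 1) :
    ∃ δ ∈ Adm, 0 < δ ∧ ∀ δ' ∈ Adm, κ * δ' ≤ δ := by
  have hbdd : BddAbove Adm := ⟨B, hB⟩
  have hpos : 0 < sSup Adm := hη.trans_le (le_csSup hbdd hηA)
  -- `κ < 1` leaves room below the supremum, which need not be attained.
  obtain ⟨δ, hδ, hlt⟩ := exists_lt_of_lt_csSup ⟨η, hηA⟩ (show κ * sSup Adm < sSup Adm by nlinarith)
  refine ⟨δ, hδ, lt_trans (by positivity) hlt, fun δ' hδ' => ?_⟩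
  exact (mul_le_mul_of_nonneg_left (le_csSup hbdd hδ') hκ0.le).trans hlt.le

/-! ### Gradients -/

section Gradient

variable {d : ℕ}

theorem IsGradient.abs_sub_le {τ : Space d → ℝ} {f : Finset (Space d)} {g : Space d}
    (hg : IsGradient τ f g) {u v : Space d} (hu : u ∈ f) (hv : v ∈ f) :
    |τ v - τ u| ≤ ‖g‖ * dist u v := by
  rw [hg.2 u hu v hv, dist_eq_norm, ← norm_neg (u - v), neg_sub]
  exact abs_real_inner_le_norm g (v - u)

theorem IsGradient.congr {τ τ' : Space d → ℝ} {f : Finset (Space d)} {g : Space d}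
    (hg : IsGradient τ f g) (h : ∀ v ∈ f, τ v = τ' v) : IsGradient τ' f g :=
  ⟨hg.1, fun u hu v hv => by rw [← h u hu, ← h v hv]; exact hg.2 u hu v hv⟩

theorem isGradient_zero (f : Finset (Space d)) : IsGradient (fun _ => 0) f 0 :=
  ⟨Submodule.zero_mem _, fun u _ v _ => by simp⟩

theorem IsGradient.inner_eq_of_mem_vectorSpan {τ : Space d → ℝ} {f f' : Finset (Space d)}
    {g g' : Space d} (hg : IsGradient τ f g) (hg' : IsGradient τ f' g') (hf : f' ⊆ f)
    {x : Space d} (hx : x ∈ vectorSpan ℝ (f' : Set (Space d))) : inner ℝ g x = inner ℝ g' x := by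
  unfold vectorSpan at hx
  induction hx using Submodule.span_induction with
  | mem x hx =>
    obtain ⟨v, hv, u, hu, rfl⟩ := hx
    simp only [vsub_eq_sub]
    rw [← hg.2 u (hf hu) v (hf hv), ← hg'.2 u hu v hv]
  | zero => simp
  | add x y _ _ hx hy => rw [inner_add_right, inner_add_right, hx, hy]
  | smul c x _ hx => rw [inner_smul_right, inner_smul_right, hx]

/-- Advancing the lowest vertex of a simplex whose opposite facet has moderate slope. The slope
of the simplex decreases, or it is bounded in terms of the progress. -/
theorem exists_gradient_advance {f : Finset (Space d)} [DecidableEq (Space d)]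
    (hf : AffineIndependent ℝ ((↑) : f → Space d)) {p : Space d} (hp : p ∈ f)
    (hne : (f.erase p).Nonempty) {τ : Space d → ℝ} {gΔ g : Space d}
    (hgΔ : IsGradient τ (f.erase p) gΔ) (hg : IsGradient τ f g) {β : ℝ}
    (hslope : ‖gΔ‖ * Metric.infDist p (hull (f.erase p)) ≤
      β * Metric.infDist p (affineSpan ℝ (f.erase p : Set (Space d))))
    (hmin : ∀ q ∈ f, τ p ≤ τ q) {δ : ℝ} (hδ : 0 ≤ δ) :
    0 < Metric.infDist p (affineSpan ℝ (f.erase p : Set (Space d))) ∧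
    ∃ g', IsGradient (advance τ p δ) f g' ∧
      (‖g'‖ ≤ ‖g‖ ∨
        ‖g'‖ ≤ β + δ / Metric.infDist p (affineSpan ℝ (f.erase p : Set (Space d)))) := by
  obtain ⟨q, hq⟩ := hne
  set E := affineSpan ℝ (f.erase p : Set (Space d)) with hE
  have hqE : q ∈ E := subset_affineSpan ℝ _ hq
  have : Nonempty E := ⟨⟨q, hqE⟩⟩
  set pb : Space d := ((EuclideanGeometry.orthogonalProjection E p : E) : Space d) with hpb
  have hpbE : pb ∈ E := EuclideanGeometry.orthogonalProjection_mem p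
  have hdir : E.direction = vectorSpan ℝ (f.erase p : Set (Space d)) := direction_affineSpan _ _
  set n := p - pb with hn
  have hnperp : ∀ x ∈ vectorSpan ℝ (f.erase p : Set (Space d)), inner ℝ n x = 0 := fun x hx => by
    rw [← hdir] at hx
    have := EuclideanGeometry.vsub_orthogonalProjection_mem_direction_orthogonal E p
    exact Submodule.inner_left_of_mem_orthogonal hx this
  have hh : Metric.infDist p E = ‖n‖ := by
    rw [← EuclideanGeometry.dist_orthogonalProjection_eq_infDist, dist_eq_norm]
  have hpE : p ∉ E := by
    have := hf.notMem_affineSpan_sdiff ⟨p, hp⟩ univ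
    rw [hE]
    convert this using 3
    ext x
    simp only [Finset.coe_erase, mem_sdiff, Finset.mem_coe, mem_singleton_iff, mem_image,
      mem_univ, true_and, Subtype.exists, Subtype.mk.injEq, exists_and_left, exists_prop,
      exists_eq_right_right]
    tauto
  have hnpos : 0 < ‖n‖ := norm_pos_iff.2 fun h0 => hpE (by
    rw [sub_eq_zero.1 h0]; exact hpbE)
  simp only [hh] at hslope ⊢
  refine ⟨hnpos, ?_⟩
  have hΔf : f.erase p ⊆ f := Finset.erase_subset _ _
  have hqf : q ∈ f := hΔf hq
  have hpbq : pb - q ∈ vectorSpan ℝ (f.erase p : Set (Space d)) := by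
    rw [← hdir]; exact AffineSubspace.vsub_mem_direction hpbE hqE
  have hgn : inner ℝ gΔ n = 0 := by rw [real_inner_comm]; exact hnperp _ hgΔ.1
  -- the time of the front at `pb`
  set T := τ q + inner ℝ gΔ (pb - q) with hT
  -- Along the facet the gradient is `gΔ` before and after the advance; its component along the
  -- altitude changes from `β₀ • n` to `β₂ • n`.
  set β₀ := (τ p - T) / ‖n‖ ^ 2 with hβ₀
  set β₂ := (τ p + δ - T) / ‖n‖ ^ 2 with hβ₂
  have hnsq : 0 < ‖n‖ ^ 2 := by positivity
  have hβ₀n : β₀ * ‖n‖ ^ 2 = τ p - T := by rw [hβ₀]; field_simp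
  have hβ₂n : β₂ * ‖n‖ ^ 2 = τ p + δ - T := by rw [hβ₂]; field_simp
  have hnorm : ∀ c : ℝ, ‖gΔ + c • n‖ ^ 2 = ‖gΔ‖ ^ 2 + c ^ 2 * ‖n‖ ^ 2 := fun c => by
    rw [norm_add_sq_real, inner_smul_right, hgn, norm_smul, mul_pow, Real.norm_eq_abs, sq_abs]
    ring
  refine ⟨gΔ + β₂ • n, ⟨?_, ?_⟩, ?_⟩
  · refine Submodule.add_mem _ (vectorSpan_mono ℝ (by exact_mod_cast hΔf) hgΔ.1)
      (Submodule.smul_mem _ _ ?_)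
    rw [← direction_affineSpan]
    exact AffineSubspace.vsub_mem_direction (subset_affineSpan ℝ _ hp)
      (affineSpan_mono ℝ (by exact_mod_cast hΔf) hpbE)
  · have hval : ∀ v ∈ f, advance τ p δ v = τ q + inner ℝ (gΔ + β₂ • n) (v - q) := by
      intro v hv
      by_cases hvp : v = p
      · subst hvp
        have hsplit : v - q = n + (pb - q) := by rw [hn]; abel
        have hnn : inner ℝ n n = ‖n‖ ^ 2 := real_inner_self_eq_norm_sq n
        rw [advance_self, hsplit, inner_add_left, inner_smul_left, inner_add_right, inner_add_right,
          hgn, hnperp _ hpbq, hnn]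
        simp only [conj_trivial, zero_add, add_zero]
        rw [hβ₂n]
        linarith
      · have hvΔ : v ∈ f.erase p := Finset.mem_erase.2 ⟨hvp, hv⟩
        have hmem : v - q ∈ vectorSpan ℝ (f.erase p : Set (Space d)) :=
          vsub_mem_vectorSpan ℝ hvΔ hq
        rw [advance_of_ne _ _ hvp, inner_add_left, inner_smul_left, hnperp _ hmem,
          ← hgΔ.2 q hq v hvΔ]
        simp
    intro u hu v hv
    rw [hval u hu, hval v hv]
    rw [show v - u = (v - q) - (u - q) by abel, inner_sub_right _ (v - q)]
    ring
  · have hβle : β₀ ≤ β₂ := by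
      rw [hβ₀, hβ₂]; gcongr; linarith
    -- Here the raised vertex is still not above the affine extension of the facet at its foot `pb`,
    -- so raising it has only reduced the tilt.
    by_cases hβ : β₂ ≤ 0
    · left
      have h1 : ‖gΔ + β₂ • n‖ ≤ ‖gΔ + β₀ • n‖ := by
        refine le_of_sq_le_sq ?_ (norm_nonneg _)
        rw [hnorm, hnorm]
        have : β₂ ^ 2 ≤ β₀ ^ 2 := by nlinarith
        gcongr
      refine h1.trans ?_
      have hgn' : inner ℝ g n = β₀ * ‖n‖ ^ 2 := by
        have hsplit : n = (p - q) - (pb - q) := by rw [hn]; abel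
        rw [hsplit, inner_sub_right, ← hg.2 q hqf p hp,
          hg.inner_eq_of_mem_vectorSpan hgΔ hΔf hpbq, ← hsplit, hβ₀n, hT]
        ring
      -- Cauchy–Schwarz against `g` gives the comparison of norms without identifying `g` with this
      -- vector.
      have h2 : inner ℝ g (gΔ + β₀ • n) = ‖gΔ + β₀ • n‖ ^ 2 := by
        rw [inner_add_right, inner_smul_right, hgn', hg.inner_eq_of_mem_vectorSpan hgΔ hΔf hgΔ.1,
          hnorm, real_inner_self_eq_norm_sq]
        ring
      have h3 := real_inner_le_norm g (gΔ + β₀ • n)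
      rw [h2] at h3
      by_cases h0 : ‖gΔ + β₀ • n‖ = 0
      · rw [h0]; exact norm_nonneg _
      · have : 0 < ‖gΔ + β₀ • n‖ := lt_of_le_of_ne (norm_nonneg _) (Ne.symm h0)
        nlinarith
    · right
      push Not at hβ
      -- The part `β₁` of the tilt was present before the advance and is controlled by the facet;
      -- the remainder `β₂ - β₁` is charged to `δ`.
      set β₁ := max β₀ 0 with hβ₁
      -- the point of the facet nearest to `p`
      have hcpt : IsCompact (hull (f.erase p)) := (f.erase p).finite_toSet.isCompact_convexHull ℝ
      obtain ⟨y, hyΔ, hy⟩ := hcpt.exists_infDist_eq_dist ⟨q, mem_hull hq⟩ p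
      have hyE : y ∈ E := convexHull_subset_affineSpan _ hyΔ
      have hyq : y - q ∈ vectorSpan ℝ (f.erase p : Set (Space d)) := by
        rw [← hdir]; exact AffineSubspace.vsub_mem_direction hyE hqE
      have hypb : y - pb ∈ vectorSpan ℝ (f.erase p : Set (Space d)) := by
        rw [← hdir]; exact AffineSubspace.vsub_mem_direction hyE hpbE
      -- This is where minimality of `p` enters: `p` is not above the front at the nearest facet
      -- point `y`, so its excess over the foot `pb` is at most `‖gΔ‖` times the distance from `pb`
      -- to `y`.
      have hTy : τ p ≤ τ q + inner ℝ gΔ (y - q) := by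
        let A : Space d →ᵃ[ℝ] ℝ := (innerSL ℝ gΔ).toLinearMap.toAffineMap +
          AffineMap.const ℝ (Space d) (τ q - inner ℝ gΔ q)
        have hA : ∀ x, A x = inner ℝ gΔ x + (τ q - inner ℝ gΔ q) := fun x => rfl
        have := affine_le_on_hull (AffineMap.const ℝ (Space d) (τ p)) A (fun v hv => by
          rw [hA]
          have h1 := hgΔ.2 q hq v hv
          rw [inner_sub_right] at h1
          have h2 := hmin v (hΔf hv)
          simp only [AffineMap.const_apply]
          linarith) hyΔ
        rw [hA, AffineMap.const_apply] at this
        rw [inner_sub_right]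
        linarith
      set D := dist p y with hD
      set r := ‖y - pb‖ with hr
      have hDsq : D ^ 2 = ‖n‖ ^ 2 + r ^ 2 := by
        have : p - y = n - (y - pb) := by rw [hn]; abel
        rw [hD, dist_eq_norm, this, norm_sub_sq_real, hnperp _ hypb]
        ring
      have hβ₁r : β₁ * ‖n‖ ^ 2 ≤ ‖gΔ‖ * r := by
        have h0 : 0 ≤ ‖gΔ‖ * r := by positivity
        have h1 : β₀ * ‖n‖ ^ 2 ≤ ‖gΔ‖ * r := by
          rw [hβ₀n, hT]
          have h2 := real_inner_le_norm gΔ (y - pb)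
          have h3 : y - pb = (y - q) - (pb - q) := by abel
          rw [h3, inner_sub_right, ← h3] at h2
          linarith
        rcases max_cases β₀ 0 with ⟨hm, -⟩ | ⟨hm, -⟩
        · rw [hβ₁, hm]; exact h1
        · rw [hβ₁, hm]; simpa using h0
      have hβ₁0 : 0 ≤ β₁ := le_max_right _ _
      have hDpos : 0 < D := by
        have : 0 < D ^ 2 := by rw [hDsq]; positivity
        exact lt_of_le_of_ne dist_nonneg fun h0 => by rw [← h0] at this; norm_num at this
      rw [hy] at hslope
      have hβb : 0 ≤ β := by
        by_contra hneg
        push Not at hneg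
        have h1 : 0 ≤ ‖gΔ‖ * D := by positivity
        nlinarith
      have hbound : ‖gΔ + β₁ • n‖ ≤ β := by
        refine le_of_sq_le_sq ?_ hβb
        rw [hnorm]
        have h1 : (β₁ * ‖n‖ ^ 2) ^ 2 ≤ (‖gΔ‖ * r) ^ 2 := by
          gcongr
        have h2 : (‖gΔ‖ * D) ^ 2 ≤ (β * ‖n‖) ^ 2 := by gcongr
        -- By Pythagoras for `p`, `pb`, `y` the two terms add up to `(‖gΔ‖ * D) ^ 2`. The ratio of
        -- `‖n‖` to `D` is the sine in the shape factor.
        have h3 : (‖gΔ‖ ^ 2 + β₁ ^ 2 * ‖n‖ ^ 2) * ‖n‖ ^ 2 ≤ β ^ 2 * ‖n‖ ^ 2 := by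
          calc (‖gΔ‖ ^ 2 + β₁ ^ 2 * ‖n‖ ^ 2) * ‖n‖ ^ 2
              = ‖gΔ‖ ^ 2 * ‖n‖ ^ 2 + (β₁ * ‖n‖ ^ 2) ^ 2 := by ring
            _ ≤ ‖gΔ‖ ^ 2 * ‖n‖ ^ 2 + (‖gΔ‖ * r) ^ 2 := by linarith
            _ = (‖gΔ‖ * D) ^ 2 := by rw [mul_pow, mul_pow, hDsq]; ring
            _ ≤ (β * ‖n‖) ^ 2 := h2
            _ = β ^ 2 * ‖n‖ ^ 2 := by ring
        exact le_of_mul_le_mul_right h3 hnsq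
      have hsplit : gΔ + β₂ • n = (gΔ + β₁ • n) + (β₂ - β₁) • n := by
        rw [sub_smul]; abel
      have hdiff0 : 0 ≤ β₂ - β₁ := by
        rw [hβ₁, sub_nonneg]; exact max_le hβle hβ.le
      have hdiff : (β₂ - β₁) * ‖n‖ ≤ δ / ‖n‖ := by
        rw [le_div_iff₀ hnpos]
        have h1 : β₀ ≤ β₁ := le_max_left _ _
        have h2 : (β₂ - β₁) * ‖n‖ ^ 2 ≤ (β₂ - β₀) * ‖n‖ ^ 2 := by gcongr
        have h3 : (β₂ - β₀) * ‖n‖ ^ 2 = δ := by rw [sub_mul, hβ₀n, hβ₂n]; ring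
        calc (β₂ - β₁) * ‖n‖ * ‖n‖ = (β₂ - β₁) * ‖n‖ ^ 2 := by ring
          _ ≤ δ := by rw [← h3]; exact h2
      calc ‖gΔ + β₂ • n‖ ≤ ‖gΔ + β₁ • n‖ + ‖(β₂ - β₁) • n‖ := by
            rw [hsplit]; exact norm_add_le _ _
        _ = ‖gΔ + β₁ • n‖ + (β₂ - β₁) * ‖n‖ := by
            rw [norm_smul, Real.norm_eq_abs, abs_of_nonneg hdiff0]
        _ ≤ β + δ / ‖n‖ := add_le_add hbound hdiff

end Gradient

/-! ### Bounds over finite sets, time spans of elements and fronts -/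

theorem exists_pos_le_of_finite {α : Type*} {S : Set α} (hS : S.Finite) (F : α → ℝ)
    (hF : ∀ x ∈ S, 0 < F x) : ∃ θ > 0, ∀ x ∈ S, θ ≤ F x := by
  rcases S.eq_empty_or_nonempty with rfl | hne
  · exact ⟨1, one_pos, by simp⟩
  · obtain ⟨a, ha, hmin⟩ := exists_min_image S F hS hne
    exact ⟨F a, hF a ha, hmin⟩

theorem exists_upper_bound_of_finite {α : Type*} {S : Set α} (hS : S.Finite) (F : α → ℝ) :
    ∃ B > 0, ∀ x ∈ S, F x ≤ B := by
  obtain ⟨B, hB⟩ := (hS.image F).bddAbove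
  exact ⟨max B 1, by positivity, fun x hx => (hB (mem_image_of_mem F hx)).trans (le_max_left _ _)⟩

namespace IsFrontSequence

variable {d : ℕ} {K : Geometry.SimplicialComplex ℝ (Space d)}
  {C : ℕ → Set (Finset (Space d))} {h : ℕ → Space d → ℝ} {p : ℕ → Space d} {δ : ℕ → ℝ}
  {new : ℕ → Set (Finset (SpaceTime d))}

/-- The element lies between two consecutive fronts, which agree at a base vertex `q` other than the
advanced one. Passing through `q` costs the spread twice. -/
theorem abs_time_sub_le (H : IsFrontSequence K C h p δ new) (hd : 1 ≤ d) {B : ℝ}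
    (hB : ∀ i, ∀ x ∈ K.space, ∀ y ∈ K.space, h i x ≤ h i y + B) {i : ℕ}
    {e : Finset (SpaceTime d)} (he : e ∈ new i) {P Q : SpaceTime d} (hP : P ∈ hull e)
    (hQ : Q ∈ hull e) : |P.2 - Q.2| ≤ 2 * B := by
  obtain ⟨-, σ, hσ, hp, -⟩ := H.exists_base he
  obtain ⟨q, hq, hqp⟩ : ∃ q ∈ σ, q ≠ p i :=
    Finset.exists_mem_ne (by rw [H.card i σ hσ]; omega) (p i)
  have hqK : q ∈ K.space := H.hull_subset_space hσ (mem_hull hq)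
  have hq1 : h (i + 1) q = h i q := by
    rw [(H.exists_affine_next he hσ).1 q hq, advance_of_ne _ _ hqp]
  have key : ∀ P ∈ hull e, ∀ Q ∈ hull e, P.2 - Q.2 ≤ 2 * B := fun P hP Q hQ => by
    have h1 := H.bounds_of_mem_hull he hP
    have h2 := H.bounds_of_mem_hull he hQ
    have h3 := hB (i + 1) P.1 h1.1 q hqK
    have h4 := hB i q hqK Q.1 h2.1
    linarith [h1.2.2, h2.2.1]
  exact abs_sub_le_iff.2 ⟨key P hP Q hQ, key Q hQ P hP⟩

end IsFrontSequence

theorem frontValue_spread {d : ℕ} {C : Set (Finset (Space d))}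
    (hC : ∀ σ ∈ C, ∀ σ' ∈ C, hull σ ∩ hull σ' ⊆ convexHull ℝ ((σ : Set (Space d)) ∩ σ'))
    (hind : ∀ σ ∈ C, AffineIndependent ℝ ((↑) : σ → Space d)) {τ : Space d → ℝ} {B : ℝ}
    (hB : ∀ σ ∈ C, ∀ σ' ∈ C, ∀ u ∈ σ, ∀ v ∈ σ', τ u ≤ τ v + B) {σ σ' : Finset (Space d)}
    (hσ : σ ∈ C) (hσ' : σ' ∈ C) {x y : Space d} (hx : x ∈ hull σ) (hy : y ∈ hull σ') :
    frontValue C τ x ≤ frontValue C τ y + B := by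
  obtain ⟨A, hA⟩ := exists_affine_interpolant (hind σ hσ) τ
  obtain ⟨A', hA'⟩ := exists_affine_interpolant (hind σ' hσ') τ
  rw [frontValue_eq hC hσ hA hx, frontValue_eq hC hσ' hA' hy]
  have h1 : ∀ v ∈ σ', A x ≤ τ v + B := fun v hv =>
    affine_le_on_hull A (AffineMap.const ℝ _ (τ v + B)) (fun u hu => by
      rw [hA u hu]; exact hB σ hσ σ' hσ' u hu v hv) hx
  have h2 := affine_le_on_hull (AffineMap.const ℝ _ (A x - B)) A' (fun v hv => by
    rw [hA' v hv, AffineMap.const_apply]; linarith [h1 v hv]) hy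
  rw [AffineMap.const_apply] at h2
  linarith

/-! ### The algorithm in arbitrary dimension -/

section ArbitraryDimension

variable {d : ℕ} {K : Geometry.SimplicialComplex ℝ (Space d)} {ε κ s : ℝ}

theorem notMem_affineSpan_diff {f : Finset (Space d)}
    (hf : AffineIndependent ℝ ((↑) : f → Space d)) {p : Space d} (hp : p ∈ f) :
    p ∉ affineSpan ℝ ((f : Set (Space d)) \ {p}) := by
  have := hf.notMem_affineSpan_sdiff ⟨p, hp⟩ univ
  convert this using 3
  ext x
  simp only [mem_sdiff, Finset.mem_coe, mem_singleton_iff, mem_image,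
    mem_univ, true_and, Subtype.exists, Subtype.mk.injEq, exists_and_left, exists_prop,
    exists_eq_right_right]
  tauto

theorem infDist_pos_of_mem {f : Finset (Space d)} (hf : AffineIndependent ℝ ((↑) : f → Space d))
    (hcard : 2 ≤ f.card) {p : Space d} (hp : p ∈ f) :
    0 < Metric.infDist p (affineSpan ℝ ((f : Set (Space d)) \ {p})) ∧
      0 < Metric.infDist p (convexHull ℝ ((f : Set (Space d)) \ {p})) := by
  obtain ⟨q, hq, hqp⟩ := Finset.exists_mem_ne (by omega : 1 < f.card) p
  have hq' : q ∈ (f : Set (Space d)) \ {p} := ⟨hq, hqp⟩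
  have h1 : 0 < Metric.infDist p (affineSpan ℝ ((f : Set (Space d)) \ {p})) :=
    ((AffineSubspace.closed_of_finiteDimensional _).notMem_iff_infDist_pos
      ⟨q, subset_affineSpan ℝ _ hq'⟩).1 (notMem_affineSpan_diff hf hp)
  exact ⟨h1, h1.trans_le (Metric.infDist_le_infDist_of_subset (convexHull_subset_affineSpan _)
    ⟨q, subset_convexHull ℝ _ hq'⟩)⟩

theorem shapeFactor_le (f : Finset (Space d)) {p : Space d} (hp : p ∈ f) :
    shapeFactor f ≤ Metric.infDist p (affineSpan ℝ ((f : Set (Space d)) \ {p})) /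
      Metric.infDist p (convexHull ℝ ((f : Set (Space d)) \ {p})) :=
  ciInf_le (Set.finite_range _).bddBelow (⟨p, hp⟩ : f)

theorem shapeFactor_pos {f : Finset (Space d)} (hf : AffineIndependent ℝ ((↑) : f → Space d))
    (hcard : 2 ≤ f.card) : 0 < shapeFactor f := by
  have hne : Nonempty f := by
    obtain ⟨q, hq⟩ := Finset.card_pos.1 (by omega : 0 < f.card)
    exact ⟨⟨q, hq⟩⟩
  obtain ⟨p, hp⟩ := exists_eq_ciInf_of_finite (f := fun p : f =>
    Metric.infDist (p : Space d) (affineSpan ℝ ((f : Set (Space d)) \ {(p : Space d)})) /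
    Metric.infDist (p : Space d) (convexHull ℝ ((f : Set (Space d)) \ {(p : Space d)})))
  rw [shapeFactor, ← hp]
  have := infDist_pos_of_mem hf hcard p.2
  exact div_pos this.1 this.2

theorem SlopeBound.mem_faces {f : Finset (Space d)} {b : ℝ} (h : SlopeBound K ε s f b) :
    f ∈ K.faces := by
  induction h with
  | top hf _ => exact hf
  | facet _ hfg _ hf ih => exact K.down_closed ih hfg hf

/-- Each passage to a facet multiplies the bound by one of finitely many positive factors and
removes a vertex, so at most `d` passages are possible. -/
theorem exists_slopeBound_lower (hK : K.faces.Finite) (hε : ε < 1) (hs : 0 < s) :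
    ∃ m > 0, ∀ f b, SlopeBound K ε s f b → m ≤ b := by
  obtain ⟨θ, hθ, hθle⟩ := exists_pos_le_of_finite (hK.subset (sep_subset _ fun f => 2 ≤ f.card))
    (fun f => (1 - ε) * shapeFactor f) fun f hf =>
      mul_pos (by linarith) (shapeFactor_pos (K.indep hf.1) hf.2)
  set θ' := min θ 1 with hθ'
  have hθ'0 : 0 < θ' := lt_min hθ one_pos
  have hθ'1 : θ' ≤ 1 := min_le_right _ _
  refine ⟨θ' ^ (d + 1) * s, by positivity, fun f b h => ?_⟩
  suffices ∃ k, k + f.card = d + 1 ∧ θ' ^ k * s ≤ b by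
    obtain ⟨k, hk, hb⟩ := this
    refine le_trans ?_ hb
    have : θ' ^ (d + 1) ≤ θ' ^ k := pow_le_pow_of_le_one hθ'0.le hθ'1 (by omega)
    gcongr
  induction h with
  | top _ hcard => exact ⟨0, by omega, by simp⟩
  | @facet g f b hg hfg hcard hf ih =>
    obtain ⟨k, hk, hb⟩ := ih
    refine ⟨k + 1, by omega, ?_⟩
    have hg2 : 2 ≤ g.card := by
      have := Finset.card_pos.2 hf
      omega
    have h1 : θ' ≤ (1 - ε) * shapeFactor g := (min_le_left _ _).trans (hθle g ⟨hg.mem_faces, hg2⟩)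
    calc θ' ^ (k + 1) * s = θ' * (θ' ^ k * s) := by ring
      _ ≤ (1 - ε) * shapeFactor g * b :=
          mul_le_mul h1 hb (by positivity) (hθ'0.le.trans h1)

theorem isProgressive_zero (hK : K.faces.Finite) (hε : ε < 1) (hs : 0 < s) :
    IsProgressive K ε s (fun _ => 0) := by
  obtain ⟨m, hm, hmb⟩ := exists_slopeBound_lower hK hε hs
  exact ⟨fun σ _ _ => ⟨0, isGradient_zero σ, by simpa using hs⟩, fun f b hb =>
    ⟨0, isGradient_zero f, by simpa using hm.le.trans (hmb f b hb)⟩⟩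

/-- Every local minimum of a progressive front can be advanced by a fixed amount. -/
theorem exists_uniform_progress (hd : 1 ≤ d) (hK : K.faces.Finite) (hε0 : 0 < ε) (hε : ε < 1)
    (hs : 0 < s) : ∃ η > 0, ∀ τ, IsProgressive K ε s τ → ∀ p, IsLocalMinVertex K τ p →
      IsProgressive K ε s (advance τ p η) := by
  classical
  obtain ⟨m, hm, hmb⟩ := exists_slopeBound_lower hK hε hs
  obtain ⟨h₀, hh₀, hh₀le⟩ := exists_pos_le_of_finite
    (S := ⋃ f ∈ {f ∈ K.faces | 2 ≤ f.card}, (fun p => (f, p)) '' (f : Set (Space d)))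
    ((hK.subset (sep_subset _ _)).biUnion fun f _ => f.finite_toSet.image _)
    (fun x => Metric.infDist x.2 (affineSpan ℝ ((x.1 : Set (Space d)) \ {x.2}))) (by
      rintro ⟨f, p⟩ hx
      simp only [mem_iUnion, mem_image, Prod.mk.injEq, exists_prop] at hx
      obtain ⟨f, hf, p, hp, rfl, rfl⟩ := hx
      exact (infDist_pos_of_mem (K.indep hf.1) hf.2 hp).1)
  -- All slope bounds are at least `m` and all altitudes at least `h₀`. Raising a vertex by this
  -- amount adds at most `ε * m / 2` to a slope, less than the margin `ε * b` left by the bound on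
  -- the facet.
  refine ⟨ε * m * h₀ / 2, by positivity, fun τ hτ p hp => ?_⟩
  set η := ε * m * h₀ / 2 with hη
  have hη0 : 0 ≤ η := by positivity
  -- Either the old bound is inherited, strict or not, or the new one is strict; so the same
  -- dichotomy serves the strict causality condition and the weak slope bounds.
  have key : ∀ f b, SlopeBound K ε s f b → 2 ≤ f.card → p ∈ f → ∀ g, IsGradient τ f g →
      ∃ g', IsGradient (advance τ p η) f g' ∧ (‖g'‖ ≤ ‖g‖ ∨ ‖g'‖ < b) := by
    intro f b hfb hcard hpf g hg
    have hfK := hfb.mem_faces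
    have hb : 0 < b := hm.trans_le (hmb f b hfb)
    have hcardp : (f.erase p).card + 1 = f.card := Finset.card_erase_add_one hpf
    have hne : (f.erase p).Nonempty := Finset.card_pos.1 (by omega)
    obtain ⟨gΔ, hgΔ, hgΔle⟩ := hτ.2 _ _ (hfb.facet (Finset.erase_subset p f) hcardp hne)
    have hpos := infDist_pos_of_mem (K.indep hfK) hcard hpf
    have hφ := shapeFactor_le f hpf
    have hhp := hh₀le (f, p) (by
      simp only [mem_iUnion, mem_image, Prod.mk.injEq, exists_prop]
      exact ⟨f, ⟨hfK, hcard⟩, p, hpf, rfl, rfl⟩)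
    simp only at hhp
    have hcoe : ((f.erase p : Finset (Space d)) : Set (Space d)) = (f : Set (Space d)) \ {p} :=
      Finset.coe_erase p f
    obtain ⟨-, g', hg', hor⟩ := exists_gradient_advance (K.indep hfK) hpf hne hgΔ hg
      (β := (1 - ε) * b) (by
        rw [hull, hcoe]
        rw [le_div_iff₀ hpos.2] at hφ
        calc ‖gΔ‖ * Metric.infDist p (convexHull ℝ ((f : Set (Space d)) \ {p}))
            ≤ (1 - ε) * shapeFactor f * b *
              Metric.infDist p (convexHull ℝ ((f : Set (Space d)) \ {p})) :=
              mul_le_mul_of_nonneg_right hgΔle hpos.2.le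
          _ = (1 - ε) * b * (shapeFactor f *
              Metric.infDist p (convexHull ℝ ((f : Set (Space d)) \ {p}))) := by ring
          _ ≤ _ := mul_le_mul_of_nonneg_left hφ (mul_nonneg (by linarith) hb.le))
      (hp.2 f hfK hpf) hη0
    refine ⟨g', hg', hor.imp_right fun hle => lt_of_le_of_lt hle ?_⟩
    rw [hcoe]
    have h1 : η / Metric.infDist p (affineSpan ℝ ((f : Set (Space d)) \ {p})) ≤ ε * m / 2 := by
      rw [div_le_iff₀ hpos.1, hη]
      calc ε * m * h₀ / 2 = ε * m / 2 * h₀ := by ring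
        _ ≤ _ := by gcongr
    have h2 : ε * m ≤ ε * b := mul_le_mul_of_nonneg_left (hmb f b hfb) hε0.le
    have h3 : 0 < ε * b := by positivity
    nlinarith
  have hcongr : ∀ f : Finset (Space d), p ∉ f → ∀ v ∈ f, τ v = advance τ p η v :=
    fun f hpf v hv => (advance_of_ne _ _ (by rintro rfl; exact hpf hv)).symm
  refine ⟨fun σ hσ hcard => ?_, fun f b hfb => ?_⟩
  · obtain ⟨g, hg, hgs⟩ := hτ.1 σ hσ hcard
    by_cases hpσ : p ∈ σ
    · obtain ⟨g', hg', hor⟩ := key σ s (SlopeBound.top hσ hcard) (by omega) hpσ g hg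
      exact ⟨g', hg', hor.elim (fun h => h.trans_lt hgs) id⟩
    · exact ⟨g, hg.congr (hcongr σ hpσ), hgs⟩
  · obtain ⟨g, hg, hgb⟩ := hτ.2 f b hfb
    by_cases hpf : p ∈ f
    · by_cases hcard : 2 ≤ f.card
      · obtain ⟨g', hg', hor⟩ := key f b hfb hcard hpf g hg
        exact ⟨g', hg', hor.elim (fun h => h.trans hgb) le_of_lt⟩
      -- A single vertex has gradient zero, whatever its time.
      · have hle := Finset.card_le_one.1 (by omega : f.card ≤ 1)
        refine ⟨0, ⟨Submodule.zero_mem _, fun u hu v hv => ?_⟩, ?_⟩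
        · rw [hle u hu v hv]; simp
        · simpa using hm.le.trans (hmb f b hfb)
    · exact ⟨g, hg.congr (hcongr f hpf), hgb⟩

theorem IsSpaceMesh.exists_vertex (hK : IsSpaceMesh K) : ∃ v, {v} ∈ K.faces := by
  obtain ⟨x, hx⟩ := hK.connected.nonempty
  obtain ⟨f, hf, -⟩ := K.mem_space_iff.1 hx
  obtain ⟨v, hv⟩ := K.nonempty_of_mem_faces hf
  exact ⟨v, K.down_closed hf (by simpa using hv) (Finset.singleton_nonempty v)⟩

theorem IsSpaceMesh.finite_vertices (hK : IsSpaceMesh K) : {v | {v} ∈ K.faces}.Finite := by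
  refine (hK.finite.biUnion fun f _ => f.finite_toSet).subset fun v hv => ?_
  exact mem_biUnion (x := {v}) hv (by simp)

theorem IsSpaceMesh.exists_localMin (hK : IsSpaceMesh K) (τ : Space d → ℝ) :
    ∃ p, IsLocalMinVertex K τ p := by
  obtain ⟨p, hp, hmin⟩ := exists_min_image {v : Space d | ({v} : Finset (Space d)) ∈ K.faces} τ
    hK.finite_vertices hK.exists_vertex
  exact ⟨p, hp, fun f hf _ q hq =>
    hmin q (K.down_closed hf (by simpa using hq) (Finset.singleton_nonempty q))⟩

theorem IsSpaceMesh.exists_pitch (hK : IsSpaceMesh K) (hd : 1 ≤ d) (hε0 : 0 < ε) (hε : ε < 1)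
    (hκ0 : 0 < κ) (hκ : κ < 1) (hs : 0 < s) {τ : Space d → ℝ} (hτ : IsProgressive K ε s τ)
    {p : Space d} (hp : IsLocalMinVertex K τ p) : ∃ δ, IsPitch K ε κ s τ p δ := by
  obtain ⟨η, hη, hprog⟩ := exists_uniform_progress hd hK.finite hε0 hε hs
  obtain ⟨σ, hσ, hpσ, hcard⟩ := hK.pure _ hp.1
  rw [Finset.singleton_subset_iff] at hpσ
  obtain ⟨q, hq, hqp⟩ := Finset.exists_mem_ne (by omega : 1 < σ.card) p
  -- Causality on one top simplex bounds the progress: `p` cannot rise more than `s * dist q p`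
  -- above the neighbor `q`.
  obtain ⟨δ, hδ, hδ0, hmax⟩ := exists_pos_near_max
    (Adm := {δ | IsProgressive K ε s (advance τ p δ)}) (B := s * dist q p + τ q - τ p) hη
    (hprog τ hτ p hp) (by
      intro δ hδ
      obtain ⟨g, hg, hgs⟩ := hδ.1 σ hσ hcard
      have := (le_abs_self _).trans (hg.abs_sub_le hq hpσ)
      rw [advance_self, advance_of_ne _ _ hqp] at this
      have h2 : ‖g‖ * dist q p ≤ s * dist q p := by gcongr
      linarith) hκ0 hκ
  exact ⟨δ, hp, hδ0, hδ, hmax⟩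

theorem IsReachableFront.isProgressive (hK : K.faces.Finite) (hε : ε < 1) (hs : 0 < s)
    {τ : Space d → ℝ} (h : IsReachableFront K ε κ s τ) : IsProgressive K ε s τ := by
  unfold IsReachableFront at h
  induction h with
  | refl => exact isProgressive_zero hK hε hs
  | tail _ h _ =>
    obtain ⟨p, δ, hpitch, rfl⟩ := h
    exact hpitch.progressive

theorem IsTentRun.isProgressive (hK : K.faces.Finite) (hε : ε < 1) (hs : 0 < s)
    {τ : ℕ → Space d → ℝ} {p : ℕ → Space d} {δ : ℕ → ℝ} (h : IsTentRun K ε κ s τ p δ) (i : ℕ) :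
    IsProgressive K ε s (τ i) := by
  cases i with
  | zero => rw [h.init]; exact isProgressive_zero hK hε hs
  | succ i => rw [h.next]; exact (h.pitch i).progressive

theorem IsSpaceMesh.exists_tentRun (hK : IsSpaceMesh K) (hd : 1 ≤ d) (hε0 : 0 < ε) (hε : ε < 1)
    (hκ0 : 0 < κ) (hκ : κ < 1) (hs : 0 < s) : ∃ τ p δ, IsTentRun K ε κ s τ p δ := by
  have hstep : ∀ τ : {τ // IsProgressive K ε s τ}, ∃ x : Space d × ℝ,
      IsPitch K ε κ s τ.1 x.1 x.2 := fun τ => by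
    obtain ⟨p, hp⟩ := hK.exists_localMin τ.1
    obtain ⟨δ, hδ⟩ := hK.exists_pitch hd hε0 hε hκ0 hκ hs τ.2 hp
    exact ⟨(p, δ), hδ⟩
  choose x hx using hstep
  let τ : ℕ → {τ // IsProgressive K ε s τ} := fun n => Nat.rec
    ⟨fun _ => 0, isProgressive_zero hK.finite hε hs⟩
    (fun _ τ => ⟨advance τ.1 (x τ).1 (x τ).2, (hx τ).progressive⟩) n
  exact ⟨fun i => (τ i).1, fun i => (x (τ i)).1, fun i => (x (τ i)).2, rfl,
    fun i => hx (τ i), fun i => rfl⟩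

/-- The simplices of full dimension of a complex. -/
def topFaces (K : Geometry.SimplicialComplex ℝ (Space d)) : Set (Finset (Space d)) :=
  {σ | σ ∈ K.faces ∧ σ.card = d + 1}

theorem topFaces_conform (K : Geometry.SimplicialComplex ℝ (Space d)) :
    ∀ σ ∈ topFaces K, ∀ σ' ∈ topFaces K,
      hull σ ∩ hull σ' ⊆ convexHull ℝ ((σ : Set (Space d)) ∩ σ') :=
  fun _ hσ _ hσ' => K.inter_subset_convexHull hσ.1 hσ'.1

theorem IsSpaceMesh.exists_topFace (hK : IsSpaceMesh K) {x : Space d} (hx : x ∈ K.space) :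
    ∃ σ ∈ topFaces K, x ∈ hull σ := by
  obtain ⟨f, hf, hxf⟩ := K.mem_space_iff.1 hx
  obtain ⟨σ, hσ, hfσ, hcard⟩ := hK.pure f hf
  exact ⟨σ, ⟨hσ, hcard⟩, hull_mono hfσ hxf⟩

theorem IsSpaceMesh.iUnion_topFaces (hK : IsSpaceMesh K) :
    ⋃ σ ∈ topFaces K, hull σ = K.space := by
  refine subset_antisymm (iUnion₂_subset fun σ hσ => K.convexHull_subset_space hσ.1) fun x hx => ?_
  obtain ⟨σ, hσ, hxσ⟩ := hK.exists_topFace hx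
  exact mem_biUnion hσ hxσ

/-- Intersections of faces of two simplices of a complex. -/
theorem SimplicialComplex.exists_inter_eq_hull {σ σ' a b : Finset (Space d)} (hσ : σ ∈ K.faces)
    (hσ' : σ' ∈ K.faces) (ha : a ⊆ σ) (hb : b ⊆ σ') :
    ∃ u : Finset (Space d), (u ⊆ a ∨ u ⊆ b) ∧ hull a ∩ hull b = hull u := by
  classical
  rcases a.eq_empty_or_nonempty with rfl | hane
  · exact ⟨∅, Or.inl subset_rfl, by simp [hull]⟩
  rcases b.eq_empty_or_nonempty with rfl | hbne
  · exact ⟨∅, Or.inr subset_rfl, by simp [hull]⟩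
  refine ⟨a ∩ b, Or.inl Finset.inter_subset_left, ?_⟩
  rw [hull, hull, hull, Finset.coe_inter]
  exact K.convexHull_inter_convexHull (K.down_closed hσ ha hane) (K.down_closed hσ' hb hbne)

/-- The triangulation is constant. Interpolation makes the front a function on all of `|K|`. -/
theorem IsTentRun.isFrontSequence (hK : IsSpaceMesh K)
    {τ : ℕ → Space d → ℝ} {p : ℕ → Space d} {δ : ℕ → ℝ} (hrun : IsTentRun K ε κ s τ p δ) :
    IsFrontSequence K (fun _ => topFaces K) (fun i => frontValue (topFaces K) (τ i)) p δ
      (fun i => {e | ∃ σ ∈ topFaces K, p i ∈ σ ∧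
        e = tentElement (frontValue (topFaces K) (τ i)) (p i) (δ i) σ}) where
  card _ σ hσ := hσ.2
  indep _ σ hσ := K.indep hσ.1
  lies_over _ σ hσ := ⟨σ, hσ.1, subset_rfl⟩
  cover _ x hx := hK.exists_topFace hx
  conform _ := topFaces_conform K
  inter _ _ σ hσ σ' hσ' a ha b hb := SimplicialComplex.exists_inter_eq_hull hσ.1 hσ'.1 ha hb
  affine i σ hσ := by
    obtain ⟨A, hA⟩ := exists_affine_interpolant (K.indep hσ.1) (τ i)
    exact ⟨A, fun x hx => frontValue_eq (topFaces_conform K) hσ hA hx⟩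
  init x hx := by
    obtain ⟨σ, hσ, hxσ⟩ := hK.exists_topFace hx
    rw [hrun.init]
    exact frontValue_eq (topFaces_conform K) hσ (A := AffineMap.const ℝ _ 0) (fun v _ => rfl) hxσ
  step i := by
    refine Or.inr ⟨(hrun.pitch i).pos, rfl, fun σ hσ => ⟨fun v hv => ?_, ?_⟩⟩
    · rw [frontValue_vertex (topFaces_conform K) hσ (K.indep hσ.1) hv, hrun.next]
      by_cases hvp : v = p i
      · subst hvp
        rw [advance_self, advance_self, frontValue_vertex (topFaces_conform K) hσ (K.indep hσ.1) hv]
      · rw [advance_of_ne _ _ hvp, advance_of_ne _ _ hvp,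
          frontValue_vertex (topFaces_conform K) hσ (K.indep hσ.1) hv]
    · obtain ⟨A, hA⟩ := exists_affine_interpolant (K.indep hσ.1) (τ (i + 1))
      exact ⟨A, fun x hx => frontValue_eq (topFaces_conform K) hσ hA hx⟩

theorem tentMesh_eq {τ : ℕ → Space d → ℝ} {p : ℕ → Space d} {δ : ℕ → ℝ} :
    tentMesh K τ p δ = ⋃ i, {e | ∃ σ ∈ topFaces K, p i ∈ σ ∧
        e = tentElement (frontValue (topFaces K) (τ i)) (p i) (δ i) σ} := by
  have hcongr : ∀ i σ, σ ∈ topFaces K → p i ∈ σ → tentElement (τ i) (p i) (δ i) σ =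
      tentElement (frontValue (topFaces K) (τ i)) (p i) (δ i) σ := fun i σ hσ hp =>
    tentElement_congr hp fun v hv =>
      (frontValue_vertex (topFaces_conform K) hσ (K.indep hσ.1) hv).symm
  ext e
  simp only [tentMesh, mem_iUnion, mem_ofPred_eq]
  constructor
  · rintro ⟨i, σ, hσ, hcard, hp, rfl⟩
    exact ⟨i, σ, ⟨hσ, hcard⟩, hp, hcongr i σ ⟨hσ, hcard⟩ hp⟩
  · rintro ⟨i, σ, hσ, hp, rfl⟩
    exact ⟨i, σ, hσ.1, hσ.2, hp, (hcongr i σ hσ hp).symm⟩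

theorem exists_meshCriteria_of_tentRun (hK : IsSpaceMesh K) (hd : 1 ≤ d) (hε0 : 0 < ε)
    (hε : ε < 1) (hκ0 : 0 < κ) (hs : 0 < s) :
    ∃ c : ℝ, 0 < c ∧ ∀ S : SpaceTime d → ℝ, (∀ P ∈ K.space ×ˢ Set.Ici (0 : ℝ), s ≤ S P) →
      ∀ τ p δ, IsTentRun K ε κ s τ p δ →
        MeshCriteria K S c (tentMesh K τ p δ) ∧
        (∀ f ∈ K.faces, f.map ⟨fun v => (v, (0 : ℝ)), Prod.mk_left_injective 0⟩ ∈
          allFaces (tentMesh K τ p δ)) ∧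
        ∀ T : ℝ, ∃ n, ∀ v, {v} ∈ K.faces → T ≤ τ n v := by
  classical
  obtain ⟨η, hη, hprog⟩ := exists_uniform_progress hd hK.finite hε0 hε hs
  obtain ⟨D, hD, hDle⟩ := exists_upper_bound_of_finite
    (hK.finite_vertices.prod hK.finite_vertices) (fun x => dist x.1 x.2)
  set V := hK.finite_vertices.toFinset with hV
  have hvert : ∀ f ∈ K.faces, ∀ v ∈ f, {v} ∈ K.faces := fun f hf v hv =>
    K.down_closed hf (by simpa using hv) (Finset.singleton_nonempty v)
  have hfin : (topFaces K).Finite := hK.finite.subset fun σ hσ => hσ.1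
  -- Times within a simplex differ by at most `s * D`, so the spread is at most `V.card * (s * D)`;
  -- the 1 ensures positivity.
  set B := V.card * (s * D) + 1 with hB
  have hB0 : 0 < B := by positivity
  -- Tentpoles have length at least `κ * η`, and elements last at most `2 * B`.
  refine ⟨κ * η / (2 * B), by positivity, fun S hS τ p δ hrun => ?_⟩
  have H := hrun.isFrontSequence hK
  have hvalue : ∀ i v, {v} ∈ K.faces → frontValue (topFaces K) (τ i) v = τ i v := fun i v hv => by
    obtain ⟨σ, hσ, hvσ, hcard⟩ := hK.pure _ hv
    exact frontValue_vertex (topFaces_conform K) ⟨hσ, hcard⟩ (K.indep hσ) (by simpa using hvσ)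
  have hδη : ∀ i, κ * η ≤ δ i := fun i => (hrun.pitch i).nearMax η
    (hprog _ (hrun.isProgressive hK.finite hε hs i) _ (hrun.pitch i).localMin)
  have hedge : ∀ i, ∀ σ ∈ topFaces K, ∀ u ∈ σ, ∀ v ∈ σ, τ i u ≤ τ i v + s * D := by
    intro i σ hσ u hu v hv
    obtain ⟨g, hg, hgs⟩ := (hrun.isProgressive hK.finite hε hs i).1 σ hσ.1 hσ.2
    have h1 := (le_abs_self _).trans (hg.abs_sub_le hv hu)
    have h2 : ‖g‖ * dist v u ≤ s * D := by
      have := hDle (v, u) ⟨hvert σ hσ.1 v hv, hvert σ hσ.1 u hu⟩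
      gcongr
    linarith
  have hspread : ∀ i, ∀ x ∈ K.space, ∀ y ∈ K.space,
      frontValue (topFaces K) (τ i) x ≤ frontValue (topFaces K) (τ i) y + B := by
    intro i x hx y hy
    obtain ⟨σ, hσ, hxσ⟩ := hK.exists_topFace hx
    obtain ⟨σ', hσ', hyσ'⟩ := hK.exists_topFace hy
    refine frontValue_spread (topFaces_conform K) (fun σ hσ => K.indep hσ.1) ?_ hσ hσ' hxσ hyσ'
    intro σ hσ σ' hσ' u hu v hv
    have := spread_le_of_isPreconnected hfin (topFaces_conform K)
      (by rw [hK.iUnion_topFaces]; exact hK.connected.isPreconnected) (hedge i) (V := V)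
      (fun σ hσ v hv => by rw [hV, Set.Finite.mem_toFinset]; exact hvert σ hσ.1 v hv) hσ hσ' hu hv
    linarith
  have hnonempty : ∀ i, ∃ σ ∈ topFaces K, p i ∈ σ := fun i => by
    obtain ⟨σ, hσ, hpσ, hcard⟩ := hK.pure _ (hrun.pitch i).localMin.1
    exact ⟨σ, ⟨hσ, hcard⟩, by simpa using hpσ⟩
  have hT := H.exists_forall_le (η := κ * η) (by positivity) V
    (fun v hv => by
      rw [hV, Set.Finite.coe_toFinset] at hv
      exact K.subset_space hv (by simp))
    (fun n => by
      obtain ⟨σ, hσ, hp⟩ := hnonempty n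
      refine ⟨n, le_rfl, ⟨_, σ, hσ, hp, rfl⟩, ?_, hδη n⟩
      rw [hV, Set.Finite.mem_toFinset]
      exact (hrun.pitch n).localMin.1) hspread
  have hTv : ∀ T : ℝ, ∃ n, ∀ v, {v} ∈ K.faces → T ≤ τ n v := fun T => by
    obtain ⟨n, hn⟩ := hT T
    refine ⟨n, fun v hv => ?_⟩
    rw [← hvalue n v hv]
    exact hn v (K.subset_space hv (by simp))
  refine ⟨?_, fun f hf => ?_, hTv⟩
  · rw [tentMesh_eq]
    refine H.meshCriteria hS (fun i _ σ hσ => ?_) (fun _ => hfin) (by positivity)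
      (fun i _ => hδη i) (fun i e he P hP Q hQ => H.abs_time_sub_le hd hspread he hP hQ) hT
    obtain ⟨g, hg, hgs⟩ := (hrun.pitch i).progressive.1 σ hσ.1 hσ.2
    refine ⟨g, hg.congr fun v hv => ?_, hgs⟩
    by_cases hvp : v = p i
    · subst hvp
      rw [advance_self, advance_self, hvalue i _ (hvert σ hσ.1 _ hv)]
    · rw [advance_of_ne _ _ hvp, advance_of_ne _ _ hvp, hvalue i _ (hvert σ hσ.1 _ hv)]
  -- When a vertex of `f` first leaves time zero, all of `f` is still there. The element erected
  -- over a top simplex that contains `f` then has `f × {0}` as a face.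
  · obtain ⟨w, hw⟩ := K.nonempty_of_mem_faces hf
    have hex : ∃ n, ∃ v ∈ f, τ n v ≠ 0 := by
      obtain ⟨n, hn⟩ := hTv 1
      have := hn w (hvert f hf w hw)
      exact ⟨n, w, hw, by linarith⟩
    obtain ⟨m, ⟨v, hv, hvm⟩, hmin⟩ : ∃ m, (∃ v ∈ f, τ m v ≠ 0) ∧ ∀ k < m, ¬ ∃ v ∈ f, τ k v ≠ 0 :=
      ⟨Nat.find hex, Nat.find_spec hex, fun k hk => Nat.find_min hex hk⟩
    cases m with
    | zero => rw [hrun.init] at hvm; exact absurd rfl hvm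
    | succ i =>
      have hi : ∀ v ∈ f, τ i v = 0 := by
        have := hmin i (Nat.lt_succ_self i)
        push Not at this
        exact this
      have hvp : v = p i := by
        by_contra hne
        rw [hrun.next, advance_of_ne _ _ hne] at hvm
        exact hvm (hi v hv)
      obtain ⟨σ, hσ, hfσ, hcard⟩ := hK.pure f hf
      refine ⟨tentElement (τ i) (p i) (δ i) σ, ⟨i, σ, hσ, hcard, hvp ▸ hfσ hv, rfl⟩, ?_⟩
      intro P hP
      obtain ⟨u, hu, rfl⟩ := Finset.mem_map.1 hP
      refine mem_tentElement.2 (Or.inr ⟨u, hfσ hu, ?_⟩)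
      rw [hi u hu]; rfl

end ArbitraryDimension

/-! ### Marked triangles and their descendants -/

/-- The signed area of the parallelogram spanned by two vectors of the plane. -/
def cross (u v : Space 2) : ℝ := u 0 * v 1 - u 1 * v 0

namespace MarkedTriangle

/-- A marked triangle is nondegenerate if its vertices are not collinear. -/
def Nondegenerate (t : MarkedTriangle) : Prop := cross (t.left - t.apex) (t.right - t.apex) ≠ 0

/-- `b` is one of the two children of `a`. -/
def IsChild (a b : MarkedTriangle) : Prop := b = a.leftChild ∨ b = a.rightChild

/-- `DescendsIn n a b`: the triangle `b` is obtained from `a` by `n` bisections. -/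
inductive DescendsIn : ℕ → MarkedTriangle → MarkedTriangle → Prop
  | refl (t : MarkedTriangle) : DescendsIn 0 t t
  | head {n : ℕ} {a b c : MarkedTriangle} (hab : IsChild a b) (hbc : DescendsIn n b c) :
      DescendsIn (n + 1) a c

theorem DescendsIn.trans {n m : ℕ} {a b c : MarkedTriangle} (hab : DescendsIn n a b)
    (hbc : DescendsIn m b c) : DescendsIn (n + m) a c := by
  induction hab with
  | refl => simpa using hbc
  | @head n _ _ _ h _ ih =>
    have := DescendsIn.head h (ih hbc)
    rwa [show n + m + 1 = n + 1 + m by omega] at this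

theorem IsChild.descendsIn {a b : MarkedTriangle} (h : IsChild a b) : DescendsIn 1 a b :=
  DescendsIn.head h (DescendsIn.refl b)

theorem DescendsIn.tail {n : ℕ} {a b c : MarkedTriangle} (hab : DescendsIn n a b)
    (hbc : IsChild b c) : DescendsIn (n + 1) a c := hab.trans hbc.descendsIn

theorem DescendsIn.isDescendant {n : ℕ} {a b : MarkedTriangle} (h : DescendsIn n a b) :
    a.IsDescendant b := by
  induction h with
  | refl => exact Relation.ReflTransGen.refl
  | head hab _ ih => exact Relation.ReflTransGen.head hab ih

theorem IsDescendant.exists_descendsIn {a b : MarkedTriangle} (h : a.IsDescendant b) :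
    ∃ n, DescendsIn n a b := by
  unfold IsDescendant at h
  induction h with
  | refl => exact ⟨0, DescendsIn.refl a⟩
  | tail _ h ih =>
    obtain ⟨n, hn⟩ := ih
    exact ⟨n + 1, hn.tail h⟩

/-- Induction over descendants, with the last bisection split off. -/
theorem DescendsIn.induction_tail {a : MarkedTriangle} {P : ℕ → MarkedTriangle → Prop}
    (h0 : P 0 a)
    (hs : ∀ n b c, DescendsIn n a b → P n b → IsChild b c → P (n + 1) c) {n : ℕ}
    {b : MarkedTriangle} (h : DescendsIn n a b) : P n b := by
  suffices ∀ m b c, DescendsIn m b c → ∀ k, DescendsIn k a b → P k b → P (k + m) c by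
    simpa using this n a b h 0 (DescendsIn.refl a) h0
  intro m b c hbc
  induction hbc with
  | refl => intro k _ hk; exact hk
  | @head m b b' c hbb _ ih =>
    intro k hk hP
    have := ih (k + 1) (hk.tail hbb) (hs k b b' hk hP hbb)
    rwa [show k + 1 + m = k + (m + 1) by omega] at this

theorem mem_verts {t : MarkedTriangle} {v : Space 2} :
    v ∈ t.verts ↔ v = t.apex ∨ v = t.left ∨ v = t.right := by
  simp [verts]

theorem apex_mem (t : MarkedTriangle) : t.apex ∈ t.verts := by simp [verts]
theorem left_mem (t : MarkedTriangle) : t.left ∈ t.verts := by simp [verts]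
theorem right_mem (t : MarkedTriangle) : t.right ∈ t.verts := by simp [verts]

/-- The triangle with its base vertices exchanged. -/
def swap (t : MarkedTriangle) : MarkedTriangle := ⟨t.apex, t.right, t.left⟩

/-- Thanks to this symmetry, properties of children need to be proved for left children only. -/
theorem leftChild_swap (t : MarkedTriangle) : t.swap.leftChild = t.rightChild := by
  simp [swap, leftChild, rightChild, midpoint_comm]

theorem verts_swap (t : MarkedTriangle) : t.swap.verts = t.verts := by
  ext v; simp only [mem_verts, swap]; tauto

theorem midpoint_apply (u v : Space 2) (i : Fin 2) : (midpoint ℝ u v) i = (u i + v i) / 2 := by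
  rw [midpoint_eq_smul_add]
  simp
  ring

theorem affine_midpoint (A : Space 2 →ᵃ[ℝ] ℝ) (u v : Space 2) :
    A (midpoint ℝ u v) = (A u + A v) / 2 := by
  rw [AffineMap.map_midpoint, midpoint_eq_smul_add]
  simp
  ring

theorem Nondegenerate.swap {t : MarkedTriangle} (h : t.Nondegenerate) : t.swap.Nondegenerate := by
  intro h0
  apply h
  simp only [MarkedTriangle.swap, cross] at h0 ⊢
  linarith

theorem Nondegenerate.leftChild {t : MarkedTriangle} (h : t.Nondegenerate) :
    t.leftChild.Nondegenerate := by
  intro h0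
  apply h
  simp only [MarkedTriangle.leftChild, cross, PiLp.sub_apply, midpoint_apply] at h0 ⊢
  linarith

theorem Nondegenerate.child {t c : MarkedTriangle} (h : t.Nondegenerate) (hc : IsChild t c) :
    c.Nondegenerate := by
  rcases hc with rfl | rfl
  · exact h.leftChild
  · rw [← leftChild_swap]; exact h.swap.leftChild

theorem Nondegenerate.descendsIn {t c : MarkedTriangle} (h : t.Nondegenerate) {n : ℕ}
    (hc : DescendsIn n t c) : c.Nondegenerate := by
  induction hc with
  | refl => exact h
  | head hab _ ih => exact ih (h.child hab)

theorem Nondegenerate.ne {t : MarkedTriangle} (h : t.Nondegenerate) :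
    t.apex ≠ t.left ∧ t.apex ≠ t.right ∧ t.left ≠ t.right := by
  refine ⟨fun h0 => h ?_, fun h0 => h ?_, fun h0 => h ?_⟩ <;> rw [h0] <;>
    simp [cross] <;> ring

theorem Nondegenerate.card {t : MarkedTriangle} (h : t.Nondegenerate) : t.verts.card = 3 := by
  classical
  obtain ⟨h1, h2, h3⟩ := h.ne
  rw [verts, Finset.card_eq_three]
  exact ⟨_, _, _, h1, h2, h3, rfl⟩

theorem Nondegenerate.indep {t : MarkedTriangle} (h : t.Nondegenerate) :
    AffineIndependent ℝ ((↑) : t.verts → Space 2) := by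
  have h1 : AffineIndependent ℝ ![t.apex, t.left, t.right] := by
    rw [affineIndependent_iff_not_collinear_set]
    intro hcol
    obtain ⟨v, hv⟩ := (collinear_iff_of_mem (p₀ := t.apex) (by simp)).1 hcol
    obtain ⟨r, hr⟩ := hv t.left (by simp)
    obtain ⟨r', hr'⟩ := hv t.right (by simp)
    apply h
    rw [hr, hr']
    simp [cross]
    ring
  have h2 := h1.range
  have h3 : (t.verts : Set (Space 2)) = Set.range ![t.apex, t.left, t.right] := by
    ext v
    simp only [Finset.mem_coe, mem_verts, Matrix.range_cons, Matrix.range_empty, mem_union,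
      mem_singleton_iff, union_empty]
  exact AffineIndependent.mono h2 h3.le

/-- If the determinant vanished, the edge vectors at the apex would be proportional, with their own
coordinates as factors. A linear form that is 1 on one vector and 0 on the other would then make the
other one zero. -/
theorem nondegenerate_of_indep {t : MarkedTriangle}
    (h : AffineIndependent ℝ ((↑) : t.verts → Space 2)) (hcard : t.verts.card = 3) :
    t.Nondegenerate := by
  classical
  intro h0
  have hne : t.apex ≠ t.left ∧ t.apex ≠ t.right ∧ t.left ≠ t.right := by
    refine ⟨fun he => ?_, fun he => ?_, fun he => ?_⟩ <;>
    · have := Finset.card_le_two (a := t.left) (b := t.right)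
      have := Finset.card_le_two (a := t.apex) (b := t.right)
      rw [verts, he] at hcard
      simp at hcard
      omega
  obtain ⟨A, hA⟩ := exists_affine_interpolant h (fun v => if v = t.left then 1 else 0)
  obtain ⟨B, hB⟩ := exists_affine_interpolant h (fun v => if v = t.right then 1 else 0)
  have hAl : A.linear (t.left - t.apex) = 1 := by
    have := A.linearMap_vsub t.left t.apex
    simp only [vsub_eq_sub] at this
    rw [this, hA _ t.left_mem, hA _ t.apex_mem, if_pos rfl, if_neg hne.1]; norm_num
  have hAr : A.linear (t.right - t.apex) = 0 := by
    have := A.linearMap_vsub t.right t.apex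
    simp only [vsub_eq_sub] at this
    rw [this, hA _ t.right_mem, hA _ t.apex_mem, if_neg hne.2.2.symm, if_neg hne.1]; norm_num
  have hBr : B.linear (t.right - t.apex) = 1 := by
    have := B.linearMap_vsub t.right t.apex
    simp only [vsub_eq_sub] at this
    rw [this, hB _ t.right_mem, hB _ t.apex_mem, if_pos rfl, if_neg hne.2.1]; norm_num
  have key : ∀ i : Fin 2, (t.right - t.apex) i • (t.left - t.apex) =
      (t.left - t.apex) i • (t.right - t.apex) := by
    intro i
    ext j
    simp only [cross] at h0
    fin_cases i <;> fin_cases j <;> simp at h0 ⊢ <;> linarith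
  have hzero : t.right - t.apex = 0 := by
    ext i
    have := congrArg A.linear (key i)
    rw [map_smul, map_smul, hAl, hAr] at this
    simpa using this
  rw [hzero, map_zero] at hBr
  norm_num at hBr

/-- An affine function that vanishes at the vertices of a nondegenerate triangle is zero. -/
theorem Nondegenerate.affine_eq {t : MarkedTriangle} (h : t.Nondegenerate)
    {A B : Space 2 →ᵃ[ℝ] ℝ} (hAB : ∀ v ∈ t.verts, A v = B v) (x : Space 2) : A x = B x := by
  have htop : affineSpan ℝ (t.verts : Set (Space 2)) = ⊤ := by
    have := (h.indep.affineSpan_eq_top_iff_card_eq_finrank_add_one).2 (by simp [h.card])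
    simpa using this
  have : A = B := AffineMap.ext_on htop hAB
  rw [this]

theorem hull_child_subset {t c : MarkedTriangle} (hc : IsChild t c) : hull c.verts ⊆ hull t.verts := by
  have hm : midpoint ℝ t.left t.right ∈ hull t.verts :=
    (convex_convexHull ℝ _).midpoint_mem (mem_hull t.left_mem) (mem_hull t.right_mem)
  refine convexHull_min ?_ (convex_convexHull ℝ _)
  intro v hv
  rw [Finset.mem_coe, mem_verts] at hv
  rcases hc with rfl | rfl <;> rcases hv with rfl | rfl | rfl
  exacts [hm, mem_hull t.apex_mem, mem_hull t.left_mem, hm, mem_hull t.apex_mem,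
    mem_hull t.right_mem]

theorem DescendsIn.hull_subset {n : ℕ} {t c : MarkedTriangle} (h : DescendsIn n t c) :
    hull c.verts ⊆ hull t.verts := by
  induction h with
  | refl => exact subset_rfl
  | head hab _ ih => exact ih.trans (hull_child_subset hab)

/-- Two nondegenerate triangles that meet in the convex hull of at most two common vertices. -/
structure Separated (q q' : MarkedTriangle) (c : Finset (Space 2)) : Prop where
  subset : c ⊆ q.verts
  subset' : c ⊆ q'.verts
  card : c.card ≤ 2
  inter : hull q.verts ∩ hull q'.verts ⊆ hull c

theorem Separated.symm {q q' : MarkedTriangle} {c : Finset (Space 2)} (h : Separated q q' c) :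
    Separated q' q c :=
  ⟨h.subset', h.subset, h.card, by rw [inter_comm]; exact h.inter⟩

-- The affine function with values 1, -1, 0 at the left, right and apex vertices has opposite signs
-- on the two children; the only vertices of the children at which it vanishes are the ends of the
-- median.
open scoped Classical in
theorem separated_children {q : MarkedTriangle} (hq : q.Nondegenerate) :
    Separated q.leftChild q.rightChild {midpoint ℝ q.left q.right, q.apex} := by
  refine ⟨?_, ?_, Finset.card_le_two, ?_⟩
  · intro v hv
    rw [Finset.mem_insert, Finset.mem_singleton] at hv
    rw [mem_verts]
    rcases hv with rfl | rfl <;> simp [leftChild]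
  · intro v hv
    rw [Finset.mem_insert, Finset.mem_singleton] at hv
    rw [mem_verts]
    rcases hv with rfl | rfl <;> simp [rightChild]
  · obtain ⟨h1, h2, h3⟩ := hq.ne
    obtain ⟨A, hA⟩ := exists_affine_interpolant hq.indep
      (fun v => if v = q.left then 1 else if v = q.right then -1 else 0)
    have hAa : A q.apex = 0 := by rw [hA _ q.apex_mem, if_neg h1, if_neg h2]
    have hAl : A q.left = 1 := by rw [hA _ q.left_mem, if_pos rfl]
    have hAr : A q.right = -1 := by rw [hA _ q.right_mem, if_neg h3.symm, if_pos rfl]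
    have hAm : A (midpoint ℝ q.left q.right) = 0 := by rw [affine_midpoint, hAl, hAr]; norm_num
    rintro x ⟨hx, hx'⟩
    have hnn : ∀ v ∈ q.leftChild.verts, 0 ≤ A v := fun v hv => by
      rw [mem_verts] at hv
      rcases hv with rfl | rfl | rfl
      exacts [hAm.ge, hAa.ge, hAl ▸ zero_le_one]
    have h0 := affine_nonneg_on_hull A hnn hx
    have h0' := affine_nonneg_on_hull (-A) (f := q.rightChild.verts) (fun v hv => by
      rw [mem_verts] at hv
      rw [AffineMap.coe_neg, Pi.neg_apply]
      rcases hv with rfl | rfl | rfl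
      · exact (neg_eq_zero.2 hAm).ge
      · exact (neg_eq_zero.2 hAa).ge
      · show 0 ≤ -(A q.right)
        rw [hAr]; norm_num) hx'
    rw [AffineMap.coe_neg, Pi.neg_apply] at h0'
    refine hull_mono ?_ (mem_hull_filter_zero hx A hnn (by linarith))
    intro v hv
    rw [Finset.mem_filter, mem_verts] at hv
    rw [Finset.mem_insert, Finset.mem_singleton]
    rcases hv with ⟨rfl | rfl | rfl, hv0⟩
    · exact Or.inl rfl
    · exact Or.inr rfl
    · exact absurd (hAl.symm.trans hv0) one_ne_zero

/-- A nondegenerate triangle does not fit into the intersection of separated triangles. -/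
theorem Separated.not_hull_subset {q q' t : MarkedTriangle} {c : Finset (Space 2)}
    (h : Separated q q' c) (hq : q.Nondegenerate) (ht : t.Nondegenerate)
    (hsub : hull t.verts ⊆ hull q.verts) (hsub' : hull t.verts ⊆ hull q'.verts) : False := by
  have hind := affineIndependent_subset hq.indep h.subset
  have hint : (interior (hull t.verts)).Nonempty :=
    interior_hull_nonempty (d := 2) (by simp) ht.card ht.indep
  obtain ⟨x, hx⟩ := hint
  have : x ∈ interior (hull c) :=
    interior_mono (fun y hy => h.inter ⟨hsub hy, hsub' hy⟩) hx
  rw [interior_hull_eq_empty (by simp) h.card hind] at this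
  exact this

/-- Otherwise the child `c` would contain all of `t`, and hence its own sibling, which it meets only
in the median. -/
theorem IsChild.verts_ne {t c d : MarkedTriangle} (ht : t.Nondegenerate) (hc : IsChild t c) {n : ℕ}
    (hd : DescendsIn n c d) : ¬ t.verts ⊆ d.verts := by
  intro hsub
  have hsub' : hull t.verts ⊆ hull c.verts := (hull_mono hsub).trans hd.hull_subset
  have hsep := separated_children ht
  rcases hc with rfl | rfl
  · exact hsep.not_hull_subset ht.leftChild (ht.child (Or.inr rfl))
      ((hull_child_subset (Or.inr rfl)).trans hsub') subset_rfl
  · exact hsep.not_hull_subset ht.leftChild ht.leftChild subset_rfl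
      ((hull_child_subset (Or.inl rfl)).trans hsub')

/-- Two descendants of a triangle are comparable, or they descend from different children of a
common ancestor. -/
theorem DescendsIn.dichotomy {n n' : ℕ} {r t t' : MarkedTriangle} (h : DescendsIn n r t)
    (h' : DescendsIn n' r t') :
    (∃ k, n' = n + k ∧ DescendsIn k t t') ∨ (∃ k, n = n' + k ∧ DescendsIn k t' t) ∨
      ∃ q o m m', DescendsIn o r q ∧ n = m + (o + 1) ∧ n' = m' + (o + 1) ∧
        ((DescendsIn m q.leftChild t ∧ DescendsIn m' q.rightChild t') ∨
          (DescendsIn m q.rightChild t ∧ DescendsIn m' q.leftChild t')) := by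
  induction h generalizing n' with
  | refl => exact Or.inl ⟨n', by omega, h'⟩
  | @head n a b c hab hbc ih =>
    cases h' with
    | refl => exact Or.inr (Or.inl ⟨n + 1, by omega, hbc.head hab⟩)
    | @head m' _ b' _ hab' hbc' =>
      by_cases hb : b = b'
      · subst hb
        rcases ih hbc' with ⟨k, hk, hd⟩ | ⟨k, hk, hd⟩ | ⟨q, o, m, m'', hq, hm, hm', hd⟩
        · exact Or.inl ⟨k, by omega, hd⟩
        · exact Or.inr (Or.inl ⟨k, by omega, hd⟩)
        · exact Or.inr (Or.inr ⟨q, o + 1, m, m'', hq.head hab, by omega, by omega, hd⟩)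
      · refine Or.inr (Or.inr ⟨a, 0, n, m', DescendsIn.refl a, by omega, by omega, ?_⟩)
        rcases hab with rfl | rfl <;> rcases hab' with rfl | rfl
        · exact absurd rfl hb
        · exact Or.inl ⟨hbc, hbc'⟩
        · exact Or.inr ⟨hbc, hbc'⟩
        · exact absurd rfl hb

/-! ### Subdivision of an edge by the descendants of a triangle -/

/-- `x` and `y` are the endpoints of the dyadic interval `[k / 2 ^ j, (k + 1) / 2 ^ j]`. -/
def IsDyadicPair (j k : ℕ) (x y : ℝ) : Prop :=
  (x = k / 2 ^ j ∧ y = (k + 1) / 2 ^ j) ∨ (y = k / 2 ^ j ∧ x = (k + 1) / 2 ^ j)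

theorem IsDyadicPair.symm {j k : ℕ} {x y : ℝ} (h : IsDyadicPair j k x y) : IsDyadicPair j k y x :=
  Or.symm h

theorem IsDyadicPair.half {j k : ℕ} {x y : ℝ} (h : IsDyadicPair j k x y) :
    ∃ k', IsDyadicPair (j + 1) k' ((x + y) / 2) x := by
  have h2 : (2 : ℝ) ^ j ≠ 0 := by positivity
  rcases h with ⟨rfl, rfl⟩ | ⟨rfl, rfl⟩
  · refine ⟨2 * k, Or.inr ⟨?_, ?_⟩⟩ <;> rw [pow_succ] <;> push_cast <;> field_simp <;> ring
  · refine ⟨2 * k + 1, Or.inl ⟨?_, ?_⟩⟩ <;> rw [pow_succ] <;> push_cast <;> field_simp <;> ring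

theorem IsDyadicPair.level_eq {j k j' k' : ℕ} {x y : ℝ} (h : IsDyadicPair j k x y)
    (h' : IsDyadicPair j' k' x y) : j = j' := by
  have key : ∀ {j k : ℕ}, IsDyadicPair j k x y → |x - y| = (1 / 2) ^ j := by
    intro j k h
    rcases h with ⟨rfl, rfl⟩ | ⟨rfl, rfl⟩
    · rw [← sub_div, show (k : ℝ) - (k + 1) = -1 by ring, neg_div, abs_neg, abs_of_pos (by positivity),
        one_div_pow]
    · rw [← sub_div, show (k : ℝ) + 1 - k = 1 by ring, abs_of_pos (by positivity), one_div_pow]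
  have := (key h).symm.trans (key h')
  exact pow_right_injective₀ (by norm_num) (by norm_num) this

/-- Two dyadic intervals are nested, or their interiors are disjoint. -/
theorem dyadic_nested_or_disjoint (j k j' k' : ℕ) :
    ((k : ℝ) / 2 ^ j ≤ k' / 2 ^ j' ∧ ((k' : ℝ) + 1) / 2 ^ j' ≤ (k + 1) / 2 ^ j) ∨
    ((k' : ℝ) / 2 ^ j' ≤ k / 2 ^ j ∧ ((k : ℝ) + 1) / 2 ^ j ≤ (k' + 1) / 2 ^ j') ∨
    ((k : ℝ) + 1) / 2 ^ j ≤ k' / 2 ^ j' ∨ ((k' : ℝ) + 1) / 2 ^ j' ≤ k / 2 ^ j := by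
  wlog hjj : j ≤ j' generalizing j k j' k'
  · rcases this j' k' j k (by omega) with h | h | h | h
    exacts [Or.inr (Or.inl h), Or.inl h, Or.inr (Or.inr (Or.inr h)), Or.inr (Or.inr (Or.inl h))]
  obtain ⟨i, rfl⟩ := Nat.exists_eq_add_of_le hjj
  have h1 : ∀ x : ℕ, (x : ℝ) / 2 ^ j = ((x * 2 ^ i : ℕ) : ℝ) / 2 ^ (j + i) := fun x => by
    push_cast; rw [pow_add]; field_simp
  have hk1 : ((k : ℝ) + 1) = ((k + 1 : ℕ) : ℝ) := by push_cast; ring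
  have hk1' : ((k' : ℝ) + 1) = ((k' + 1 : ℕ) : ℝ) := by push_cast; ring
  have hle : ∀ x y : ℕ, x ≤ y → (x : ℝ) / 2 ^ (j + i) ≤ (y : ℝ) / 2 ^ (j + i) := fun x y h => by
    have : (x : ℝ) ≤ y := by exact_mod_cast h
    gcongr
  rw [hk1, hk1', h1 k, h1 (k + 1)]
  by_cases ha : k' + 1 ≤ k * 2 ^ i
  · exact Or.inr (Or.inr (Or.inr (hle _ _ ha)))
  by_cases hb : (k + 1) * 2 ^ i ≤ k'
  · exact Or.inr (Or.inr (Or.inl (hle _ _ hb)))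
  · exact Or.inl ⟨hle _ _ (by omega), hle _ _ (by omega)⟩

/-- The edges of the triangle `t`, of generation `n`, on the line `ζ = 0` are dyadic intervals in
the coordinate `η`, and their sizes are determined by the generation. -/
structure EdgeInvariant (ζ η : Space 2 →ᵃ[ℝ] ℝ) (c n : ℕ) (t : MarkedTriangle) : Prop where
  -- Halving an edge raises its generation by two, from the base of one triangle to an apex edge of
  -- its child. The offset `c` tells whether the undivided edge is the base of the first triangle
  -- (0) or one of its other edges (1).
  base : ζ t.left = 0 → ζ t.right = 0 → ∃ j k, n = 2 * j + c ∧ IsDyadicPair j k (η t.left) (η t.right)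
  left : ζ t.apex = 0 → ζ t.left = 0 →
    ∃ j k, n + 1 = 2 * j + c ∧ IsDyadicPair j k (η t.apex) (η t.left)
  right : ζ t.apex = 0 → ζ t.right = 0 →
    ∃ j k, n + 1 = 2 * j + c ∧ IsDyadicPair j k (η t.apex) (η t.right)

theorem EdgeInvariant.swap {ζ η : Space 2 →ᵃ[ℝ] ℝ} {c n : ℕ} {t : MarkedTriangle}
    (h : EdgeInvariant ζ η c n t) : EdgeInvariant ζ η c n t.swap := by
  refine ⟨fun h1 h2 => ?_, h.right, h.left⟩
  obtain ⟨j, k, hj, hk⟩ := h.base h2 h1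
  exact ⟨j, k, hj, hk.symm⟩

/-- The child's base is an old apex edge, and one of its apex edges is half the old base. Its other
apex edge, the median, is not on the line: a zero of `ζ` at the midpoint forces zeros at both base
vertices, and with the apex `ζ` would vanish at all vertices. -/
theorem EdgeInvariant.leftChild {ζ η : Space 2 →ᵃ[ℝ] ℝ} {c n : ℕ} {t : MarkedTriangle}
    (h : EdgeInvariant ζ η c n t) (hnn : ∀ v ∈ t.verts, 0 ≤ ζ v) (hne : ∃ v ∈ t.verts, ζ v ≠ 0) :
    EdgeInvariant ζ η c (n + 1) t.leftChild := by
  have hmid : ζ (midpoint ℝ t.left t.right) = 0 → ζ t.left = 0 ∧ ζ t.right = 0 := fun h0 => by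
    rw [affine_midpoint] at h0
    have h1 := hnn _ t.left_mem
    have h2 := hnn _ t.right_mem
    constructor <;> linarith
  refine ⟨h.left, fun h1 h2 => ?_, fun h1 _ => ?_⟩
  · obtain ⟨hl, hr⟩ := hmid h1
    obtain ⟨v, hv, hv0⟩ := hne
    rw [mem_verts] at hv
    rcases hv with rfl | rfl | rfl
    exacts [absurd h2 hv0, absurd hl hv0, absurd hr hv0]
  · obtain ⟨hl, hr⟩ := hmid h1
    obtain ⟨j, k, hj, hk⟩ := h.base hl hr
    obtain ⟨k', hk'⟩ := hk.half
    refine ⟨j + 1, k', by omega, ?_⟩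
    show IsDyadicPair (j + 1) k' (η (midpoint ℝ t.left t.right)) (η t.left)
    rw [affine_midpoint]
    exact hk'

theorem EdgeInvariant.descendsIn {ζ η : Space 2 →ᵃ[ℝ] ℝ} {c : ℕ} {r : MarkedTriangle}
    (hr : r.Nondegenerate) (h : EdgeInvariant ζ η c 0 r) (hnn : ∀ v ∈ r.verts, 0 ≤ ζ v)
    (hne : ∃ v ∈ r.verts, ζ v ≠ 0) {n : ℕ} {t : MarkedTriangle} (ht : DescendsIn n r t) :
    EdgeInvariant ζ η c n t ∧ (∀ v ∈ t.verts, 0 ≤ ζ v) ∧ ∃ v ∈ t.verts, ζ v ≠ 0 := by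
  have hprop : ∀ {n t}, DescendsIn n r t → (∀ v ∈ t.verts, 0 ≤ ζ v) ∧ ∃ v ∈ t.verts, ζ v ≠ 0 := by
    intro n t ht
    refine ⟨fun v hv => affine_nonneg_on_hull ζ hnn (ht.hull_subset (mem_hull hv)), ?_⟩
    by_contra hcon
    push Not at hcon
    obtain ⟨v, -, hv0⟩ := hne
    exact hv0 ((hr.descendsIn ht).affine_eq (B := AffineMap.const ℝ _ 0) hcon v)
  refine ⟨?_, hprop ht⟩
  refine DescendsIn.induction_tail (P := fun n t => EdgeInvariant ζ η c n t) h ?_ ht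
  intro n b b' hb hP hbb
  obtain ⟨h1, h2⟩ := hprop hb
  rcases hbb with rfl | rfl
  · exact hP.leftChild h1 h2
  · rw [← leftChild_swap]
    exact hP.swap.leftChild (by rwa [verts_swap]) (by rwa [verts_swap])

theorem EdgeInvariant.exists_dyadic {ζ η : Space 2 →ᵃ[ℝ] ℝ} {c n : ℕ} {t : MarkedTriangle}
    (h : EdgeInvariant ζ η c n t) {v w : Space 2} (hv : v ∈ t.verts) (hw : w ∈ t.verts) (hvw : v ≠ w)
    (hv0 : ζ v = 0) (hw0 : ζ w = 0) : ∃ j k, IsDyadicPair j k (η v) (η w) := by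
  rw [mem_verts] at hv hw
  rcases hv with rfl | rfl | rfl <;> rcases hw with rfl | rfl | rfl
  · exact absurd rfl hvw
  · obtain ⟨j, k, -, h⟩ := h.left hv0 hw0; exact ⟨j, k, h⟩
  · obtain ⟨j, k, -, h⟩ := h.right hv0 hw0; exact ⟨j, k, h⟩
  · obtain ⟨j, k, -, h⟩ := h.left hw0 hv0; exact ⟨j, k, h.symm⟩
  · exact absurd rfl hvw
  · obtain ⟨j, k, -, h⟩ := h.base hv0 hw0; exact ⟨j, k, h⟩
  · obtain ⟨j, k, -, h⟩ := h.right hw0 hv0; exact ⟨j, k, h.symm⟩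
  · obtain ⟨j, k, -, h⟩ := h.base hw0 hv0; exact ⟨j, k, h.symm⟩
  · exact absurd rfl hvw

/-- Coordinates adapted to a face with at most two vertices. -/
theorem exists_unit_coordinate {c : Finset (Space 2)} (hcard : c.card ≤ 2)
    (hind : AffineIndependent ℝ ((↑) : c → Space 2)) :
    ∃ η : Space 2 →ᵃ[ℝ] ℝ, ∀ v ∈ c, ∀ w ∈ c, v ≠ w → IsDyadicPair 0 0 (η v) (η w) := by
  classical
  rcases c.eq_empty_or_nonempty with rfl | ⟨x, hx⟩
  · exact ⟨0, by simp⟩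
  obtain ⟨η, hη⟩ := exists_affine_interpolant hind (fun v => if v = x then 0 else 1)
  have hx0 : η x = 0 := by rw [hη x hx, if_pos rfl]
  have h1 : ∀ v ∈ c, v ≠ x → η v = 1 := fun v hv hvx => by rw [hη v hv, if_neg hvx]
  refine ⟨η, fun v hv w hw hvw => ?_⟩
  by_cases hvx : v = x
  · subst hvx
    left
    rw [hx0, h1 w hw hvw.symm]; norm_num
  · by_cases hwx : w = x
    · subst hwx
      right
      rw [hx0, h1 v hv hvw]; norm_num
    · exfalso
      have : ({x, v, w} : Finset (Space 2)).card ≤ c.card :=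
        Finset.card_le_card (by
          intro y hy
          simp only [Finset.mem_insert, Finset.mem_singleton] at hy
          rcases hy with rfl | rfl | rfl <;> assumption)
      rw [Finset.card_eq_three.2 ⟨x, v, w, Ne.symm hvx, Ne.symm hwx, hvw, rfl⟩] at this
      omega

/-- `ζ` is the total barycentric weight outside `c`. The offset is 0 exactly when `c` contains both
base vertices; then it contains no apex, since `c` has at most two elements. -/
theorem exists_edgeInvariant {q : MarkedTriangle} (hq : q.Nondegenerate) {c : Finset (Space 2)}
    (hc : c ⊆ q.verts) (hcard : c.card ≤ 2) {η : Space 2 →ᵃ[ℝ] ℝ}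
    (hη : ∀ v ∈ c, ∀ w ∈ c, v ≠ w → IsDyadicPair 0 0 (η v) (η w)) :
    ∃ (ζ : Space 2 →ᵃ[ℝ] ℝ) (o : ℕ), o ≤ 1 ∧ (¬ (q.left ∈ c ∧ q.right ∈ c) → o = 1) ∧
      EdgeInvariant ζ η o 0 q ∧ (∀ v ∈ q.verts, 0 ≤ ζ v) ∧ (∃ v ∈ q.verts, ζ v ≠ 0) ∧
      (∀ x ∈ hull c, ζ x = 0) ∧ ∀ x ∈ hull q.verts, ζ x = 0 → x ∈ hull c := by
  classical
  obtain ⟨ζ, hζ⟩ := exists_affine_interpolant hq.indep (fun v => if v ∈ c then 0 else 1)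
  have hζ0 : ∀ v ∈ q.verts, ζ v = 0 → v ∈ c := fun v hv h0 => by
    by_contra hvc
    rw [hζ v hv, if_neg hvc] at h0
    exact one_ne_zero h0
  have hnn : ∀ v ∈ q.verts, 0 ≤ ζ v := fun v hv => by
    rw [hζ v hv]; split_ifs <;> norm_num
  obtain ⟨h1, h2, h3⟩ := hq.ne
  have hthree : ¬ (q.apex ∈ c ∧ q.left ∈ c ∧ q.right ∈ c) := fun ⟨ha, hl, hr⟩ => by
    have : q.verts ⊆ c := fun v hv => by
      rw [mem_verts] at hv
      rcases hv with rfl | rfl | rfl <;> assumption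
    have := Finset.card_le_card this
    rw [hq.card] at this
    omega
  refine ⟨ζ, if q.left ∈ c ∧ q.right ∈ c then 0 else 1, by split_ifs <;> norm_num,
    fun h => by rw [if_neg h], ⟨fun hl hr => ?_, fun ha hl => ?_, fun ha hr => ?_⟩, hnn, ?_, ?_, ?_⟩
  · have hl' := hζ0 _ q.left_mem hl
    have hr' := hζ0 _ q.right_mem hr
    exact ⟨0, 0, by rw [if_pos ⟨hl', hr'⟩], hη _ hl' _ hr' h3⟩
  · have ha' := hζ0 _ q.apex_mem ha
    have hl' := hζ0 _ q.left_mem hl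
    exact ⟨0, 0, by rw [if_neg fun h => hthree ⟨ha', h⟩], hη _ ha' _ hl' h1⟩
  · have ha' := hζ0 _ q.apex_mem ha
    have hr' := hζ0 _ q.right_mem hr
    exact ⟨0, 0, by rw [if_neg fun h => hthree ⟨ha', h⟩], hη _ ha' _ hr' h2⟩
  · by_contra hcon
    push Not at hcon
    exact hthree ⟨hζ0 _ q.apex_mem (hcon _ q.apex_mem), hζ0 _ q.left_mem (hcon _ q.left_mem),
      hζ0 _ q.right_mem (hcon _ q.right_mem)⟩
  · intro x hx
    exact affine_eq_on_hull ζ (AffineMap.const ℝ _ 0) (fun v hv => by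
      rw [hζ v (hc hv), if_pos hv]; rfl) hx
  · intro x hx h0
    refine hull_mono ?_ (mem_hull_filter_zero hx ζ hnn h0)
    intro v hv
    rw [Finset.mem_filter] at hv
    exact hζ0 v hv.1 hv.2

end MarkedTriangle

namespace MarkedTriangle

theorem injOn_hull_of_unit_coordinate {c : Finset (Space 2)} {η : Space 2 →ᵃ[ℝ] ℝ}
    (hcard : c.card ≤ 2) (hη : ∀ v ∈ c, ∀ w ∈ c, v ≠ w → IsDyadicPair 0 0 (η v) (η w)) :
    InjOn η (hull c) := by
  classical
  rcases Nat.lt_or_ge c.card 2 with h | h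
  · rcases Finset.card_le_one_iff_subset_singleton.1 (by omega : c.card ≤ 1) with ⟨x, hx⟩
    intro v hv w hw _
    have h1 := hull_mono hx hv
    have h2 := hull_mono hx hw
    simp only [hull, Finset.coe_singleton, convexHull_singleton, mem_singleton_iff] at h1 h2
    rw [h1, h2]
  · obtain ⟨x, y, hxy, rfl⟩ := Finset.card_eq_two.1 (le_antisymm hcard h)
    have hxy' : η x ≠ η y := by
      rcases hη x (by simp) y (by simp) hxy with ⟨h1, h2⟩ | ⟨h1, h2⟩ <;> rw [h1, h2] <;> norm_num
    intro v hv w hw hvw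
    rw [hull, Finset.coe_pair, convexHull_pair, segment_eq_image_lineMap] at hv hw
    obtain ⟨a, -, rfl⟩ := hv
    obtain ⟨b, -, rfl⟩ := hw
    rw [AffineMap.apply_lineMap, AffineMap.apply_lineMap, AffineMap.lineMap_apply,
      AffineMap.lineMap_apply] at hvw
    simp only [vsub_eq_sub, smul_eq_mul, vadd_eq_add, add_left_inj, mul_eq_mul_right_iff] at hvw
    rcases hvw with rfl | h0
    · rfl
    · exact absurd (sub_eq_zero.1 h0).symm hxy'

theorem mem_segment_iff_of_injOn {S : Set (Space 2)} (hS : Convex ℝ S) {η : Space 2 →ᵃ[ℝ] ℝ}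
    (hinj : InjOn η S) {v w : Space 2} (hv : v ∈ S) (hw : w ∈ S) (hvw : η v ≤ η w) {P : Space 2}
    (hP : P ∈ S) : P ∈ segment ℝ v w ↔ η P ∈ Icc (η v) (η w) := by
  have himg : η '' segment ℝ v w = Icc (η v) (η w) := by
    rw [image_segment, segment_eq_Icc hvw]
  constructor
  · intro h; rw [← himg]; exact mem_image_of_mem η h
  · intro h
    rw [← himg] at h
    obtain ⟨Q, hQ, hQP⟩ := h
    rwa [← hinj (hS.segment_subset hv hw hQ) hP hQP]

-- On `S` the coordinate `η` is injective, so segments compare like dyadic intervals: they are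
-- nested, or they share at most an endpoint.
open scoped Classical in
theorem exists_inter_dyadic {S : Set (Space 2)} (hS : Convex ℝ S) {η : Space 2 →ᵃ[ℝ] ℝ}
    (hinj : InjOn η S) {v w v' w' : Space 2} (hv : v ∈ S) (hw : w ∈ S) (hv' : v' ∈ S)
    (hw' : w' ∈ S) {j k j' k' : ℕ} (h : IsDyadicPair j k (η v) (η w))
    (h' : IsDyadicPair j' k' (η v') (η w')) :
    ∃ u : Finset (Space 2), (u ⊆ {v, w} ∨ u ⊆ {v', w'}) ∧
      hull {v, w} ∩ hull {v', w'} = hull u := by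
  wlog ho : η v = k / 2 ^ j ∧ η w = (k + 1) / 2 ^ j generalizing v w
  · have := this hw hv h.symm (h.resolve_left ho)
    rwa [Finset.pair_comm w v] at this
  wlog ho' : η v' = k' / 2 ^ j' ∧ η w' = (k' + 1) / 2 ^ j' generalizing v' w'
  · have := this hw' hv' h'.symm (h'.resolve_left ho')
    rwa [Finset.pair_comm w' v'] at this
  have hseg : ∀ a b : Space 2, hull ({a, b} : Finset (Space 2)) = segment ℝ a b := fun a b => by
    rw [hull, Finset.coe_pair, convexHull_pair]
  have hvw : η v ≤ η w := by rw [ho.1, ho.2]; gcongr; linarith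
  have hvw' : η v' ≤ η w' := by rw [ho'.1, ho'.2]; gcongr; linarith
  have hmem := fun {P} (hP : P ∈ S) => mem_segment_iff_of_injOn hS hinj hv hw hvw hP
  have hmem' := fun {P} (hP : P ∈ S) => mem_segment_iff_of_injOn hS hinj hv' hw' hvw' hP
  have hsub : segment ℝ v w ⊆ S := hS.segment_subset hv hw
  have hsub' : segment ℝ v' w' ⊆ S := hS.segment_subset hv' hw'
  have single : ∀ z, (z = v ∨ z = w) → segment ℝ v w ∩ segment ℝ v' w' ⊆ {z} →
      ∃ u : Finset (Space 2), (u ⊆ {v, w} ∨ u ⊆ {v', w'}) ∧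
      hull {v, w} ∩ hull {v', w'} = hull u := by
    intro z hz hsubz
    rw [hseg, hseg]
    rcases subset_singleton_iff_eq.1 hsubz with h0 | h0
    · exact ⟨∅, Or.inl (Finset.empty_subset _), by rw [h0]; simp [hull]⟩
    · exact ⟨{z}, Or.inl (by simpa using hz), by rw [h0]; simp [hull]⟩
  have hd := dyadic_nested_or_disjoint j k j' k'
  rw [← ho.1, ← ho.2, ← ho'.1, ← ho'.2] at hd
  rcases hd with ⟨h1, h2⟩ | ⟨h1, h2⟩ | h1 | h1
  · refine ⟨{v', w'}, Or.inr subset_rfl, ?_⟩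
    rw [hseg, hseg]
    refine inter_eq_right.2 fun P hP => ?_
    have := (hmem' (hsub' hP)).1 hP
    exact (hmem (hsub' hP)).2 ⟨h1.trans this.1, this.2.trans h2⟩
  · refine ⟨{v, w}, Or.inl subset_rfl, ?_⟩
    rw [hseg, hseg]
    refine inter_eq_left.2 fun P hP => ?_
    have := (hmem (hsub hP)).1 hP
    exact (hmem' (hsub hP)).2 ⟨h1.trans this.1, this.2.trans h2⟩
  · refine single w (Or.inr rfl) ?_
    rintro P ⟨hP, hP'⟩
    have h3 := (hmem (hsub hP)).1 hP
    have h4 := (hmem' (hsub hP)).1 hP'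
    exact hinj (hsub hP) hw (le_antisymm h3.2 (h1.trans h4.1))
  · refine single v (Or.inl rfl) ?_
    rintro P ⟨hP, hP'⟩
    have h3 := (hmem (hsub hP)).1 hP
    have h4 := (hmem' (hsub hP)).1 hP'
    exact hinj (hsub hP) hv (le_antisymm (h4.2.trans h1) h3.1)

/-- Faces of descendants of separated triangles intersect in a face of one of them. -/
theorem Separated.exists_inter {q q' : MarkedTriangle} {c : Finset (Space 2)}
    (hsep : Separated q q' c) (hq : q.Nondegenerate) (hq' : q'.Nondegenerate) {m m' : ℕ}
    {t t' : MarkedTriangle} (ht : DescendsIn m q t) (ht' : DescendsIn m' q' t')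
    {a b : Finset (Space 2)} (ha : a ⊆ t.verts) (hb : b ⊆ t'.verts) :
    ∃ u : Finset (Space 2), (u ⊆ a ∨ u ⊆ b) ∧ hull a ∩ hull b = hull u := by
  classical
  have hind := affineIndependent_subset hq.indep hsep.subset
  obtain ⟨η, hη⟩ := exists_unit_coordinate hsep.card hind
  obtain ⟨ζ, o, -, -, hE, hnn, hne, hζc, hζ⟩ := exists_edgeInvariant hq hsep.subset hsep.card hη
  obtain ⟨ζ', o', -, -, hE', hnn', hne', hζc', hζ'⟩ :=
    exists_edgeInvariant hq' hsep.subset' hsep.card hη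
  obtain ⟨hEt, htnn, htne⟩ := hE.descendsIn hq hnn hne ht
  obtain ⟨hEt', htnn', htne'⟩ := hE'.descendsIn hq' hnn' hne' ht'
  -- Common points lie in `c`, so only the vertices on its line matter, on either side.
  set a₀ := a.filter fun v => ζ v = 0 with ha₀
  set b₀ := b.filter fun v => ζ' v = 0 with hb₀
  have hEq : hull a ∩ hull b = hull a₀ ∩ hull b₀ := by
    refine subset_antisymm ?_ (inter_subset_inter (hull_mono (Finset.filter_subset _ _))
      (hull_mono (Finset.filter_subset _ _)))
    rintro P ⟨hPa, hPb⟩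
    have hPc : P ∈ hull c := hsep.inter ⟨ht.hull_subset (hull_mono ha hPa),
      ht'.hull_subset (hull_mono hb hPb)⟩
    exact ⟨mem_hull_filter_zero hPa ζ (fun v hv => htnn v (ha hv)) (hζc P hPc),
      mem_hull_filter_zero hPb ζ' (fun v hv => htnn' v (hb hv)) (hζc' P hPc)⟩
  have hac : ∀ v ∈ a₀, v ∈ hull c := fun v hv => by
    rw [Finset.mem_filter] at hv
    exact hζ v (ht.hull_subset (mem_hull (ha hv.1))) hv.2
  have hbc : ∀ v ∈ b₀, v ∈ hull c := fun v hv => by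
    rw [Finset.mem_filter] at hv
    exact hζ' v (ht'.hull_subset (mem_hull (hb hv.1))) hv.2
  have hsingle : ∀ e f : Finset (Space 2), e.card ≤ 1 →
      ∃ u : Finset (Space 2), u ⊆ e ∧ hull e ∩ hull f = hull u := by
    intro e f he
    obtain ⟨x, hx⟩ := Finset.card_le_one_iff_subset_singleton.1 he
    rcases Finset.subset_singleton_iff.1 hx with rfl | rfl
    · exact ⟨∅, subset_rfl, by simp [hull]⟩
    · by_cases hxf : x ∈ hull f
      · exact ⟨{x}, subset_rfl, by simp only [hull, Finset.coe_singleton, convexHull_singleton];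
                                   exact inter_eq_left.2 (by simpa using hxf)⟩
      · refine ⟨∅, Finset.empty_subset _, ?_⟩
        simp only [hull, Finset.coe_singleton, convexHull_singleton, Finset.coe_empty,
          convexHull_empty]
        exact singleton_inter_eq_empty.2 hxf
  have hpair : ∀ (s : MarkedTriangle) (ξ : Space 2 →ᵃ[ℝ] ℝ) (e : Finset (Space 2)), e ⊆ s.verts →
      s.verts.card = 3 → (∃ v ∈ s.verts, ξ v ≠ 0) → (∀ v ∈ e, ξ v = 0) → ¬ e.card ≤ 1 →
      ∃ v w, v ≠ w ∧ e = {v, w} := by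
    intro s ξ e he hcard ⟨v, hv, hv0⟩ hξ h1
    rw [← Finset.card_eq_two]
    have : e.card < s.verts.card :=
      Finset.card_lt_card ⟨he, fun hle => hv0 (hξ v (hle hv))⟩
    omega
  rw [hEq]
  -- At most two vertices of a triangle are on the line. A set with at most one vertex meets
  -- anything in itself or not at all; otherwise both sides contribute dyadic segments.
  by_cases h1 : a₀.card ≤ 1
  · obtain ⟨u, hu, h⟩ := hsingle a₀ b₀ h1
    exact ⟨u, Or.inl (hu.trans (Finset.filter_subset _ _)), h⟩
  by_cases h2 : b₀.card ≤ 1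
  · obtain ⟨u, hu, h⟩ := hsingle b₀ a₀ h2
    exact ⟨u, Or.inr (hu.trans (Finset.filter_subset _ _)), by rw [inter_comm]; exact h⟩
  obtain ⟨v, w, hvw, hvwa⟩ := hpair t ζ a₀ ((Finset.filter_subset _ _).trans ha)
    (hq.descendsIn ht).card htne (fun v hv => (Finset.mem_filter.1 hv).2) h1
  obtain ⟨v', w', hvw', hvwb⟩ := hpair t' ζ' b₀ ((Finset.filter_subset _ _).trans hb)
    (hq'.descendsIn ht').card htne' (fun v hv => (Finset.mem_filter.1 hv).2) h2
  have hva : v ∈ a₀ := by rw [hvwa]; simp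
  have hwa : w ∈ a₀ := by rw [hvwa]; simp
  have hvb : v' ∈ b₀ := by rw [hvwb]; simp
  have hwb : w' ∈ b₀ := by rw [hvwb]; simp
  obtain ⟨j, k, hjk⟩ := hEt.exists_dyadic (ha (Finset.mem_filter.1 hva).1)
    (ha (Finset.mem_filter.1 hwa).1) hvw (Finset.mem_filter.1 hva).2 (Finset.mem_filter.1 hwa).2
  obtain ⟨j', k', hjk'⟩ := hEt'.exists_dyadic (hb (Finset.mem_filter.1 hvb).1)
    (hb (Finset.mem_filter.1 hwb).1) hvw' (Finset.mem_filter.1 hvb).2 (Finset.mem_filter.1 hwb).2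
  obtain ⟨u, hu, h⟩ := exists_inter_dyadic (convex_convexHull ℝ (c : Set (Space 2)))
    (injOn_hull_of_unit_coordinate hsep.card hη) (hac v hva) (hac w hwa) (hbc v' hvb) (hbc w' hwb)
    hjk hjk'
  rw [← hvwa, ← hvwb] at h hu
  exact ⟨u, hu.imp (fun h => h.trans (Finset.filter_subset _ _))
    (fun h => h.trans (Finset.filter_subset _ _)), h⟩

/-- The faces of a triangle and of a triangle inside it intersect in faces of the latter. -/
theorem exists_inter_of_hull_subset {t t' : MarkedTriangle} (ht : t.Nondegenerate)
    (hsub : hull t'.verts ⊆ hull t.verts) {a b : Finset (Space 2)} (ha : a ⊆ t.verts)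
    (hb : b ⊆ t'.verts) : ∃ u : Finset (Space 2), u ⊆ b ∧ hull a ∩ hull b = hull u := by
  classical
  -- The barycentric weight outside `a` is nonnegative on the smaller triangle too, so its zero set
  -- cuts a face out of `b`.
  obtain ⟨ζ, hζ⟩ := exists_affine_interpolant ht.indep (fun v => if v ∈ a then 0 else 1)
  have hnn : ∀ v ∈ t.verts, 0 ≤ ζ v := fun v hv => by
    rw [hζ v hv]; split_ifs <;> norm_num
  refine ⟨b.filter fun v => ζ v = 0, Finset.filter_subset _ _, subset_antisymm ?_ ?_⟩
  · rintro P ⟨hPa, hPb⟩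
    refine mem_hull_filter_zero hPb ζ (fun v hv =>
      affine_nonneg_on_hull ζ hnn (hsub (mem_hull (hb hv)))) ?_
    exact affine_eq_on_hull ζ (AffineMap.const ℝ _ 0) (fun v hv => by
      rw [hζ v (ha hv), if_pos hv]; rfl) hPa
  · refine subset_inter ?_ (hull_mono (Finset.filter_subset _ _))
    refine convexHull_min ?_ (convex_convexHull ℝ _)
    intro v hv
    rw [Finset.mem_coe, Finset.mem_filter] at hv
    refine hull_mono ?_ (mem_hull_filter_zero (hsub (mem_hull (hb hv.1))) ζ hnn hv.2)
    intro w hw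
    rw [Finset.mem_filter] at hw
    by_contra hwa
    have := hζ w hw.1
    rw [if_neg hwa, hw.2] at this
    exact zero_ne_one this

/-- The generation of an edge of a triangle of generation `n`: that of the triangle if it is the
base, and one more otherwise. -/
def IsEdgeGeneration (n : ℕ) (t : MarkedTriangle) (e : Sym2 (Space 2)) (g : ℕ) : Prop :=
  (e = t.base ∧ g = n) ∨ ((e = s(t.apex, t.left) ∨ e = s(t.apex, t.right)) ∧ g = n + 1)

theorem IsEdgeGeneration.mem_verts {n g : ℕ} {t : MarkedTriangle} {v w : Space 2}
    (h : IsEdgeGeneration n t s(v, w) g) : v ∈ t.verts ∧ w ∈ t.verts := by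
  simp only [MarkedTriangle.mem_verts]
  rcases h with ⟨h, -⟩ | ⟨h | h, -⟩ <;>
    simp only [base, Sym2.eq_iff] at h <;> rcases h with ⟨rfl, rfl⟩ | ⟨rfl, rfl⟩ <;> simp

theorem EdgeInvariant.generation {ζ η : Space 2 →ᵃ[ℝ] ℝ} {c n g : ℕ} {t : MarkedTriangle}
    (h : EdgeInvariant ζ η c n t) {v w : Space 2} (hg : IsEdgeGeneration n t s(v, w) g)
    (hv : ζ v = 0) (hw : ζ w = 0) : ∃ j k, g = 2 * j + c ∧ IsDyadicPair j k (η v) (η w) := by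
  rcases hg with ⟨he, rfl⟩ | ⟨he | he, rfl⟩ <;> simp only [MarkedTriangle.base, Sym2.eq_iff] at he <;>
    rcases he with ⟨rfl, rfl⟩ | ⟨rfl, rfl⟩
  · exact h.base hv hw
  · obtain ⟨j, k, h1, h2⟩ := h.base hw hv; exact ⟨j, k, h1, h2.symm⟩
  · exact h.left hv hw
  · obtain ⟨j, k, h1, h2⟩ := h.left hw hv; exact ⟨j, k, h1, h2.symm⟩
  · exact h.right hv hw
  · obtain ⟨j, k, h1, h2⟩ := h.right hw hv; exact ⟨j, k, h1, h2.symm⟩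

end MarkedTriangle

/-! ### Forests of marked triangles -/

open MarkedTriangle

/-- Nondegenerate triangles, any two of which meet in a common face of dimension at most one. -/
structure IsForest (𝒯₀ : Finset MarkedTriangle) : Prop where
  nondegenerate : ∀ r ∈ 𝒯₀, r.Nondegenerate
  separated : ∀ r ∈ 𝒯₀, ∀ r' ∈ 𝒯₀, r ≠ r' → ∃ c, Separated r r' c

/-- The triangle `t` is a descendant of generation `n` of a triangle of `𝒯₀`. -/
def HasGeneration (𝒯₀ : Finset MarkedTriangle) (n : ℕ) (t : MarkedTriangle) : Prop :=
  ∃ r ∈ 𝒯₀, DescendsIn n r t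

namespace IsForest

variable {𝒯₀ : Finset MarkedTriangle} (h𝒯₀ : IsForest 𝒯₀)

include h𝒯₀

theorem nondegenerate_of_hasGeneration {n : ℕ} {t : MarkedTriangle} (ht : HasGeneration 𝒯₀ n t) :
    t.Nondegenerate := by
  obtain ⟨r, hr, hd⟩ := ht
  exact (h𝒯₀.nondegenerate r hr).descendsIn hd

/-- `o` is the generation of the triangles `q`, `q'` at which the lines of descent part. For
different initial triangles it is 0, and the markings are unrelated. Otherwise `q` and `q'` are
siblings; their common edge is the median, which is the base of neither, and this fixes the parity
of edge generations on both sides. -/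
theorem comparable_or_separated {n n' : ℕ} {t t' : MarkedTriangle} (ht : HasGeneration 𝒯₀ n t)
    (ht' : HasGeneration 𝒯₀ n' t') :
    (∃ k, n' = n + k ∧ DescendsIn k t t') ∨ (∃ k, n = n' + k ∧ DescendsIn k t' t) ∨
      ∃ q q' c o m m', q.Nondegenerate ∧ q'.Nondegenerate ∧ Separated q q' c ∧ DescendsIn m q t ∧
        DescendsIn m' q' t' ∧ n = m + o ∧ n' = m' + o ∧
        (o = 0 ∨ (¬ (q.left ∈ c ∧ q.right ∈ c) ∧ ¬ (q'.left ∈ c ∧ q'.right ∈ c))) := by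
  classical
  obtain ⟨r, hr, hd⟩ := ht
  obtain ⟨r', hr', hd'⟩ := ht'
  by_cases hrr : r = r'
  · subst hrr
    rcases hd.dichotomy hd' with h | h | ⟨q, o, m, m', hq, hm, hm', hor⟩
    · exact Or.inl h
    · exact Or.inr (Or.inl h)
    · have hqn := (h𝒯₀.nondegenerate r hr).descendsIn hq
      have hsep := separated_children hqn
      have hL : ¬ (q.leftChild.left ∈ ({midpoint ℝ q.left q.right, q.apex} : Finset (Space 2)) ∧
          q.leftChild.right ∈ ({midpoint ℝ q.left q.right, q.apex} : Finset (Space 2))) := by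
        rintro ⟨-, h⟩
        rw [Finset.mem_insert, Finset.mem_singleton] at h
        rcases h with h | h
        · exact hqn.leftChild.ne.2.1 h.symm
        · exact hqn.ne.1 h.symm
      have hR : ¬ (q.rightChild.left ∈ ({midpoint ℝ q.left q.right, q.apex} : Finset (Space 2)) ∧
          q.rightChild.right ∈ ({midpoint ℝ q.left q.right, q.apex} : Finset (Space 2))) := by
        rintro ⟨-, h⟩
        rw [Finset.mem_insert, Finset.mem_singleton] at h
        rcases h with h | h
        · exact (hqn.child (Or.inr rfl)).ne.2.1 h.symm
        · exact hqn.ne.2.1 h.symm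
      refine Or.inr (Or.inr ?_)
      rcases hor with ⟨h1, h2⟩ | ⟨h1, h2⟩
      · exact ⟨_, _, _, o + 1, m, m', hqn.leftChild, hqn.child (Or.inr rfl), hsep, h1, h2, hm, hm',
          Or.inr ⟨hL, hR⟩⟩
      · exact ⟨_, _, _, o + 1, m, m', hqn.child (Or.inr rfl), hqn.leftChild, hsep.symm, h1, h2, hm,
          hm', Or.inr ⟨hR, hL⟩⟩
  · obtain ⟨c, hc⟩ := h𝒯₀.separated r hr r' hr' hrr
    exact Or.inr (Or.inr ⟨r, r', c, 0, n, n', h𝒯₀.nondegenerate r hr, h𝒯₀.nondegenerate r' hr', hc,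
      hd, hd', rfl, rfl, Or.inl rfl⟩)

theorem exists_inter {n n' : ℕ} {t t' : MarkedTriangle} (ht : HasGeneration 𝒯₀ n t)
    (ht' : HasGeneration 𝒯₀ n' t') {a b : Finset (Space 2)} (ha : a ⊆ t.verts)
    (hb : b ⊆ t'.verts) :
    ∃ u : Finset (Space 2), (u ⊆ a ∨ u ⊆ b) ∧ hull a ∩ hull b = hull u := by
  rcases h𝒯₀.comparable_or_separated ht ht' with ⟨k, -, hd⟩ | ⟨k, -, hd⟩ |
    ⟨q, q', c, o, m, m', hq, hq', hsep, hd, hd', -⟩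
  · obtain ⟨u, hu, h⟩ := exists_inter_of_hull_subset (h𝒯₀.nondegenerate_of_hasGeneration ht)
      hd.hull_subset ha hb
    exact ⟨u, Or.inr hu, h⟩
  · obtain ⟨u, hu, h⟩ := exists_inter_of_hull_subset (h𝒯₀.nondegenerate_of_hasGeneration ht')
      hd.hull_subset hb ha
    exact ⟨u, Or.inl hu, by rw [inter_comm]; exact h⟩
  · exact hsep.exists_inter hq hq' hd hd' ha hb

/-- If a nondegenerate triangle lies in two descendants, then these are comparable. -/
theorem comparable {n n' : ℕ} {t t' s : MarkedTriangle} (ht : HasGeneration 𝒯₀ n t)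
    (ht' : HasGeneration 𝒯₀ n' t') (hs : s.Nondegenerate) (hst : hull s.verts ⊆ hull t.verts)
    (hst' : hull s.verts ⊆ hull t'.verts) :
    (∃ k, n' = n + k ∧ DescendsIn k t t') ∨ (∃ k, n = n' + k ∧ DescendsIn k t' t) := by
  rcases h𝒯₀.comparable_or_separated ht ht' with h | h |
    ⟨q, q', c, o, m, m', hq, hq', hsep, hd, hd', -⟩
  · exact Or.inl h
  · exact Or.inr h
  · exact (hsep.not_hull_subset hq hs (hst.trans hd.hull_subset) (hst'.trans hd'.hull_subset)).elim

theorem generation_unique {n n' : ℕ} {t : MarkedTriangle} (ht : HasGeneration 𝒯₀ n t)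
    (ht' : HasGeneration 𝒯₀ n' t) : n = n' := by
  have hnd := h𝒯₀.nondegenerate_of_hasGeneration ht
  have hself : ∀ k, DescendsIn k t t → k = 0 := fun k hk => by
    cases hk with
    | refl => rfl
    | head hab hbc => exact (hab.verts_ne hnd hbc subset_rfl).elim
  rcases h𝒯₀.comparable ht ht' hnd subset_rfl subset_rfl with ⟨k, hk, hd⟩ | ⟨k, hk, hd⟩ <;>
    have := hself k hd <;> omega

/-- The generations of a common edge of two incomparable triangles agree up to parity. -/
theorem edge_generation_div_two {n n' g g' : ℕ} {t t' : MarkedTriangle}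
    (ht : HasGeneration 𝒯₀ n t) (ht' : HasGeneration 𝒯₀ n' t')
    (hinc : ∀ k, DescendsIn k t t' ∨ DescendsIn k t' t → t = t') {e : Sym2 (Space 2)}
    (hg : IsEdgeGeneration n t e g) (hg' : IsEdgeGeneration n' t' e g') : g / 2 = g' / 2 := by
  induction e using Sym2.inductionOn with
  | hf v w =>
  have hnd := h𝒯₀.nondegenerate_of_hasGeneration ht
  by_cases htt : t = t'
  · subst htt
    have hn := h𝒯₀.generation_unique ht ht'
    subst hn
    suffices g = g' by rw [this]
    obtain ⟨h1, h2, h3⟩ := hnd.ne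
    rcases hg with ⟨he, rfl⟩ | ⟨he, rfl⟩ <;> rcases hg' with ⟨he', rfl⟩ | ⟨he', rfl⟩
    · rfl
    · rw [he] at he'
      simp only [MarkedTriangle.base, Sym2.eq_iff] at he'
      exfalso; rcases he' with (h | h) | (h | h) <;> simp_all
    · rw [he'] at he
      simp only [MarkedTriangle.base, Sym2.eq_iff] at he
      exfalso; rcases he with (h | h) | (h | h) <;> simp_all
    · rfl
  rcases h𝒯₀.comparable_or_separated ht ht' with ⟨k, -, hd⟩ | ⟨k, -, hd⟩ |
    ⟨q, q', c, o, m, m', hq, hq', hsep, hd, hd', hm, hm', ho⟩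
  · exact absurd (hinc k (Or.inl hd)) htt
  · exact absurd (hinc k (Or.inr hd)) htt
  have hind := affineIndependent_subset hq.indep hsep.subset
  obtain ⟨η, hη⟩ := exists_unit_coordinate hsep.card hind
  obtain ⟨ζ, i, hi, hi1, hE, hnn, hne, hζc, -⟩ := exists_edgeInvariant hq hsep.subset hsep.card hη
  obtain ⟨ζ', i', hi', hi1', hE', hnn', hne', hζc', -⟩ :=
    exists_edgeInvariant hq' hsep.subset' hsep.card hη
  obtain ⟨hEt, -⟩ := hE.descendsIn hq hnn hne hd
  obtain ⟨hEt', -⟩ := hE'.descendsIn hq' hnn' hne' hd'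
  have hc : v ∈ hull c ∧ w ∈ hull c := by
    have h1 := hg.mem_verts
    have h2 := hg'.mem_verts
    exact ⟨hsep.inter ⟨hd.hull_subset (mem_hull h1.1), hd'.hull_subset (mem_hull h2.1)⟩,
      hsep.inter ⟨hd.hull_subset (mem_hull h1.2), hd'.hull_subset (mem_hull h2.2)⟩⟩
  have hgm : ∃ f, IsEdgeGeneration m t s(v, w) f ∧ g = f + o := by
    rcases hg with ⟨he, rfl⟩ | ⟨he, rfl⟩
    · exact ⟨m, Or.inl ⟨he, rfl⟩, hm⟩
    · exact ⟨m + 1, Or.inr ⟨he, rfl⟩, by omega⟩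
  have hgm' : ∃ f, IsEdgeGeneration m' t' s(v, w) f ∧ g' = f + o := by
    rcases hg' with ⟨he, rfl⟩ | ⟨he, rfl⟩
    · exact ⟨m', Or.inl ⟨he, rfl⟩, hm'⟩
    · exact ⟨m' + 1, Or.inr ⟨he, rfl⟩, by omega⟩
  obtain ⟨f, hf, hgf⟩ := hgm
  obtain ⟨f', hf', hgf'⟩ := hgm'
  obtain ⟨j, k, hj, hjk⟩ := hEt.generation hf (hζc v hc.1) (hζc w hc.2)
  obtain ⟨j', k', hj', hjk'⟩ := hEt'.generation hf' (hζc' v hc.1) (hζc' w hc.2)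
  have hjj := hjk.level_eq hjk'
  -- The dyadic levels agree, so only the offsets can differ. For unrelated markings they are 0 or
  -- 1, which division by two ignores; for siblings both are 1.
  rcases ho with rfl | ⟨h1, h2⟩
  · omega
  · have := hi1 h1
    have := hi1' h2
    omega

end IsForest

/-! ### The pieces into which a refinement cuts a triangle -/

namespace MarkedTriangle

theorem affineIndependent_pair {x y : Space 2} (hxy : x ≠ y) [DecidableEq (Space 2)] :
    AffineIndependent ℝ ((↑) : ({x, y} : Finset (Space 2)) → Space 2) := by
  have h := (affineIndependent_of_ne ℝ hxy).range
  refine AffineIndependent.mono (s := ((({x, y} : Finset (Space 2))) : Set (Space 2))) h ?_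
  intro v hv
  simp only [Finset.coe_insert, Finset.coe_singleton, mem_insert_iff, mem_singleton_iff] at hv
  rcases hv with rfl | rfl
  · exact ⟨0, rfl⟩
  · exact ⟨1, rfl⟩

theorem Nondegenerate.midpoint_notMem {t : MarkedTriangle} (ht : t.Nondegenerate) {x y : Space 2}
    (hx : x ∈ t.verts) (hy : y ∈ t.verts) (hxy : x ≠ y) : midpoint ℝ x y ∉ t.verts := by
  classical
  intro hm
  have hmem : midpoint ℝ x y ∈ hull ({x, y} : Finset (Space 2)) :=
    (convex_convexHull ℝ _).midpoint_mem (mem_hull (by simp)) (mem_hull (by simp))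
  have := mem_of_mem_hull_subset ht.indep (t := {x, y}) (by
    intro v hv
    simp only [Finset.mem_insert, Finset.mem_singleton] at hv
    rcases hv with rfl | rfl <;> assumption) hm hmem
  simp only [Finset.mem_insert, Finset.mem_singleton] at this
  rcases this with h | h
  · exact hxy ((midpoint_eq_left_iff ℝ).1 h)
  · exact hxy ((midpoint_eq_right_iff ℝ).1 h)

theorem mem_edges {t : MarkedTriangle} {e : Sym2 (Space 2)} :
    e ∈ t.edges ↔ e = t.base ∨ e = s(t.apex, t.left) ∨ e = s(t.apex, t.right) := by
  simp [edges]

theorem mk_mem_edges {t : MarkedTriangle} {x y : Space 2} (hx : x ∈ t.verts) (hy : y ∈ t.verts)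
    (hxy : x ≠ y) : s(x, y) ∈ t.edges := by
  rw [mem_verts] at hx hy
  rw [mem_edges, base]
  rcases hx with rfl | rfl | rfl <;> rcases hy with rfl | rfl | rfl <;>
    first | exact absurd rfl hxy | simp

theorem mem_verts_of_mk_mem_edges {t : MarkedTriangle} {x y : Space 2} (h : s(x, y) ∈ t.edges) :
    x ∈ t.verts ∧ y ∈ t.verts := by
  rw [mem_edges, base] at h
  simp only [Sym2.eq_iff] at h
  simp only [mem_verts]
  rcases h with (⟨rfl, rfl⟩ | ⟨rfl, rfl⟩) | (⟨rfl, rfl⟩ | ⟨rfl, rfl⟩) | ⟨rfl, rfl⟩ | ⟨rfl, rfl⟩ <;>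
    simp

theorem base_swap (t : MarkedTriangle) : t.swap.base = t.base := Sym2.eq_swap

/-- The parts of a subdivided triangle in its left child. -/
def leftPieces (M : Set (Sym2 (Space 2))) (t : MarkedTriangle) : Set MarkedTriangle :=
  {q | (s(t.apex, t.left) ∉ M ∧ q = t.leftChild) ∨
    (s(t.apex, t.left) ∈ M ∧ IsChild t.leftChild q)}

/-- The pieces of a bisected triangle are the left pieces of the triangle and of its mirror image,
so only one side needs study. -/
theorem mem_subdivide {M : Set (Sym2 (Space 2))} {t q : MarkedTriangle} :
    q ∈ t.subdivide M ↔ (t.base ∉ M ∧ q = t) ∨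
      (t.base ∈ M ∧ (q ∈ t.leftPieces M ∨ q ∈ t.swap.leftPieces M)) := by
  classical
  have h1 : t.leftChild.base = s(t.apex, t.left) := rfl
  have h2 : t.rightChild.base = s(t.apex, t.right) := rfl
  have h3 : t.swap.apex = t.apex := rfl
  have h4 : t.swap.left = t.right := rfl
  simp only [leftPieces, leftChild_swap, h3, h4, mem_ofPred_eq, IsChild]
  unfold subdivide
  rw [h1, h2]
  by_cases hb : t.base ∈ M
  · simp only [hb, if_true, Finset.mem_union, not_true_eq_false, false_and, true_and, false_or]
    refine or_congr ?_ ?_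
    · by_cases h : s(t.apex, t.left) ∈ M <;> simp [h]
    · by_cases h : s(t.apex, t.right) ∈ M <;> simp [h]
  · simp [hb]

theorem leftPieces_descendsIn {M : Set (Sym2 (Space 2))} {t q : MarkedTriangle}
    (hq : q ∈ t.leftPieces M) : ∃ k, DescendsIn k t.leftChild q := by
  rcases hq with ⟨-, rfl⟩ | ⟨-, h⟩
  · exact ⟨0, DescendsIn.refl _⟩
  · exact ⟨1, h.descendsIn⟩

theorem mem_verts_of_mem_leftPieces {M : Set (Sym2 (Space 2))} {t q : MarkedTriangle}
    (hq : q ∈ t.leftPieces M) {v : Space 2} (hv : v ∈ q.verts) :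
    v = midpoint ℝ t.left t.right ∨ v = t.apex ∨ v = t.left ∨
      (s(t.apex, t.left) ∈ M ∧ v = midpoint ℝ t.apex t.left) := by
  rw [mem_verts] at hv
  rcases hq with ⟨-, rfl⟩ | ⟨hM, rfl | rfl⟩ <;> simp only [leftChild, rightChild] at hv <;> tauto

theorem not_both_mem_leftPieces {M : Set (Sym2 (Space 2))} {t q : MarkedTriangle}
    (ht : t.Nondegenerate) (hq : q ∈ t.leftPieces M) (hM : s(t.apex, t.left) ∈ M) :
    ¬ (t.apex ∈ q.verts ∧ t.left ∈ q.verts) := by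
  rintro ⟨ha, hl⟩
  obtain ⟨h1, h2, h3⟩ := ht.ne
  have hm := ht.midpoint_notMem t.left_mem t.right_mem h3
  have hk := ht.midpoint_notMem t.apex_mem t.left_mem h1
  have ha1 : t.apex ≠ midpoint ℝ t.left t.right := fun h => hm (h ▸ t.apex_mem)
  have hl1 : t.left ≠ midpoint ℝ t.left t.right := fun h => hm (by rw [← h]; exact t.left_mem)
  have ha2 : t.apex ≠ midpoint ℝ t.apex t.left := fun h => hk (by rw [← h]; exact t.apex_mem)
  have hl2 : t.left ≠ midpoint ℝ t.apex t.left := fun h => hk (by rw [← h]; exact t.left_mem)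
  rw [mem_verts] at ha hl
  rcases hq with ⟨h, -⟩ | ⟨-, rfl | rfl⟩
  · exact h hM
  · simp only [leftChild] at ha hl
    rcases hl with h | h | h
    exacts [hl2 h, hl1 h, h1 h.symm]
  · simp only [leftChild, rightChild] at ha hl
    rcases ha with h | h | h
    exacts [ha2 h, ha1 h, h1 h]

theorem right_notMem_leftPieces {M : Set (Sym2 (Space 2))} {t q : MarkedTriangle}
    (ht : t.Nondegenerate) (hq : q ∈ t.leftPieces M) : t.right ∉ q.verts := by
  intro hr
  obtain ⟨h1, h2, h3⟩ := ht.ne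
  rcases mem_verts_of_mem_leftPieces hq hr with h | h | h | ⟨-, h⟩
  · exact ht.midpoint_notMem t.left_mem t.right_mem h3 (by rw [← h]; exact t.right_mem)
  · exact h2 h.symm
  · exact h3 h.symm
  · exact ht.midpoint_notMem t.apex_mem t.left_mem h1 (by rw [← h]; exact t.right_mem)

theorem leftPieces_mem_verts {M : Set (Sym2 (Space 2))} {t q : MarkedTriangle}
    (hb : t.base ∈ M) (hq : q ∈ t.leftPieces M) {v : Space 2} (hv : v ∈ q.verts) :
    v ∈ t.verts ∨ ∃ x y, s(x, y) ∈ t.edges ∧ s(x, y) ∈ M ∧ v = midpoint ℝ x y := by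
  rcases mem_verts_of_mem_leftPieces hq hv with rfl | rfl | rfl | ⟨hM, rfl⟩
  · exact Or.inr ⟨_, _, mem_edges.2 (Or.inl rfl), hb, rfl⟩
  · exact Or.inl t.apex_mem
  · exact Or.inl t.left_mem
  · exact Or.inr ⟨_, _, mem_edges.2 (Or.inr (Or.inl rfl)), hM, rfl⟩

theorem edges_swap (t : MarkedTriangle) : t.swap.edges = t.edges := by
  ext e
  simp only [mem_edges, base_swap]
  simp only [swap]
  tauto

/-- The vertices of a subdivision are old vertices and midpoints of bisected edges. -/
theorem subdivide_mem_verts {M : Set (Sym2 (Space 2))} {t q : MarkedTriangle}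
    (hq : q ∈ t.subdivide M) {v : Space 2} (hv : v ∈ q.verts) :
    v ∈ t.verts ∨ ∃ x y, s(x, y) ∈ t.edges ∧ s(x, y) ∈ M ∧ v = midpoint ℝ x y := by
  rcases mem_subdivide.1 hq with ⟨-, rfl⟩ | ⟨hb, h | h⟩
  · exact Or.inl hv
  · exact leftPieces_mem_verts hb h hv
  · have := leftPieces_mem_verts (by rwa [base_swap]) h hv
    rwa [verts_swap, edges_swap] at this

/-- No part of a subdivision contains both endpoints of a bisected edge. -/
theorem subdivide_not_both {M : Set (Sym2 (Space 2))} {t q : MarkedTriangle} (ht : t.Nondegenerate)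
    (hM : ∀ e ∈ t.edges, e ∈ M → t.base ∈ M) (hq : q ∈ t.subdivide M) {x y : Space 2}
    (he : s(x, y) ∈ t.edges) (hxy : s(x, y) ∈ M) : ¬ (x ∈ q.verts ∧ y ∈ q.verts) := by
  have key : ∀ (t : MarkedTriangle), t.Nondegenerate → q ∈ t.leftPieces M → s(x, y) ∈ t.edges →
      ¬ (x ∈ q.verts ∧ y ∈ q.verts) := by
    rintro t ht h he ⟨hx, hy⟩
    have hr := right_notMem_leftPieces ht h
    rw [mem_edges, base] at he
    simp only [Sym2.eq_iff] at he
    rcases he with (⟨rfl, rfl⟩ | ⟨rfl, rfl⟩) | (⟨rfl, rfl⟩ | ⟨rfl, rfl⟩) | ⟨rfl, rfl⟩ | ⟨rfl, rfl⟩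
    · exact hr hy
    · exact hr hx
    · exact not_both_mem_leftPieces ht h hxy ⟨hx, hy⟩
    · exact not_both_mem_leftPieces ht h (by rwa [Sym2.eq_swap]) ⟨hy, hx⟩
    · exact hr hy
    · exact hr hx
  rcases mem_subdivide.1 hq with ⟨hb, rfl⟩ | ⟨hb, h | h⟩
  · exact absurd (hM _ he hxy) hb
  · exact key t ht h he
  · exact key t.swap ht.swap h (by rwa [edges_swap])

/-- A first bisection requires `n / 2 ≤ N`, a second one `(n + 1) / 2 ≤ N`, with integer division.
In both cases the generation reached is at most `2 * N + 2`. -/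
theorem subdivide_descendsIn {M : Set (Sym2 (Space 2))} {t q : MarkedTriangle}
    (hq : q ∈ t.subdivide M) {n N : ℕ} (hn : n ≤ 2 * N + 2)
    (hM : ∀ e ∈ M, ∀ g, IsEdgeGeneration n t e g → g / 2 ≤ N) :
    ∃ k, DescendsIn k t q ∧ n + k ≤ 2 * N + 2 := by
  rcases mem_subdivide.1 hq with ⟨-, rfl⟩ | ⟨hb, h⟩
  · exact ⟨0, DescendsIn.refl q, by omega⟩
  have h1 := hM _ hb n (Or.inl ⟨rfl, rfl⟩)
  rcases h with (⟨-, rfl⟩ | ⟨he, h⟩) | (⟨-, rfl⟩ | ⟨he, h⟩)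
  · exact ⟨1, IsChild.descendsIn (Or.inl rfl), by omega⟩
  · have h2 := hM _ he (n + 1) (Or.inr ⟨Or.inl rfl, rfl⟩)
    exact ⟨2, h.descendsIn.head (Or.inl rfl), by omega⟩
  · exact ⟨1, IsChild.descendsIn (Or.inr (leftChild_swap t)), by omega⟩
  · have h2 := hM _ he (n + 1) (Or.inr ⟨Or.inr rfl, rfl⟩)
    rw [leftChild_swap] at h
    exact ⟨2, h.descendsIn.head (Or.inr rfl), by omega⟩

theorem subdivide_exists_descendsIn {M : Set (Sym2 (Space 2))} {t q : MarkedTriangle}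
    (hq : q ∈ t.subdivide M) : ∃ k, DescendsIn k t q := by
  rcases mem_subdivide.1 hq with ⟨-, rfl⟩ | ⟨hb, h | h⟩
  · exact ⟨0, DescendsIn.refl q⟩
  · obtain ⟨k, hk⟩ := leftPieces_descendsIn h
    exact ⟨k + 1, hk.head (Or.inl rfl)⟩
  · obtain ⟨k, hk⟩ := leftPieces_descendsIn h
    exact ⟨k + 1, hk.head (Or.inr (leftChild_swap t))⟩

theorem mem_hull_verts {t : MarkedTriangle} {x : Space 2} :
    x ∈ hull t.verts ↔ ∃ α β γ : ℝ, 0 ≤ α ∧ 0 ≤ β ∧ 0 ≤ γ ∧ α + β + γ = 1 ∧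
      α • t.apex + β • t.left + γ • t.right = x := by
  classical
  have : (t.verts : Set (Space 2)) = {t.apex, t.left, t.right} := by simp [verts]
  rw [hull, this, convexHull_insert (by simp), convexHull_pair]
  simp only [convexJoin_singleton_left, mem_iUnion, exists_prop]
  constructor
  · rintro ⟨y, ⟨b, c, hb, hc, hbc, rfl⟩, ⟨u, v, hu, hv, huv, rfl⟩⟩
    refine ⟨u, v * b, v * c, hu, by positivity, by positivity, ?_, ?_⟩
    · rw [add_assoc, ← mul_add, hbc, mul_one, huv]
    · simp only [smul_add, smul_smul, add_assoc]
  · rintro ⟨α, β, γ, hα, hβ, hγ, hsum, rfl⟩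
    by_cases h0 : β + γ = 0
    · have hβ0 : β = 0 := by linarith
      have hγ0 : γ = 0 := by linarith
      subst hβ0 hγ0
      refine ⟨t.left, left_mem_segment ℝ _ _, ?_⟩
      have : α = 1 := by linarith
      subst this
      simpa using left_mem_segment ℝ t.apex t.left
    · have hpos : 0 < β + γ := lt_of_le_of_ne (by positivity) (Ne.symm h0)
      refine ⟨(β / (β + γ)) • t.left + (γ / (β + γ)) • t.right, ⟨_, _, by positivity, by positivity,
        by field_simp, rfl⟩, ⟨α, β + γ, hα, hpos.le, by linarith, ?_⟩⟩
      rw [smul_add, smul_smul, smul_smul, mul_div_cancel₀ _ h0, mul_div_cancel₀ _ h0, add_assoc]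

/-- The smaller of the two base weights, joined with an equal part of the larger one, becomes weight
at the midpoint. -/
theorem exists_child_mem_hull {t : MarkedTriangle} {x : Space 2} (hx : x ∈ hull t.verts) :
    x ∈ hull t.leftChild.verts ∨ x ∈ hull t.rightChild.verts := by
  obtain ⟨α, β, γ, hα, hβ, hγ, hsum, rfl⟩ := mem_hull_verts.1 hx
  rcases le_total γ β with h | h
  · left
    refine mem_hull_verts.2 ⟨2 * γ, α, β - γ, by positivity, hα, by linarith, by linarith, ?_⟩
    simp only [leftChild, midpoint_eq_smul_add, invOf_eq_inv]
    module
  · right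
    refine mem_hull_verts.2 ⟨2 * β, α, γ - β, by positivity, hα, by linarith, by linarith, ?_⟩
    simp only [rightChild, midpoint_eq_smul_add, invOf_eq_inv]
    module

theorem subdivide_cover {M : Set (Sym2 (Space 2))} {t : MarkedTriangle} {x : Space 2}
    (hx : x ∈ hull t.verts) : ∃ q ∈ t.subdivide M, x ∈ hull q.verts := by
  by_cases hb : t.base ∈ M
  · have key : ∀ t : MarkedTriangle, x ∈ hull t.leftChild.verts →
        ∃ q ∈ t.leftPieces M, x ∈ hull q.verts := by
      intro t hx
      by_cases hM : s(t.apex, t.left) ∈ M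
      · rcases exists_child_mem_hull hx with h | h
        · exact ⟨_, Or.inr ⟨hM, Or.inl rfl⟩, h⟩
        · exact ⟨_, Or.inr ⟨hM, Or.inr rfl⟩, h⟩
      · exact ⟨_, Or.inl ⟨hM, rfl⟩, hx⟩
    rcases exists_child_mem_hull hx with h | h
    · obtain ⟨q, hq, hxq⟩ := key t h
      exact ⟨q, mem_subdivide.2 (Or.inr ⟨hb, Or.inl hq⟩), hxq⟩
    · rw [← leftChild_swap] at h
      obtain ⟨q, hq, hxq⟩ := key t.swap h
      exact ⟨q, mem_subdivide.2 (Or.inr ⟨hb, Or.inr hq⟩), hxq⟩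
  · exact ⟨t, mem_subdivide.2 (Or.inl ⟨hb, rfl⟩), hx⟩

/-- The pieces in the two children of a triangle meet in common faces. -/
theorem leftPieces_inter_swap {M : Set (Sym2 (Space 2))} {t q q' : MarkedTriangle}
    (ht : t.Nondegenerate) (hq : q ∈ t.leftPieces M) (hq' : q' ∈ t.swap.leftPieces M) :
    hull q.verts ∩ hull q'.verts ⊆ convexHull ℝ ((q.verts : Set (Space 2)) ∩ q'.verts) := by
  classical
  obtain ⟨h1, h2, h3⟩ := ht.ne
  obtain ⟨A, hA⟩ := exists_affine_interpolant ht.indep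
    (fun v => if v = t.left then 1 else if v = t.right then -1 else 0)
  have hAa : A t.apex = 0 := by rw [hA _ t.apex_mem, if_neg h1, if_neg h2]
  have hAl : A t.left = 1 := by rw [hA _ t.left_mem, if_pos rfl]
  have hAr : A t.right = -1 := by rw [hA _ t.right_mem, if_neg h3.symm, if_pos rfl]
  have hAm : A (midpoint ℝ t.left t.right) = 0 := by rw [affine_midpoint, hAl, hAr]; norm_num
  have hAm' : A (midpoint ℝ t.right t.left) = 0 := by rw [midpoint_comm, hAm]
  have hAk : A (midpoint ℝ t.apex t.left) = 1 / 2 := by rw [affine_midpoint, hAa, hAl]; norm_num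
  have hAk' : A (midpoint ℝ t.apex t.right) = -1 / 2 := by
    rw [affine_midpoint, hAa, hAr]; norm_num
  have hv : ∀ v ∈ q.verts, 0 ≤ A v ∧
      (A v = 0 → v ∈ ({midpoint ℝ t.left t.right, t.apex} : Finset (Space 2))) := by
    intro v hv
    rcases mem_verts_of_mem_leftPieces hq hv with rfl | rfl | rfl | ⟨-, rfl⟩
    · exact ⟨hAm.ge, fun _ => by simp⟩
    · exact ⟨hAa.ge, fun _ => by simp⟩
    · rw [hAl]; norm_num
    · rw [hAk]; norm_num
  have hv' : ∀ v ∈ q'.verts, 0 ≤ (-A) v ∧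
      ((-A) v = 0 → v ∈ ({midpoint ℝ t.left t.right, t.apex} : Finset (Space 2))) := by
    intro v hv
    rw [AffineMap.coe_neg, Pi.neg_apply]
    rcases mem_verts_of_mem_leftPieces hq' hv with rfl | rfl | rfl | ⟨-, rfl⟩ <;>
      simp only [swap]
    · rw [hAm']; exact ⟨by norm_num, fun _ => by rw [midpoint_comm]; simp⟩
    · rw [hAa]; exact ⟨by norm_num, fun _ => by simp⟩
    · rw [hAr]; norm_num
    · rw [hAk']; norm_num
  -- At a common point `A` vanishes, so the point lies on the median. No piece has a vertex there
  -- other than the two ends.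
  rintro P ⟨hP, hP'⟩
  have hA0 := affine_nonneg_on_hull A (fun v h => (hv v h).1) hP
  have hA0' := affine_nonneg_on_hull (-A) (fun v h => (hv' v h).1) hP'
  have hAP : A P = 0 := by rw [AffineMap.coe_neg, Pi.neg_apply] at hA0'; linarith
  have hZ := mem_hull_filter_zero hP A (fun v h => (hv v h).1) hAP
  have hZ' := mem_hull_filter_zero hP' (-A) (fun v h => (hv' v h).1) (by
    rw [AffineMap.coe_neg, Pi.neg_apply, hAP, neg_zero])
  have hne : midpoint ℝ t.left t.right ≠ t.apex := fun h =>
    ht.midpoint_notMem t.left_mem t.right_mem h3 (by rw [h]; exact t.apex_mem)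
  have hin := (hull_inter_hull_of_subset (affineIndependent_pair hne)
    (fun v h => (hv v (Finset.mem_filter.1 h).1).2 (Finset.mem_filter.1 h).2)
    (fun v h => (hv' v (Finset.mem_filter.1 h).1).2 (Finset.mem_filter.1 h).2)).le ⟨hZ, hZ'⟩
  refine convexHull_mono ?_ hin
  intro v hv
  rw [Finset.mem_coe, Finset.mem_inter] at hv
  exact ⟨(Finset.mem_filter.1 hv.1).1, (Finset.mem_filter.1 hv.2).1⟩

theorem leftPieces_inter {M : Set (Sym2 (Space 2))} {t q q' : MarkedTriangle}
    (ht : t.Nondegenerate) (hq : q ∈ t.leftPieces M) (hq' : q' ∈ t.leftPieces M) :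
    hull q.verts ∩ hull q'.verts ⊆ convexHull ℝ ((q.verts : Set (Space 2)) ∩ q'.verts) := by
  by_cases hqq : q = q'
  · subst hqq; rw [Set.inter_self, Set.inter_self]
  have key : ∀ {a b : MarkedTriangle} {c : Finset (Space 2)}, Separated a b c →
      hull a.verts ∩ hull b.verts ⊆ convexHull ℝ ((a.verts : Set (Space 2)) ∩ b.verts) :=
    fun h => h.inter.trans (convexHull_mono fun v hv => ⟨h.subset hv, h.subset' hv⟩)
  have hsep := separated_children ht.leftChild
  rcases hq with ⟨hM, rfl⟩ | ⟨hM, rfl | rfl⟩ <;> rcases hq' with ⟨hM', rfl⟩ | ⟨hM', rfl | rfl⟩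
  · exact absurd rfl hqq
  · exact absurd hM' hM
  · exact absurd hM' hM
  · exact absurd hM hM'
  · exact absurd rfl hqq
  · exact key hsep
  · exact absurd hM hM'
  · exact key hsep.symm
  · exact absurd rfl hqq

theorem subdivide_inter_self {M : Set (Sym2 (Space 2))} {t q q' : MarkedTriangle}
    (ht : t.Nondegenerate) (hq : q ∈ t.subdivide M) (hq' : q' ∈ t.subdivide M) :
    hull q.verts ∩ hull q'.verts ⊆ convexHull ℝ ((q.verts : Set (Space 2)) ∩ q'.verts) := by
  rcases mem_subdivide.1 hq with ⟨hb, rfl⟩ | ⟨hb, h⟩ <;>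
    rcases mem_subdivide.1 hq' with ⟨hb', rfl⟩ | ⟨hb', h'⟩
  · rw [Set.inter_self, Set.inter_self]
  · exact absurd hb' hb
  · exact absurd hb hb'
  · rcases h with h | h <;> rcases h' with h' | h'
    · exact leftPieces_inter ht h h'
    · exact leftPieces_inter_swap ht h h'
    · rw [inter_comm (hull q.verts), inter_comm (q.verts : Set (Space 2))]
      exact leftPieces_inter_swap ht h' h
    · exact leftPieces_inter ht.swap h h'

/-- The parts of two subdivided neighbors meet in common faces. -/
theorem Separated.subdivide_inter {M : Set (Sym2 (Space 2))} {t t' q q' : MarkedTriangle}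
    {c : Finset (Space 2)} (hsep : Separated t t' c) (ht : t.Nondegenerate)
    (ht' : t'.Nondegenerate) (hM : ∀ e ∈ t.edges, e ∈ M → t.base ∈ M)
    (hM' : ∀ e ∈ t'.edges, e ∈ M → t'.base ∈ M) (hq : q ∈ t.subdivide M)
    (hq' : q' ∈ t'.subdivide M) :
    hull q.verts ∩ hull q'.verts ⊆ convexHull ℝ ((q.verts : Set (Space 2)) ∩ q'.verts) := by
  classical
  have hind := affineIndependent_subset ht.indep hsep.subset
  obtain ⟨η, hη⟩ := exists_unit_coordinate hsep.card hind
  -- the vertices of the pieces on the common face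
  have face : ∀ {t q : MarkedTriangle}, t.Nondegenerate → c ⊆ t.verts → q ∈ t.subdivide M →
      (∀ e ∈ t.edges, e ∈ M → t.base ∈ M) → ∀ P ∈ hull q.verts, P ∈ hull c →
      ∃ Z ⊆ q.verts, P ∈ hull Z ∧ (∀ v ∈ Z, v ∈ c ∨ ∃ x ∈ c, ∃ y ∈ c, x ≠ y ∧ s(x, y) ∈ M ∧
        v = midpoint ℝ x y) ∧ ∀ x ∈ c, ∀ y ∈ c, x ≠ y → s(x, y) ∈ M → ¬ (x ∈ Z ∧ y ∈ Z) := by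
    intro t q ht hc hq hM P hP hPc
    obtain ⟨ζ, o, -, -, -, hnn, -, hζc, hζ⟩ := exists_edgeInvariant ht hc hsep.card hη
    have hζv : ∀ v ∈ t.verts, ζ v = 0 → v ∈ c := fun v hv h0 =>
      mem_of_mem_hull_subset ht.indep hc hv (hζ v (mem_hull hv) h0)
    obtain ⟨k, hk⟩ := subdivide_exists_descendsIn hq
    refine ⟨q.verts.filter fun v => ζ v = 0, Finset.filter_subset _ _,
      mem_hull_filter_zero hP ζ (fun v hv => affine_nonneg_on_hull ζ hnn
        (hk.hull_subset (mem_hull hv))) (hζc P hPc), ?_, ?_⟩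
    · intro v hv
      rw [Finset.mem_filter] at hv
      rcases subdivide_mem_verts hq hv.1 with h | ⟨x, y, he, hxy, rfl⟩
      · exact Or.inl (hζv v h hv.2)
      · right
        obtain ⟨hx, hy⟩ := mem_verts_of_mk_mem_edges he
        have h0 := hv.2
        rw [affine_midpoint] at h0
        have hx0 := hnn x hx
        have hy0 := hnn y hy
        refine ⟨x, hζv x hx (by linarith), y, hζv y hy (by linarith), ?_, hxy, rfl⟩
        rintro rfl
        obtain ⟨h1, h2, h3⟩ := ht.ne
        rw [mem_edges, base] at he
        simp only [Sym2.eq_iff] at he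
        rcases he with (⟨h, h'⟩ | ⟨h, h'⟩) | (⟨h, h'⟩ | ⟨h, h'⟩) | ⟨h, h'⟩ | ⟨h, h'⟩
        exacts [h3 (h.symm.trans h'), h3 (h'.symm.trans h), h1 (h.symm.trans h'),
          h1 (h'.symm.trans h), h2 (h.symm.trans h'), h2 (h'.symm.trans h)]
    · rintro x hx y hy hxy hxyM ⟨hxZ, hyZ⟩
      exact subdivide_not_both ht hM hq (mk_mem_edges (hc hx) (hc hy) hxy) hxyM
        ⟨(Finset.mem_filter.1 hxZ).1, (Finset.mem_filter.1 hyZ).1⟩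
  rintro P ⟨hP, hP'⟩
  obtain ⟨k, hk⟩ := subdivide_exists_descendsIn hq
  obtain ⟨k', hk'⟩ := subdivide_exists_descendsIn hq'
  have hPc : P ∈ hull c := hsep.inter ⟨hk.hull_subset hP, hk'.hull_subset hP'⟩
  obtain ⟨Z, hZq, hPZ, hZ, hZn⟩ := face ht hsep.subset hq hM P hP hPc
  obtain ⟨Z', hZq', hPZ', hZ', hZn'⟩ := face ht' hsep.subset' hq' hM' P hP' hPc
  suffices P ∈ hull (Z ∩ Z') by
    refine convexHull_mono ?_ this
    intro v hv
    rw [Finset.mem_coe, Finset.mem_inter] at hv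
    exact ⟨hZq hv.1, hZq' hv.2⟩
  -- If the common face is a bisected edge, no piece contains both of its ends, so each piece lies
  -- along one half: the two halves are the same, or they meet in the midpoint. Otherwise both
  -- pieces have only vertices of `c` on the common face.
  by_cases hedge : ∃ x ∈ c, ∃ y ∈ c, x ≠ y ∧ s(x, y) ∈ M
  · obtain ⟨x, hx, y, hy, hxy, hxyM⟩ := hedge
    have hcxy : c = {x, y} := by
      refine (Finset.eq_of_subset_of_card_le (fun v hv => ?_) ?_).symm
      · simp only [Finset.mem_insert, Finset.mem_singleton] at hv
        rcases hv with rfl | rfl <;> assumption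
      · rw [Finset.card_pair hxy]; exact hsep.card
    subst hcxy
    set k := midpoint ℝ x y with hk
    have hsub : ∀ Z : Finset (Space 2), (∀ v ∈ Z, v ∈ ({x, y} : Finset (Space 2)) ∨
        ∃ a ∈ ({x, y} : Finset (Space 2)), ∃ b ∈ ({x, y} : Finset (Space 2)), a ≠ b ∧ s(a, b) ∈ M ∧
        v = midpoint ℝ a b) → ∀ v ∈ Z, v = x ∨ v = y ∨ v = k := by
      intro Z hZ v hv
      rcases hZ v hv with h | ⟨a, ha, b, hb, hab, -, rfl⟩
      · simp only [Finset.mem_insert, Finset.mem_singleton] at h; tauto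
      · simp only [Finset.mem_insert, Finset.mem_singleton] at ha hb
        right; right
        rcases ha with rfl | rfl <;> rcases hb with rfl | rfl
        · exact absurd rfl hab
        · rfl
        · exact midpoint_comm _ _
        · exact absurd rfl hab
    have hside : ∀ Z : Finset (Space 2), (∀ v ∈ Z, v = x ∨ v = y ∨ v = k) → ¬ (x ∈ Z ∧ y ∈ Z) →
        Z ⊆ {x, k} ∨ Z ⊆ {y, k} := by
      intro Z hZ hn
      by_cases hxZ : x ∈ Z
      · left
        intro v hv
        rw [Finset.mem_insert, Finset.mem_singleton]
        rcases hZ v hv with rfl | rfl | rfl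
        · exact Or.inl rfl
        · exact absurd ⟨hxZ, hv⟩ hn
        · exact Or.inr rfl
      · right
        intro v hv
        rw [Finset.mem_insert, Finset.mem_singleton]
        rcases hZ v hv with rfl | rfl | rfl
        · exact absurd hv hxZ
        · exact Or.inl rfl
        · exact Or.inr rfl
    have hxk : x ≠ k := fun h => hxy ((midpoint_eq_left_iff ℝ).1 h.symm)
    have hyk : y ≠ k := fun h => hxy ((midpoint_eq_right_iff ℝ).1 h.symm)
    obtain ⟨lam, hlam⟩ := exists_affine_interpolant (affineIndependent_pair hxy)
      (fun v => if v = x then -1 else 1)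
    have hlx : lam x = -1 := by rw [hlam x (by simp), if_pos rfl]
    have hly : lam y = 1 := by rw [hlam y (by simp), if_neg hxy.symm]
    have hlk : lam k = 0 := by rw [hk, affine_midpoint, hlx, hly]; norm_num
    -- On opposite halves `lam` has opposite signs, which leaves only the midpoint.
    have mixed : ∀ Z Z' : Finset (Space 2), Z ⊆ {x, k} → Z' ⊆ {y, k} → P ∈ hull Z → P ∈ hull Z' →
        P ∈ hull (Z ∩ Z') := by
      intro Z Z' hZ hZ' hP hP'
      have hv : ∀ v ∈ Z, 0 ≤ (-lam) v ∧ ((-lam) v = 0 → v = k) := fun v hv => by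
        have := hZ hv
        rw [Finset.mem_insert, Finset.mem_singleton] at this
        rw [AffineMap.coe_neg, Pi.neg_apply]
        rcases this with rfl | rfl
        · rw [hlx]; norm_num
        · exact ⟨by rw [hlk]; norm_num, fun _ => rfl⟩
      have hv' : ∀ v ∈ Z', 0 ≤ lam v ∧ (lam v = 0 → v = k) := fun v hv => by
        have := hZ' hv
        rw [Finset.mem_insert, Finset.mem_singleton] at this
        rcases this with rfl | rfl
        · rw [hly]; norm_num
        · exact ⟨hlk.ge, fun _ => rfl⟩
      have h1 := affine_nonneg_on_hull _ (fun v h => (hv v h).1) hP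
      have h2 := affine_nonneg_on_hull _ (fun v h => (hv' v h).1) hP'
      rw [AffineMap.coe_neg, Pi.neg_apply] at h1
      have h3 := mem_hull_filter_zero hP _ (fun v h => (hv v h).1) (by
        rw [AffineMap.coe_neg, Pi.neg_apply]; linarith)
      have h4 := mem_hull_filter_zero hP' _ (fun v h => (hv' v h).1) (by linarith)
      have h5 : ∀ v ∈ Z.filter (fun v => (-lam) v = 0), v = k := fun v h =>
        (hv v (Finset.mem_filter.1 h).1).2 (Finset.mem_filter.1 h).2
      have h6 : ∀ v ∈ Z'.filter (fun v => lam v = 0), v = k := fun v h =>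
        (hv' v (Finset.mem_filter.1 h).1).2 (Finset.mem_filter.1 h).2
      obtain ⟨v, hvm⟩ := convexHull_nonempty_iff.1 ⟨P, h3⟩
      obtain ⟨v', hvm'⟩ := convexHull_nonempty_iff.1 ⟨P, h4⟩
      have hkZ : k ∈ Z := by
        have := h5 v hvm; rw [← this]; exact (Finset.mem_filter.1 hvm).1
      have hkZ' : k ∈ Z' := by
        have := h6 v' hvm'; rw [← this]; exact (Finset.mem_filter.1 hvm').1
      refine hull_mono (f := Z.filter (fun v => (-lam) v = 0)) ?_ h3
      intro v hv
      rw [h5 v hv]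
      exact Finset.mem_inter.2 ⟨hkZ, hkZ'⟩
    rcases hside Z (hsub Z hZ) (hZn x (by simp) y (by simp) hxy hxyM) with h | h <;>
      rcases hside Z' (hsub Z' hZ') (hZn' x (by simp) y (by simp) hxy hxyM) with h' | h'
    · exact (hull_inter_hull_of_subset (affineIndependent_pair hxk) h h').le ⟨hPZ, hPZ'⟩
    · exact mixed Z Z' h h' hPZ hPZ'
    · rw [Finset.inter_comm]; exact mixed Z' Z h' h hPZ' hPZ
    · exact (hull_inter_hull_of_subset (affineIndependent_pair hyk) h h').le ⟨hPZ, hPZ'⟩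
  · have hsub : ∀ Z : Finset (Space 2), (∀ v ∈ Z, v ∈ c ∨ ∃ x ∈ c, ∃ y ∈ c, x ≠ y ∧ s(x, y) ∈ M ∧
        v = midpoint ℝ x y) → Z ⊆ c := fun Z hZ v hv => by
      rcases hZ v hv with h | ⟨x, hx, y, hy, hxy, hM, -⟩
      · exact h
      · exact absurd ⟨x, hx, y, hy, hxy, hM⟩ hedge
    exact (hull_inter_hull_of_subset hind (hsub Z hZ) (hsub Z' hZ')).le ⟨hPZ, hPZ'⟩

end MarkedTriangle

/-! ### Number and size of the descendants of a triangle -/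

namespace MarkedTriangle

theorem DescendsIn.eq_of_zero {a b : MarkedTriangle} (h : DescendsIn 0 a b) : a = b := by
  cases h; rfl

theorem finite_descendsIn (n : ℕ) (r : MarkedTriangle) : {t | DescendsIn n r t}.Finite := by
  induction n generalizing r with
  | zero =>
    refine (finite_singleton r).subset fun t ht => ?_
    exact (DescendsIn.eq_of_zero ht).symm
  | succ n ih =>
    refine ((ih r.leftChild).union (ih r.rightChild)).subset fun t ht => ?_
    cases ht with
    | head hab hbc =>
      rcases hab with rfl | rfl
      · exact Or.inl hbc
      · exact Or.inr hbc

/-- The two edges at the apex have length at most `X`, the base has length at most `2 X`. -/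
structure EdgeBound (X : ℝ) (t : MarkedTriangle) : Prop where
  left : dist t.apex t.left ≤ X
  right : dist t.apex t.right ≤ X
  base : dist t.left t.right ≤ 2 * X

theorem EdgeBound.swap {X : ℝ} {t : MarkedTriangle} (h : EdgeBound X t) : EdgeBound X t.swap :=
  ⟨h.right, h.left, by rw [dist_comm]; exact h.base⟩

theorem dist_midpoint_midpoint_common (u v w : Space 2) :
    dist (midpoint ℝ u v) (midpoint ℝ u w) = dist v w / 2 := by
  rw [dist_eq_norm, dist_eq_norm, midpoint_eq_smul_add, midpoint_eq_smul_add, ← smul_sub,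
    add_sub_add_left_eq_sub, norm_smul]
  norm_num
  ring

/-- The factor 2 at the base makes the bound hereditary: the median is at most the mean of the apex
edges, and half the base is at most `X`. -/
theorem EdgeBound.leftChild {X : ℝ} {t : MarkedTriangle} (h : EdgeBound X t) :
    EdgeBound X t.leftChild := by
  have h1 := h.left
  have h2 := h.right
  have h3 := h.base
  have hX : 0 ≤ X := dist_nonneg.trans h1
  refine ⟨?_, ?_, ?_⟩
  · have := dist_midpoint_midpoint_le t.left t.right t.apex t.apex
    rw [midpoint_self] at this
    change dist (midpoint ℝ t.left t.right) t.apex ≤ X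
    rw [dist_comm t.left, dist_comm t.right] at this
    linarith
  · change dist (midpoint ℝ t.left t.right) t.left ≤ X
    rw [dist_midpoint_left]
    norm_num
    linarith
  · change dist t.apex t.left ≤ 2 * X
    linarith

theorem EdgeBound.child {X : ℝ} {t c : MarkedTriangle} (h : EdgeBound X t) (hc : IsChild t c) :
    EdgeBound X c := by
  rcases hc with rfl | rfl
  · exact h.leftChild
  · rw [← leftChild_swap]; exact h.swap.leftChild

/-- The apex of the grandchild is the midpoint of an apex edge. Its apex edges are half of that edge
and a midline, which is half of the other apex edge; its base is the median or half the old base. -/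
theorem EdgeBound.grandchild_of_left {X : ℝ} {t c : MarkedTriangle} (h : EdgeBound X t)
    (hc : IsChild t.leftChild c) : EdgeBound (X / 2) c := by
  have hm : dist (midpoint ℝ t.left t.right) t.apex ≤ X := h.leftChild.left
  have hl : dist (midpoint ℝ t.left t.right) t.left ≤ X := h.leftChild.right
  have hmid : dist (midpoint ℝ t.apex t.left) (midpoint ℝ t.left t.right) ≤ X / 2 := by
    rw [midpoint_comm t.apex, dist_midpoint_midpoint_common]
    linarith [h.right]
  rcases hc with rfl | rfl
  · refine ⟨hmid, ?_, ?_⟩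
    · change dist (midpoint ℝ t.apex t.left) t.apex ≤ X / 2
      rw [dist_midpoint_left]; norm_num; linarith [h.left]
    · change dist (midpoint ℝ t.left t.right) t.apex ≤ 2 * (X / 2)
      linarith
  · refine ⟨hmid, ?_, ?_⟩
    · change dist (midpoint ℝ t.apex t.left) t.left ≤ X / 2
      rw [dist_midpoint_right]; norm_num; linarith [h.left]
    · change dist (midpoint ℝ t.left t.right) t.left ≤ 2 * (X / 2)
      linarith

theorem EdgeBound.grandchild {X : ℝ} {t b c : MarkedTriangle} (h : EdgeBound X t)
    (hb : IsChild t b) (hc : IsChild b c) : EdgeBound (X / 2) c := by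
  rcases hb with rfl | rfl
  · exact h.grandchild_of_left hc
  · rw [← leftChild_swap] at hc
    exact h.swap.grandchild_of_left hc

theorem EdgeBound.descendsIn (k : ℕ) {X : ℝ} {n : ℕ} {t c : MarkedTriangle} (h : EdgeBound X t)
    (hn : 2 * k ≤ n) (hc : DescendsIn n t c) : EdgeBound (X / 2 ^ k) c := by
  -- Bisections in excess of `2 * k` do not spoil the bound.
  have weak : ∀ {n : ℕ} {t c : MarkedTriangle} {X : ℝ}, EdgeBound X t → DescendsIn n t c →
      EdgeBound X c := by
    intro n t c X h hc
    induction hc with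
    | refl => exact h
    | head hab _ ih => exact ih (h.child hab)
  induction k generalizing X n t with
  | zero => simpa using weak h hc
  | succ k ih =>
    cases hc with
    | refl => omega
    | head hab hbc =>
      cases hbc with
      | refl => omega
      | head hbd hdc =>
        have := ih (h.grandchild hab hbd) (by omega) hdc
        rwa [div_div, ← pow_succ'] at this

theorem EdgeBound.dist_le {X : ℝ} {t : MarkedTriangle} (h : EdgeBound X t) {u v : Space 2}
    (hu : u ∈ t.verts) (hv : v ∈ t.verts) : dist u v ≤ 2 * X := by
  have h1 := h.left
  have h2 := h.right
  have h3 := h.base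
  have hX : 0 ≤ X := dist_nonneg.trans h1
  rcases mem_verts.1 hu with rfl | rfl | rfl <;> rcases mem_verts.1 hv with rfl | rfl | rfl <;>
    first
    | (rw [dist_self]; linarith)
    | linarith
    | (rw [dist_comm]; linarith)

theorem exists_edgeBound (t : MarkedTriangle) : ∃ X > 0, EdgeBound X t :=
  ⟨dist t.apex t.left + dist t.apex t.right + dist t.left t.right + 1, by positivity,
    by linarith [dist_nonneg (x := t.apex) (y := t.right), dist_nonneg (x := t.left) (y := t.right)],
    by linarith [dist_nonneg (x := t.apex) (y := t.left), dist_nonneg (x := t.left) (y := t.right)],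
    by linarith [dist_nonneg (x := t.apex) (y := t.left), dist_nonneg (x := t.apex) (y := t.right),
      dist_nonneg (x := t.left) (y := t.right)]⟩

end MarkedTriangle

/-! ### Conforming triangulations, their refinement and coarsening -/

/-- A conforming triangulation of `|K|` by descendants of the triangles in `𝒯₀`. -/
structure IsTriangulation (K : Geometry.SimplicialComplex ℝ (Space 2))
    (𝒯₀ 𝒯 : Finset MarkedTriangle) : Prop where
  generation : ∀ t ∈ 𝒯, ∃ n, HasGeneration 𝒯₀ n t
  conforming : IsConformingTriangulation 𝒯
  cover : ∀ x ∈ K.space, ∃ t ∈ 𝒯, x ∈ hull t.verts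

/-- All triangles of `𝒯` have generation at most `N`. -/
def GenerationLE (𝒯₀ : Finset MarkedTriangle) (N : ℕ) (𝒯 : Finset MarkedTriangle) : Prop :=
  ∀ t ∈ 𝒯, ∀ n, HasGeneration 𝒯₀ n t → n ≤ N

section Marking

variable {K : Geometry.SimplicialComplex ℝ (Space 2)} {𝒯₀ : Finset MarkedTriangle}

theorem IsMarking.isForest (h : IsMarking K 𝒯₀) : IsForest 𝒯₀ where
  nondegenerate r hr := nondegenerate_of_indep (K.indep (h.1 r hr).1) (h.1 r hr).2
  separated r hr r' hr' hne := by
    classical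
    refine ⟨r.verts ∩ r'.verts, Finset.inter_subset_left, Finset.inter_subset_right, ?_, ?_⟩
    · by_contra hcon
      have h1 : r.verts ∩ r'.verts = r.verts :=
        Finset.eq_of_subset_of_card_le Finset.inter_subset_left (by rw [(h.1 r hr).2]; omega)
      have h2 : r.verts ∩ r'.verts = r'.verts :=
        Finset.eq_of_subset_of_card_le Finset.inter_subset_right (by rw [(h.1 r' hr').2]; omega)
      exact hne ((h.2 r.verts (h.1 r hr).1 (h.1 r hr).2).unique ⟨hr, rfl⟩ ⟨hr', h2.symm.trans h1⟩)
    · rw [hull, hull, hull, Finset.coe_inter]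
      exact K.inter_subset_convexHull (h.1 r hr).1 (h.1 r' hr').1

theorem IsMarking.isTriangulation (h : IsMarking K 𝒯₀) (hK : IsSpaceMesh K) :
    IsTriangulation K 𝒯₀ 𝒯₀ where
  generation t ht := ⟨0, t, ht, DescendsIn.refl t⟩
  conforming t ht t' ht' := by
    refine Subset.antisymm (K.inter_subset_convexHull (h.1 t ht).1 (h.1 t' ht').1) ?_
    exact subset_inter (convexHull_mono inter_subset_left) (convexHull_mono inter_subset_right)
  cover x hx := by
    obtain ⟨σ, hσ, hxσ⟩ := hK.exists_topFace hx
    obtain ⟨t, ⟨ht, htσ⟩, -⟩ := h.2 σ hσ.1 hσ.2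
    exact ⟨t, ht, htσ ▸ hxσ⟩

theorem finite_hasGeneration (𝒯₀ : Finset MarkedTriangle) (N : ℕ) :
    {t | ∃ n ≤ N, HasGeneration 𝒯₀ n t}.Finite := by
  have : {t | ∃ n ≤ N, HasGeneration 𝒯₀ n t} ⊆
      ⋃ n ∈ Iic N, ⋃ r ∈ (𝒯₀ : Set MarkedTriangle), {t | DescendsIn n r t} := by
    rintro t ⟨n, hn, r, hr, hrt⟩
    simp only [mem_iUnion]
    exact ⟨n, hn, r, hr, hrt⟩
  exact ((finite_Iic N).biUnion fun n _ => 𝒯₀.finite_toSet.biUnion fun r _ =>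
    finite_descendsIn n r).subset this

end Marking

theorem mem_refineTriangulation {𝒯 : Finset MarkedTriangle} {R : Set MarkedTriangle}
    {q : MarkedTriangle} :
    q ∈ refineTriangulation 𝒯 R ↔ ∃ t ∈ 𝒯, q ∈ t.subdivide {e | BisectedEdge 𝒯 R e} := by
  classical
  exact Finset.mem_biUnion

namespace IsTriangulation

variable {K : Geometry.SimplicialComplex ℝ (Space 2)} {𝒯₀ 𝒯 : Finset MarkedTriangle}
  (hF : IsForest 𝒯₀) (hT : IsTriangulation K 𝒯₀ 𝒯)

include hF hT

theorem nondegenerate {t : MarkedTriangle} (ht : t ∈ 𝒯) : t.Nondegenerate := by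
  obtain ⟨n, hn⟩ := hT.generation t ht
  exact hF.nondegenerate_of_hasGeneration hn

/-- By conformity every vertex of `t'`, being extreme, is a vertex of `t`; but a proper descendant
never has the vertices of its ancestor. -/
theorem eq_of_descendsIn {t t' : MarkedTriangle} (ht : t ∈ 𝒯) (ht' : t' ∈ 𝒯) {k : ℕ}
    (h : DescendsIn k t t') : t = t' := by
  classical
  have hsub : t'.verts ⊆ t.verts := by
    intro v hv
    have h1 : v ∈ hull t.verts ∩ hull t'.verts := ⟨h.hull_subset (mem_hull hv), mem_hull hv⟩
    rw [hT.conforming t ht t' ht', ← Finset.coe_inter] at h1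
    exact Finset.inter_subset_left (mem_of_mem_hull_subset (hT.nondegenerate hF ht').indep
      Finset.inter_subset_right hv h1)
  have heq : t'.verts = t.verts := Finset.eq_of_subset_of_card_le hsub (by
    rw [(hT.nondegenerate hF ht).card, (hT.nondegenerate hF ht').card])
  cases h with
  | refl => rfl
  | head hab hbc => exact absurd heq.symm.subset (IsChild.verts_ne (hT.nondegenerate hF ht) hab hbc)

theorem eq_of_verts_eq {t t' : MarkedTriangle} (ht : t ∈ 𝒯) (ht' : t' ∈ 𝒯)
    (h : t.verts = t'.verts) : t = t' := by
  obtain ⟨n, hn⟩ := hT.generation t ht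
  obtain ⟨n', hn'⟩ := hT.generation t' ht'
  rcases hF.comparable hn hn' (hT.nondegenerate hF ht) subset_rfl (by rw [h]) with
    ⟨k, -, hk⟩ | ⟨k, -, hk⟩
  · exact hT.eq_of_descendsIn hF ht ht' hk
  · exact (hT.eq_of_descendsIn hF ht' ht hk).symm

open scoped Classical in
theorem separated {t t' : MarkedTriangle} (ht : t ∈ 𝒯) (ht' : t' ∈ 𝒯) (hne : t ≠ t') :
    Separated t t' (t.verts ∩ t'.verts) := by
  refine ⟨Finset.inter_subset_left, Finset.inter_subset_right, ?_, ?_⟩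
  · by_contra hcon
    have h1 : t.verts ∩ t'.verts = t.verts := Finset.eq_of_subset_of_card_le
      Finset.inter_subset_left (by rw [(hT.nondegenerate hF ht).card]; omega)
    have h2 : t.verts ∩ t'.verts = t'.verts := Finset.eq_of_subset_of_card_le
      Finset.inter_subset_right (by rw [(hT.nondegenerate hF ht').card]; omega)
    exact hne (hT.eq_of_verts_eq hF ht ht' (h1.symm.trans h2))
  · rw [hT.conforming t ht t' ht', hull, Finset.coe_inter]

theorem refine (R : Set MarkedTriangle) :
    IsTriangulation K 𝒯₀ (refineTriangulation 𝒯 R) where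
  generation q hq := by
    obtain ⟨t, ht, hqt⟩ := mem_refineTriangulation.1 hq
    obtain ⟨n, r, hr, hrt⟩ := hT.generation t ht
    obtain ⟨k, hk⟩ := subdivide_exists_descendsIn hqt
    exact ⟨n + k, r, hr, hrt.trans hk⟩
  conforming q hq q' hq' := by
    obtain ⟨t, ht, hqt⟩ := mem_refineTriangulation.1 hq
    obtain ⟨t', ht', hqt'⟩ := mem_refineTriangulation.1 hq'
    -- Propagation: a triangle with a bisected edge has its base bisected.
    have hM : ∀ t ∈ 𝒯, ∀ e ∈ t.edges, e ∈ {e | BisectedEdge 𝒯 R e} →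
        t.base ∈ {e | BisectedEdge 𝒯 R e} := fun t ht e he h => BisectedEdge.propagate ht he h
    refine Subset.antisymm ?_
      (subset_inter (convexHull_mono inter_subset_left) (convexHull_mono inter_subset_right))
    by_cases hne : t = t'
    · subst hne
      exact subdivide_inter_self (hT.nondegenerate hF ht) hqt hqt'
    · exact (hT.separated hF ht ht' hne).subdivide_inter (hT.nondegenerate hF ht)
        (hT.nondegenerate hF ht') (hM t ht) (hM t' ht') hqt hqt'
  cover x hx := by
    obtain ⟨t, ht, hxt⟩ := hT.cover x hx
    obtain ⟨q, hq, hxq⟩ := subdivide_cover (M := {e | BisectedEdge 𝒯 R e}) hxt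
    exact ⟨q, mem_refineTriangulation.2 ⟨t, ht, hq⟩, hxq⟩

/-- Propagation passes from an edge of a triangle to its base, whose generation is not larger, and
between neighbors half the generation of the common edge agrees. So this half never exceeds its
value at the bases bisected at the outset. -/
theorem bisectedEdge_generation_le {R : Set MarkedTriangle} {N : ℕ}
    (hR : ∀ t ∈ 𝒯, t ∈ R → ∀ n, HasGeneration 𝒯₀ n t → n ≤ 2 * N + 1) {e : Sym2 (Space 2)}
    (he : BisectedEdge 𝒯 R e) {t : MarkedTriangle} (ht : t ∈ 𝒯) {n g : ℕ}
    (hn : HasGeneration 𝒯₀ n t) (hg : IsEdgeGeneration n t e g) : g / 2 ≤ N := by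
  have hinc : ∀ t ∈ 𝒯, ∀ t' ∈ 𝒯, ∀ k, DescendsIn k t t' ∨ DescendsIn k t' t → t = t' := by
    intro t ht t' ht' k hk
    rcases hk with hk | hk
    · exact hT.eq_of_descendsIn hF ht ht' hk
    · exact (hT.eq_of_descendsIn hF ht' ht hk).symm
  have hbase : ∀ (t : MarkedTriangle) (n : ℕ), IsEdgeGeneration n t t.base n :=
    fun t n => Or.inl ⟨rfl, rfl⟩
  induction he generalizing t n g with
  | @base q hq hqR =>
    obtain ⟨m, hm⟩ := hT.generation q hq
    have := hF.edge_generation_div_two hn hm (hinc t ht q hq) hg (hbase q m)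
    have := hR q hq hqR m hm
    omega
  | @propagate q e hq hqe _ ih =>
    obtain ⟨m, hm⟩ := hT.generation q hq
    have h1 := hF.edge_generation_div_two hn hm (hinc t ht q hq) hg (hbase q m)
    have h2 : m / 2 ≤ N := by
      rcases mem_edges.1 hqe with rfl | h | h
      · exact ih hq hm (hbase q m)
      · have := ih hq hm (g := m + 1) (Or.inr ⟨Or.inl h, rfl⟩); omega
      · have := ih hq hm (g := m + 1) (Or.inr ⟨Or.inr h, rfl⟩); omega
    omega

/-- The bound is even on purpose: neighbors agree on edge generations only after division by two. -/
theorem refine_generationLE {R : Set MarkedTriangle} {N : ℕ} (hN : GenerationLE 𝒯₀ (2 * N + 2) 𝒯)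
    (hR : ∀ t ∈ 𝒯, t ∈ R → ∀ n, HasGeneration 𝒯₀ n t → n ≤ 2 * N + 1) :
    GenerationLE 𝒯₀ (2 * N + 2) (refineTriangulation 𝒯 R) := by
  intro q hq m hm
  obtain ⟨t, ht, hqt⟩ := mem_refineTriangulation.1 hq
  obtain ⟨n, hn⟩ := hT.generation t ht
  obtain ⟨k, hk, hkn⟩ := subdivide_descendsIn hqt (hN t ht n hn)
    fun e he g hg => hT.bisectedEdge_generation_le hF hR he ht hn hg
  obtain ⟨r, hr, hrt⟩ := hn
  rw [hF.generation_unique hm ⟨r, hr, hrt.trans hk⟩]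
  exact hkn

/-- Merging nothing is admissible, so an accepted tent always has a successor front. -/
theorem isCoarsening_self (τ : Space 2 → ℝ) : IsCoarsening 𝒯₀ 𝒯 τ 𝒯 := by
  refine ⟨hT.conforming, fun t ht => ?_, fun t ht => ⟨t, ht, .refl⟩, fun t ht => ⟨t, ht, .refl⟩,
    fun t ht => ?_⟩
  · obtain ⟨n, r, hr, hrt⟩ := hT.generation t ht
    exact ⟨r, hr, hrt.isDescendant⟩
  · obtain ⟨A, hA⟩ := exists_affine_interpolant (hT.nondegenerate hF ht).indep τ
    refine ⟨A, fun v hv => (hA v hv).symm, fun t' ht' hd v hv => ?_⟩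
    obtain ⟨k, hk⟩ := hd.exists_descendsIn
    obtain rfl := hT.eq_of_descendsIn hF ht ht' hk
    exact (hA v hv).symm

omit hF in
theorem coarsen {τ : Space 2 → ℝ} {𝒯' : Finset MarkedTriangle}
    (hc : IsCoarsening 𝒯₀ 𝒯 τ 𝒯') : IsTriangulation K 𝒯₀ 𝒯' where
  generation t' ht' := by
    obtain ⟨r, hr, hrt⟩ := hc.2.1 t' ht'
    obtain ⟨n, hn⟩ := hrt.exists_descendsIn
    exact ⟨n, r, hr, hn⟩
  conforming := hc.1
  cover x hx := by
    obtain ⟨t, ht, hxt⟩ := hT.cover x hx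
    obtain ⟨t', ht', hd⟩ := hc.2.2.1 t ht
    obtain ⟨k, hk⟩ := hd.exists_descendsIn
    exact ⟨t', ht', hk.hull_subset hxt⟩

omit hF hT in
theorem coarsen_generationLE {N : ℕ} (hN : GenerationLE 𝒯₀ N 𝒯) {τ : Space 2 → ℝ}
    {𝒯' : Finset MarkedTriangle} (hc : IsCoarsening 𝒯₀ 𝒯 τ 𝒯') : GenerationLE 𝒯₀ N 𝒯' := by
  rintro t' ht' n ⟨r, hr, hrt⟩
  obtain ⟨t, ht, hd⟩ := hc.2.2.2.1 t' ht'
  obtain ⟨k, hk⟩ := hd.exists_descendsIn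
  have := hN t ht (n + k) ⟨r, hr, hrt.trans hk⟩
  omega

end IsTriangulation

/-- The descendants of the initial triangles, of generation at most `N`, that have a descendant in
`𝒯`. -/
def ancestors (𝒯₀ : Finset MarkedTriangle) (N : ℕ) (𝒯 : Finset MarkedTriangle) :
    Set MarkedTriangle :=
  {q | (∃ n ≤ N, HasGeneration 𝒯₀ n q) ∧ ∃ t ∈ 𝒯, ∃ k, DescendsIn k q t}

/-- The measure that limits rejections. Refinement loses no ancestors and adds a piece of the
refined triangle `t`. Had this piece been an ancestor before, the triangulation would have contained
a proper descendant of `t`. -/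
theorem IsTriangulation.ancestors_ssubset {K : Geometry.SimplicialComplex ℝ (Space 2)}
    {𝒯₀ 𝒯 : Finset MarkedTriangle} (hF : IsForest 𝒯₀) (hT : IsTriangulation K 𝒯₀ 𝒯)
    {R : Set MarkedTriangle} {N : ℕ} (hN : GenerationLE 𝒯₀ N (refineTriangulation 𝒯 R))
    {t : MarkedTriangle} (ht : t ∈ 𝒯) (htR : t ∈ R) :
    ancestors 𝒯₀ N 𝒯 ⊂ ancestors 𝒯₀ N (refineTriangulation 𝒯 R) := by
  have hex : ∀ t : MarkedTriangle, ∃ q, q ∈ t.subdivide {e | BisectedEdge 𝒯 R e} := by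
    intro t
    obtain ⟨q, hq, -⟩ := subdivide_cover (M := {e | BisectedEdge 𝒯 R e}) (mem_hull t.apex_mem)
    exact ⟨q, hq⟩
  refine (ssubset_iff_of_subset ?_).2 ?_
  · rintro q ⟨hq, t, ht, k, hk⟩
    obtain ⟨c, hc⟩ := hex t
    obtain ⟨j, hj⟩ := subdivide_exists_descendsIn hc
    exact ⟨hq, c, mem_refineTriangulation.2 ⟨t, ht, hc⟩, k + j, hk.trans hj⟩
  · obtain ⟨c, hc⟩ := hex t
    have hcT : c ∈ refineTriangulation 𝒯 R := mem_refineTriangulation.2 ⟨t, ht, hc⟩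
    obtain ⟨n, hn⟩ := (hT.refine hF R).generation c hcT
    refine ⟨c, ⟨⟨n, hN c hcT n hn, hn⟩, c, hcT, 0, .refl c⟩, ?_⟩
    rintro ⟨-, t', ht', k, hk⟩
    have hchild : ∃ b j, IsChild t b ∧ DescendsIn j b c := by
      have hM : t.base ∈ {e | BisectedEdge 𝒯 R e} := BisectedEdge.base ht htR
      rcases mem_subdivide.1 hc with ⟨h, -⟩ | ⟨-, h | h⟩
      · exact absurd hM h
      · obtain ⟨j, hj⟩ := leftPieces_descendsIn h
        exact ⟨_, j, Or.inl rfl, hj⟩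
      · obtain ⟨j, hj⟩ := leftPieces_descendsIn h
        exact ⟨_, j, Or.inr (leftChild_swap t), hj⟩
    obtain ⟨b, j, hb, hj⟩ := hchild
    have htt' := hT.eq_of_descendsIn hF ht ht' (DescendsIn.head hb (hj.trans hk))
    subst htt'
    exact IsChild.verts_ne (hT.nondegenerate hF ht) hb (hj.trans hk) subset_rfl

theorem ancestors_finite (𝒯₀ : Finset MarkedTriangle) (N : ℕ) (𝒯 : Finset MarkedTriangle) :
    (ancestors 𝒯₀ N 𝒯).Finite :=
  (finite_hasGeneration 𝒯₀ N).subset fun _ h => h.1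

/-! ### Altitudes of triangles and the adaptive progress constraint -/

theorem dist_sq_eq (u v : Space 2) : dist u v ^ 2 = (u 0 - v 0) ^ 2 + (u 1 - v 1) ^ 2 := by
  rw [EuclideanSpace.dist_eq, Real.sq_sqrt (Finset.sum_nonneg fun _ _ => sq_nonneg _),
    Fin.sum_univ_two, Real.dist_eq, Real.dist_eq, sq_abs, sq_abs]

/-- Altitude times base is twice the area. The foot of the perpendicular gives one inequality; for
the other, squared cross product plus squared inner product equals the product of squared lengths.
Altitudes are compared through this formula. -/
theorem infDist_affineSpan_mul_dist (a b c : Space 2) :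
    Metric.infDist a (affineSpan ℝ {b, c}) * dist b c = |cross (b - a) (c - a)| := by
  rcases eq_or_ne b c with rfl | hbc
  · rw [dist_self, mul_zero]
    simp [cross, mul_comm]
  have hd : 0 < dist b c := dist_pos.2 hbc
  have hsq := dist_sq_eq b c
  have hcross : cross (b - a) (c - a) =
      (b 0 - a 0) * (c 1 - a 1) - (b 1 - a 1) * (c 0 - a 0) := by simp [cross]
  apply le_antisymm
  · set r : ℝ := ((a 0 - b 0) * (c 0 - b 0) + (a 1 - b 1) * (c 1 - b 1)) / dist b c ^ 2 with hr
    have hr' : r * dist b c ^ 2 = (a 0 - b 0) * (c 0 - b 0) + (a 1 - b 1) * (c 1 - b 1) := by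
      rw [hr]; field_simp
    have hmem : AffineMap.lineMap b c r ∈ affineSpan ℝ ({b, c} : Set (Space 2)) :=
      AffineMap.lineMap_mem_affineSpan_pair r b c
    have hle := Metric.infDist_le_dist_of_mem (x := a) hmem
    refine (mul_le_mul_of_nonneg_right hle hd.le).trans ?_
    refine abs_le_of_sq_le_sq' ?_ (abs_nonneg _) |>.2
    rw [mul_pow, sq_abs, dist_sq_eq a, hcross, AffineMap.lineMap_apply]
    simp only [vsub_eq_sub, vadd_eq_add, PiLp.add_apply, PiLp.smul_apply, PiLp.sub_apply,
      smul_eq_mul]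
    rw [hsq] at hr' ⊢
    refine le_of_eq ?_
    have key : ((a 0 - (r * (c 0 - b 0) + b 0)) ^ 2 + (a 1 - (r * (c 1 - b 1) + b 1)) ^ 2) *
        ((b 0 - c 0) ^ 2 + (b 1 - c 1) ^ 2) =
        ((a 0 - b 0) ^ 2 + (a 1 - b 1) ^ 2) * ((b 0 - c 0) ^ 2 + (b 1 - c 1) ^ 2) -
        2 * ((a 0 - b 0) * (c 0 - b 0) + (a 1 - b 1) * (c 1 - b 1)) *
          (r * ((b 0 - c 0) ^ 2 + (b 1 - c 1) ^ 2)) +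
        (r * ((b 0 - c 0) ^ 2 + (b 1 - c 1) ^ 2)) ^ 2 := by ring
    rw [key, hr']
    ring
  · rw [← div_le_iff₀ hd]
    refine (Metric.le_infDist ⟨b, left_mem_affineSpan_pair ℝ b c⟩).2 fun x hx => ?_
    obtain ⟨r, rfl⟩ := mem_affineSpan_pair_iff_exists_lineMap_eq.1 hx
    rw [div_le_iff₀ hd]
    refine abs_le_of_sq_le_sq' ?_ (mul_nonneg dist_nonneg dist_nonneg) |>.2
    rw [mul_pow, sq_abs, dist_sq_eq a, hcross, AffineMap.lineMap_apply, hsq]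
    simp only [vsub_eq_sub, vadd_eq_add, PiLp.add_apply, PiLp.smul_apply, PiLp.sub_apply,
      smul_eq_mul]
    nlinarith [sq_nonneg ((a 0 - (r * (c 0 - b 0) + b 0)) * (b 0 - c 0) +
      (a 1 - (r * (c 1 - b 1) + b 1)) * (b 1 - c 1))]

/-- Area scales by `r ^ 2` and the base by `|r|`. A negative ratio is allowed because point
reflections occur. -/
theorem infDist_affineSpan_of_homothety {a b c a' b' c' : Space 2} {r : ℝ} (hr : r ≠ 0)
    (hb : b' - a' = r • (b - a)) (hc : c' - a' = r • (c - a)) (hbc : b ≠ c) :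
    Metric.infDist a' (affineSpan ℝ {b', c'}) = |r| * Metric.infDist a (affineSpan ℝ {b, c}) := by
  have h := infDist_affineSpan_mul_dist a b c
  have h' := infDist_affineSpan_mul_dist a' b' c'
  have hd : 0 < dist b c := dist_pos.2 hbc
  have hdist : dist b' c' = |r| * dist b c := by
    rw [dist_eq_norm, dist_eq_norm, ← sub_sub_sub_cancel_right b' c' a', hb, hc, ← smul_sub,
      sub_sub_sub_cancel_right, norm_smul, Real.norm_eq_abs]
  have hr' : 0 < |r| := abs_pos.2 hr
  rw [hdist, hb, hc] at h'
  have hcr : cross (r • (b - a)) (r • (c - a)) = r ^ 2 * cross (b - a) (c - a) := by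
    simp only [cross, PiLp.smul_apply, smul_eq_mul]; ring
  rw [hcr, abs_mul, ← h, abs_pow] at h'
  have : (|r| * dist b c) * Metric.infDist a' (affineSpan ℝ {b', c'}) =
      (|r| * dist b c) * (|r| * Metric.infDist a (affineSpan ℝ {b, c})) := by linarith
  exact mul_left_cancel₀ (by positivity) this

section Width

variable {ε φ : ℝ}

theorem diminishedWidth_comm (ε φ : ℝ) (a b c : Space 2) :
    diminishedWidth ε φ a b c = diminishedWidth ε φ a c b := by
  rw [diminishedWidth, diminishedWidth, Set.pair_comm c b,
    min_comm ((1 - φ) * Metric.infDist c _)]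

theorem ne_of_cross_ne_zero {a b c : Space 2} (h : cross (b - a) (c - a) ≠ 0) :
    a ≠ b ∧ a ≠ c ∧ b ≠ c :=
  Nondegenerate.ne (t := ⟨a, b, c⟩) h

theorem diminishedWidth_of_homothety (ε φ : ℝ) {a b c a' b' c' : Space 2} {r : ℝ} (hr : r ≠ 0)
    (hb : b' - a' = r • (b - a)) (hc : c' - a' = r • (c - a))
    (hnd : cross (b - a) (c - a) ≠ 0) :
    diminishedWidth ε φ a' b' c' = |r| * diminishedWidth ε φ a b c := by
  obtain ⟨hab, hac, hbc⟩ := ne_of_cross_ne_zero hnd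
  have h1 := infDist_affineSpan_of_homothety hr hb hc hbc
  have hcb : c' - b' = r • (c - b) := by
    rw [← sub_sub_sub_cancel_right c' b' a', hb, hc, ← smul_sub, sub_sub_sub_cancel_right]
  have hab' : a' - b' = r • (a - b) := by rw [← neg_sub b' a', hb, ← smul_neg, neg_sub]
  have hac' : a' - c' = r • (a - c) := by rw [← neg_sub c' a', hc, ← smul_neg, neg_sub]
  have hbc' : b' - c' = r • (b - c) := by rw [← neg_sub c' b', hcb, ← smul_neg, neg_sub]
  have h2 := infDist_affineSpan_of_homothety hr hab' hcb hac
  have h3 := infDist_affineSpan_of_homothety hr hac' hbc' hab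
  rw [diminishedWidth, diminishedWidth, h1, h2, h3, mul_min_of_nonneg _ _ (abs_nonneg r),
    mul_min_of_nonneg _ _ (abs_nonneg r)]
  congr 1
  · ring
  · congr 1 <;> ring

theorem infDist_affineSpan_pos {a b c : Space 2} (hnd : cross (b - a) (c - a) ≠ 0) :
    0 < Metric.infDist a (affineSpan ℝ {b, c}) := by
  have h := infDist_affineSpan_mul_dist a b c
  have : 0 < |cross (b - a) (c - a)| := abs_pos.2 hnd
  rw [← h] at this
  exact pos_of_mul_pos_left this dist_nonneg

theorem diminishedWidth_pos (hε : ε < 1) (hφ : φ < 1) {a b c : Space 2}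
    (hnd : cross (b - a) (c - a) ≠ 0) : 0 < diminishedWidth ε φ a b c := by
  have h2 : cross (a - b) (c - b) ≠ 0 := by
    have : cross (a - b) (c - b) = - cross (b - a) (c - a) := by simp [cross]; ring
    rwa [this, neg_ne_zero]
  have h3 : cross (a - c) (b - c) ≠ 0 := by
    have : cross (a - c) (b - c) = cross (b - a) (c - a) := by simp [cross]; ring
    rwa [this]
  have p1 := infDist_affineSpan_pos hnd
  have p2 := infDist_affineSpan_pos h2
  have p3 := infDist_affineSpan_pos h3
  have q1 : 0 < 1 - ε := by linarith
  have q2 : 0 < 1 - φ := by linarith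
  exact lt_min (by positivity) (lt_min (by positivity) (by positivity))

end Width

section Constraint

variable {ε φ s : ℝ} {τ : Space 2 → ℝ} {t : MarkedTriangle}

theorem SatisfiesAdaptiveConstraint.congr {τ' : Space 2 → ℝ}
    (h : SatisfiesAdaptiveConstraint ε φ s τ t) (hτ : ∀ v ∈ t.verts, τ v = τ' v) :
    SatisfiesAdaptiveConstraint ε φ s τ' t := by
  simp only [SatisfiesAdaptiveConstraint] at h ⊢
  rwa [← hτ _ t.apex_mem, ← hτ _ t.left_mem, ← hτ _ t.right_mem]

/-- The two triangles are halves of the parallelogram formed by `a` and the three midpoints,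
exchanged by a point reflection. This makes the fourth inequality of the constraint symmetric in the
base vertices. -/
theorem diminishedWidth_midline (ε φ : ℝ) {a b c : Space 2} (hnd : cross (b - a) (c - a) ≠ 0) :
    diminishedWidth ε φ (midpoint ℝ a b) a (midpoint ℝ b c) =
      diminishedWidth ε φ (midpoint ℝ a c) a (midpoint ℝ b c) := by
  rw [diminishedWidth_comm ε φ (midpoint ℝ a c)]
  have h : diminishedWidth ε φ (midpoint ℝ a b) a (midpoint ℝ b c) =
      |(-1 : ℝ)| * diminishedWidth ε φ (midpoint ℝ a c) (midpoint ℝ b c) a := by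
    refine diminishedWidth_of_homothety ε φ (by norm_num) ?_ ?_ ?_
    · ext i; simp [midpoint_apply]; ring
    · ext i; simp [midpoint_apply]; ring
    · have : cross (midpoint ℝ b c - midpoint ℝ a c) (a - midpoint ℝ a c) =
          -(1 / 4) * cross (b - a) (c - a) := by simp [cross, midpoint_apply]; ring
      rw [this]
      exact mul_ne_zero (by norm_num) hnd
  simpa using h

theorem satisfiesAdaptiveConstraint_swap (ht : t.Nondegenerate) :
    SatisfiesAdaptiveConstraint ε φ s τ t.swap ↔ SatisfiesAdaptiveConstraint ε φ s τ t := by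
  have h := diminishedWidth_midline ε φ ht
  have h1 := diminishedWidth_comm ε φ (midpoint ℝ t.left t.right) t.left t.apex
  have h2 := diminishedWidth_comm ε φ (midpoint ℝ t.left t.right) t.apex t.right
  have h3 := diminishedWidth_comm ε φ t.apex t.right t.left
  simp only [SatisfiesAdaptiveConstraint, MarkedTriangle.swap]
  rw [midpoint_comm t.right t.left, h, h1, h2, h3, add_comm (τ t.right), abs_sub_comm (τ t.right)]
  tauto

/-- The reason for the form of the constraint: inequalities 1, 2, 3, 4 of the child are inequalities
2, 3, 4, 1 of the parent. The triangles whose widths appear are equal, congruent or similar with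
ratio 1/2, and linearity of the front along the base matches the time differences. -/
theorem satisfiesAdaptiveConstraint_leftChild (ht : t.Nondegenerate)
    (hτ : τ (midpoint ℝ t.left t.right) = (τ t.left + τ t.right) / 2) :
    SatisfiesAdaptiveConstraint ε φ s τ t.leftChild ↔ SatisfiesAdaptiveConstraint ε φ s τ t := by
  have ht' : cross (t.left - t.apex) (t.right - t.apex) ≠ 0 := ht
  have e1 : diminishedWidth ε φ (midpoint ℝ t.apex t.left) t.left (midpoint ℝ t.left t.right) =
      |(1 / 2 : ℝ)| * diminishedWidth ε φ t.apex t.left t.right := by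
    refine diminishedWidth_of_homothety ε φ (by norm_num) ?_ ?_ ht
    · ext i; simp
    · ext i; simp [midpoint_apply]; ring
  have e3 : diminishedWidth ε φ (midpoint ℝ t.apex t.left) (midpoint ℝ t.left t.right) t.apex =
      diminishedWidth ε φ (midpoint ℝ t.apex t.right) t.apex (midpoint ℝ t.left t.right) := by
    rw [diminishedWidth_comm, diminishedWidth_midline ε φ ht]
  have e4 : diminishedWidth ε φ (midpoint ℝ (midpoint ℝ t.left t.right) t.left)
      (midpoint ℝ t.left t.right) (midpoint ℝ t.apex t.left) =
      |(1 / 2 : ℝ)| * diminishedWidth ε φ (midpoint ℝ t.left t.right) t.right t.apex := by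
    refine diminishedWidth_of_homothety ε φ (by norm_num) ?_ ?_ ?_
    · ext i; simp
    · ext i; simp [midpoint_apply]; ring
    · have : cross (t.right - midpoint ℝ t.left t.right) (t.apex - midpoint ℝ t.left t.right) =
          1 / 2 * cross (t.left - t.apex) (t.right - t.apex) := by
        simp [cross, midpoint_apply]; ring
      rw [this]
      exact mul_ne_zero (by norm_num) ht'
  simp only [SatisfiesAdaptiveConstraint, MarkedTriangle.leftChild]
  rw [e1, e3, e4, hτ, abs_of_pos (by norm_num : (0 : ℝ) < 1 / 2)]
  have f2 : (τ t.left + τ t.right) / 2 - (τ t.apex + τ t.left) / 2 =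
      -((τ t.apex - τ t.right) / 2) := by ring
  have f3 : (τ t.left + τ t.right) / 2 - τ t.left = -((τ t.left - τ t.right) / 2) := by ring
  rw [f2, f3, abs_neg, abs_neg, abs_div, abs_div, abs_two, abs_sub_comm _ (τ t.apex)]
  constructor
  · rintro ⟨h1, h2, h3, h4⟩
    exact ⟨by linarith, by linarith, by linarith, by linarith⟩
  · rintro ⟨h1, h2, h3, h4⟩
    exact ⟨by linarith, by linarith, by linarith, by linarith⟩

theorem satisfiesAdaptiveConstraint_child {c : MarkedTriangle} (ht : t.Nondegenerate)
    (hc : IsChild t c) (A : Space 2 →ᵃ[ℝ] ℝ) :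
    SatisfiesAdaptiveConstraint ε φ s A c ↔ SatisfiesAdaptiveConstraint ε φ s A t := by
  rcases hc with rfl | rfl
  · exact satisfiesAdaptiveConstraint_leftChild ht (affine_midpoint A _ _)
  · rw [← leftChild_swap, satisfiesAdaptiveConstraint_leftChild ht.swap (affine_midpoint A _ _),
      satisfiesAdaptiveConstraint_swap ht]

theorem satisfiesAdaptiveConstraint_descendsIn {c : MarkedTriangle} (ht : t.Nondegenerate) {n : ℕ}
    (hc : DescendsIn n t c) (A : Space 2 →ᵃ[ℝ] ℝ) :
    SatisfiesAdaptiveConstraint ε φ s A c ↔ SatisfiesAdaptiveConstraint ε φ s A t := by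
  induction hc with
  | refl => rfl
  | head hab _ ih => rw [ih (ht.child hab), satisfiesAdaptiveConstraint_child ht hab]

end Constraint

/-! ### Positive progress at every vertex of a triangle -/

section Progress

theorem exists_gradient_pair [DecidableEq (Space 2)] {q r : Space 2} (hqr : q ≠ r)
    (τ : Space 2 → ℝ) : ∃ g, IsGradient τ ({q, r} : Finset (Space 2)) g ∧
      ‖g‖ * dist q r = |τ q - τ r| := by
  have hd : 0 < ‖r - q‖ := norm_pos_iff.2 (sub_ne_zero.2 hqr.symm)
  have hin : inner ℝ (r - q) (r - q) = ‖r - q‖ ^ 2 := real_inner_self_eq_norm_sq _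
  refine ⟨((τ r - τ q) / ‖r - q‖ ^ 2) • (r - q), ⟨?_, ?_⟩, ?_⟩
  · refine Submodule.smul_mem _ _ (vsub_mem_vectorSpan ℝ ?_ ?_) <;> simp
  · have h1 : τ r - τ q = inner ℝ (((τ r - τ q) / ‖r - q‖ ^ 2) • (r - q)) (r - q) := by
      rw [real_inner_smul_left, hin]; field_simp
    have h2 : τ q - τ r = inner ℝ (((τ r - τ q) / ‖r - q‖ ^ 2) • (r - q)) (q - r) := by
      rw [← neg_sub r q, inner_neg_right, ← h1]; ring
    intro u hu v hv
    simp only [Finset.mem_insert, Finset.mem_singleton] at hu hv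
    rcases hu with rfl | rfl <;> rcases hv with rfl | rfl
    · simp
    · exact h1
    · exact h2
    · simp
  · rw [norm_smul, norm_div, norm_pow, norm_norm, dist_comm, dist_eq_norm, Real.norm_eq_abs,
      abs_sub_comm]
    field_simp

/-- A lowest vertex `p` of a triangle `pqr` can be advanced without violating causality if the
slope along the opposite edge is small compared to the altitude of `p`. -/
theorem exists_gradient_advance_triangle [DecidableEq (Space 2)] {p q r x : Space 2}
    (hnd : cross (q - p) (r - p) ≠ 0) (hx : x ∈ hull ({q, r} : Finset (Space 2)))
    {τ : Space 2 → ℝ} {β s δ : ℝ}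
    (hslope : |τ q - τ r| * dist p x ≤ β * |cross (q - p) (r - p)|)
    (hg : ∃ g, IsGradient τ ({p, q, r} : Finset (Space 2)) g ∧ ‖g‖ < s)
    (hq : τ p ≤ τ q) (hr : τ p ≤ τ r) (hδ : 0 ≤ δ)
    (hδs : δ * dist q r < (s - β) * |cross (q - p) (r - p)|) :
    ∃ g, IsGradient (advance τ p δ) ({p, q, r} : Finset (Space 2)) g ∧ ‖g‖ < s := by
  obtain ⟨hpq, hpr, hqr⟩ := ne_of_cross_ne_zero hnd
  obtain ⟨g, hg, hgs⟩ := hg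
  obtain ⟨gΔ, hgΔ, hnorm⟩ := exists_gradient_pair hqr τ
  have harea := infDist_affineSpan_mul_dist p q r
  have hd : 0 < dist q r := dist_pos.2 hqr
  have hind : AffineIndependent ℝ ((↑) : ({p, q, r} : Finset (Space 2)) → Space 2) := by
    have := Nondegenerate.indep (t := ⟨p, q, r⟩) hnd
    convert this using 2 <;> simp [verts]
  have herase : ({p, q, r} : Finset (Space 2)).erase p = {q, r} := by
    rw [Finset.erase_insert]; simp [hpq, hpr]
  have hcoe : (({q, r} : Finset (Space 2)) : Set (Space 2)) = {q, r} := by simp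
  have hle : ‖gΔ‖ * Metric.infDist p (hull ({q, r} : Finset (Space 2))) ≤
      β * Metric.infDist p (affineSpan ℝ ({q, r} : Set (Space 2))) := by
    have h1 : Metric.infDist p (hull ({q, r} : Finset (Space 2))) ≤ dist p x :=
      Metric.infDist_le_dist_of_mem hx
    refine (mul_le_mul_of_nonneg_left h1 (norm_nonneg _)).trans ?_
    refine le_of_mul_le_mul_right ?_ hd
    calc ‖gΔ‖ * dist p x * dist q r = |τ q - τ r| * dist p x := by rw [← hnorm]; ring
      _ ≤ β * |cross (q - p) (r - p)| := hslope
      _ = _ := by rw [← harea]; ring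
  obtain ⟨hpos, g', hg', hor⟩ := exists_gradient_advance hind (p := p) (by simp)
    (by rw [herase]; simp) (by rw [herase]; exact hgΔ) hg (β := β)
    (by rw [herase, hcoe]; exact hle)
    (by
      intro v hv
      simp only [Finset.mem_insert, Finset.mem_singleton] at hv
      rcases hv with rfl | rfl | rfl
      · exact le_rfl
      · exact hq
      · exact hr) hδ
  refine ⟨g', hg', ?_⟩
  rcases hor with h | h
  · exact h.trans_lt hgs
  · refine h.trans_lt ?_
    rw [herase, hcoe] at hpos ⊢
    have : δ / Metric.infDist p (affineSpan ℝ ({q, r} : Set (Space 2))) < s - β := by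
      rw [div_lt_iff₀ hpos]
      refine lt_of_mul_lt_mul_right ?_ hd.le
      calc _ < _ := hδs
        _ = _ := by rw [← harea]; ring
    linarith

variable {ε φ s : ℝ}

/-- The front `τ` is progressive on the triangle `t`. -/
def IsProgressiveOn (ε φ s : ℝ) (τ : Space 2 → ℝ) (t : MarkedTriangle) : Prop :=
  (∃ g, IsGradient τ t.verts g ∧ ‖g‖ < s) ∧ SatisfiesAdaptiveConstraint ε φ s τ t

theorem IsProgressiveOn.congr {τ τ' : Space 2 → ℝ} {t : MarkedTriangle}
    (h : IsProgressiveOn ε φ s τ t) (hτ : ∀ v ∈ t.verts, τ v = τ' v) :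
    IsProgressiveOn ε φ s τ' t := by
  obtain ⟨⟨g, hg, hgs⟩, hc⟩ := h
  exact ⟨⟨g, hg.congr hτ, hgs⟩, hc.congr hτ⟩

theorem isProgressiveOn_swap {τ : Space 2 → ℝ} {t : MarkedTriangle} (ht : t.Nondegenerate) :
    IsProgressiveOn ε φ s τ t.swap ↔ IsProgressiveOn ε φ s τ t := by
  rw [IsProgressiveOn, IsProgressiveOn, verts_swap, satisfiesAdaptiveConstraint_swap ht]

theorem infDist_midpoint_mul_dist (a b c : Space 2) :
    Metric.infDist (midpoint ℝ b c) (affineSpan ℝ {a, b}) * dist a b =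
      |cross (b - a) (c - a)| / 2 := by
  rw [infDist_affineSpan_mul_dist]
  have : cross (a - midpoint ℝ b c) (b - midpoint ℝ b c) = cross (b - a) (c - a) / 2 := by
    simp [cross, midpoint_apply]; ring
  rw [this, abs_div, abs_two]

/-- This provides the slack for advancing a base vertex. Each term of the minimum on the right
exceeds a term on the left: the first because `ε < φ`, the third because the midpoint has half the
altitude of `c` and `φ < (1 + ε) / 2`. For the altitude of `b`, the parallelogram law shows that
`ac` is shorter than `bc` or than twice the median; for equal areas, a shorter base means a larger
altitude. -/
theorem diminishedWidth_midpoint_lt (hεφ : ε < φ) (hφ : φ < (1 + ε) / 2)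
    {a b c : Space 2} (hnd : cross (b - a) (c - a) ≠ 0) :
    diminishedWidth ε φ (midpoint ℝ b c) a b < diminishedWidth ε φ a b c := by
  obtain ⟨hab, hac, hbc⟩ := ne_of_cross_ne_zero hnd
  have hA : 0 < |cross (b - a) (c - a)| := abs_pos.2 hnd
  have hφ1 : 0 < 1 - φ := by linarith
  have ham : a ≠ midpoint ℝ b c := by
    rintro h
    apply hnd
    rw [h]; simp [cross]; ring
  have d1 := infDist_midpoint_mul_dist a b c
  have d2 : Metric.infDist a (affineSpan ℝ {midpoint ℝ b c, b}) * (dist b c / 2) =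
      |cross (b - a) (c - a)| / 2 := by
    have := infDist_affineSpan_mul_dist a (midpoint ℝ b c) b
    rw [dist_midpoint_left] at this
    have h2 : cross (midpoint ℝ b c - a) (b - a) = -(cross (b - a) (c - a) / 2) := by
      simp [cross, midpoint_apply]; ring
    rw [h2, abs_neg, abs_div, abs_two] at this
    rw [← this]; norm_num; ring_nf; simp
  have d3 : Metric.infDist b (affineSpan ℝ {midpoint ℝ b c, a}) * dist a (midpoint ℝ b c) =
      |cross (b - a) (c - a)| / 2 := by
    rw [dist_comm, infDist_affineSpan_mul_dist]
    have h2 : cross (midpoint ℝ b c - b) (a - b) = cross (b - a) (c - a) / 2 := by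
      simp [cross]; ring
    rw [h2, abs_div, abs_two]
  have e1 := infDist_affineSpan_mul_dist a b c
  have e2 : Metric.infDist b (affineSpan ℝ {a, c}) * dist a c = |cross (b - a) (c - a)| := by
    rw [infDist_affineSpan_mul_dist, ← abs_neg]; congr 1; simp [cross]; ring
  have e3 : Metric.infDist c (affineSpan ℝ {a, b}) * dist a b = |cross (b - a) (c - a)| := by
    rw [infDist_affineSpan_mul_dist]; congr 1; simp [cross]; ring
  have hpar : 4 * dist a (midpoint ℝ b c) ^ 2 + dist b c ^ 2 = 2 * dist a b ^ 2 + 2 * dist a c ^ 2 := by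
    simp only [dist_sq_eq, midpoint_apply]; ring
  have px : 0 < dist a b := dist_pos.2 hab
  have py : 0 < dist a c := dist_pos.2 hac
  have pz : 0 < dist b c := dist_pos.2 hbc
  have pm : 0 < dist a (midpoint ℝ b c) := dist_pos.2 ham
  simp only [diminishedWidth]
  generalize Metric.infDist (midpoint ℝ b c) (affineSpan ℝ {a, b}) = D1 at *
  generalize Metric.infDist a (affineSpan ℝ {midpoint ℝ b c, b}) = D2 at *
  generalize Metric.infDist b (affineSpan ℝ {midpoint ℝ b c, a}) = D3 at *
  generalize Metric.infDist a (affineSpan ℝ {b, c}) = Da at *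
  generalize Metric.infDist b (affineSpan ℝ {a, c}) = Db at *
  generalize Metric.infDist c (affineSpan ℝ {a, b}) = Dc at *
  generalize dist a (midpoint ℝ b c) = μ at *
  generalize dist a b = x at *
  generalize dist a c = y at *
  generalize dist b c = z at *
  generalize |cross (b - a) (c - a)| = A at *
  have i1 : D1 = Dc / 2 := mul_right_cancel₀ px.ne' (by linarith)
  have i2 : D2 = Da := mul_right_cancel₀ pz.ne' (by linarith)
  have pDa : 0 < Da := pos_of_mul_pos_left (by rw [e1]; exact hA) pz.le
  have pDb : 0 < Db := pos_of_mul_pos_left (by rw [e2]; exact hA) py.le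
  have pDc : 0 < Dc := pos_of_mul_pos_left (by rw [e3]; exact hA) px.le
  refine lt_min ?_ (lt_min ?_ ?_)
  · refine (min_le_right _ _).trans_lt ((min_le_left _ _).trans_lt ?_)
    rw [i2]
    exact mul_lt_mul_of_pos_right (by linarith) pDa
  · by_cases hz : y < z
    · refine (min_le_right _ _).trans_lt ((min_le_left _ _).trans_lt ?_)
      rw [i2]
      refine mul_lt_mul_of_pos_left ?_ hφ1
      refine lt_of_mul_lt_mul_right ?_ pz.le
      rw [e1, ← e2]
      exact mul_lt_mul_of_pos_left hz pDb
    · have hm : y < 2 * μ := by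
        push Not at hz
        refine lt_of_pow_lt_pow_left₀ 2 (by positivity) ?_
        have : z ^ 2 ≤ y ^ 2 := pow_le_pow_left₀ pz.le hz 2
        have : 0 < x ^ 2 := by positivity
        nlinarith
      refine (min_le_right _ _).trans_lt ((min_le_right _ _).trans_lt ?_)
      refine mul_lt_mul_of_pos_left ?_ hφ1
      refine lt_of_mul_lt_mul_right ?_ (by positivity : (0 : ℝ) ≤ 2 * μ)
      calc D3 * (2 * μ) = Db * y := by rw [e2]; linarith
        _ < Db * (2 * μ) := mul_lt_mul_of_pos_left hm pDb
  · refine (min_le_left _ _).trans_lt ?_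
    rw [i1]
    nlinarith

theorem abs_add_le_of_nonpos {x δ X : ℝ} (hx : |x| ≤ X) (hx0 : x ≤ 0) (hδ : 0 ≤ δ) (hδX : δ ≤ X) :
    |x + δ| ≤ X := by
  rw [abs_le] at hx ⊢
  constructor <;> linarith

theorem abs_sub_le_of_nonneg {x δ X : ℝ} (hx : |x| ≤ X) (hx0 : 0 ≤ x) (hδ : 0 ≤ δ) (hδX : δ ≤ X) :
    |x - δ| ≤ X := by
  rw [abs_le] at hx ⊢
  constructor <;> linarith

theorem exists_progress_apex (hε0 : 0 < ε) (hεφ : ε < φ) (hφ : φ < 1) (hs : 0 < s)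
    {t : MarkedTriangle} (ht : t.Nondegenerate) :
    ∃ η > 0, ∀ (τ : Space 2 → ℝ) (δ : ℝ), IsProgressiveOn ε φ s τ t →
      (∀ q ∈ t.verts, τ t.apex ≤ τ q) → 0 ≤ δ → δ ≤ η →
      IsProgressiveOn ε φ s (advance τ t.apex δ) t := by
  classical
  obtain ⟨a, b, c⟩ := t
  have hnd : cross (b - a) (c - a) ≠ 0 := ht
  obtain ⟨hab, hac, hbc⟩ := ne_of_cross_ne_zero hnd
  have hA : 0 < |cross (b - a) (c - a)| := abs_pos.2 hnd
  have hd : 0 < dist b c := dist_pos.2 hbc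
  have hε : ε < 1 := by linarith
  have w1 : 0 < diminishedWidth ε φ (midpoint ℝ b c) c a := by
    refine diminishedWidth_pos hε hφ ?_
    have : cross (c - midpoint ℝ b c) (a - midpoint ℝ b c) = cross (b - a) (c - a) / 2 := by
      simp [cross, midpoint_apply]; ring
    rw [this]; positivity
  have w2 : 0 < diminishedWidth ε φ a b c := diminishedWidth_pos hε hφ hnd
  have w3 : 0 < diminishedWidth ε φ (midpoint ℝ b c) a b := by
    refine diminishedWidth_pos hε hφ ?_
    have : cross (a - midpoint ℝ b c) (b - midpoint ℝ b c) = cross (b - a) (c - a) / 2 := by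
      simp [cross, midpoint_apply]; ring
    rw [this]; positivity
  -- Three terms protect the inequalities that involve the apex, the last one protects causality.
  refine ⟨min (min (2 * diminishedWidth ε φ (midpoint ℝ b c) c a * s) (diminishedWidth ε φ a b c * s))
    (min (2 * diminishedWidth ε φ (midpoint ℝ b c) a b * s)
      (ε * s * |cross (b - a) (c - a)| / (2 * dist b c))), by positivity, ?_⟩
  rintro τ δ ⟨hg, c1, c2, c3, c4⟩ hmin hδ hδη
  simp only [le_min_iff] at hδη
  obtain ⟨⟨hδ1, hδ2⟩, hδ3, hδ4⟩ := hδη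
  have hb := hmin b (left_mem ⟨a, b, c⟩)
  have hc := hmin c (right_mem ⟨a, b, c⟩)
  dsimp only at c1 c2 c3 c4 hb hc
  refine ⟨?_, ?_⟩
  · refine exists_gradient_advance_triangle (x := midpoint ℝ b c) (β := (1 - ε) * s) hnd ?_ ?_ hg
      hb hc hδ ?_
    · rw [hull, Finset.coe_pair, convexHull_pair]
      exact midpoint_mem_segment b c
    -- The altitude of the midpoint of `ac` over the median, times the median, is a quarter of the
    -- determinant. So the fourth inequality is just the slope condition needed for `bc`, with the
    -- midpoint of `bc` as the point `x`.
    · have hH : Metric.infDist (midpoint ℝ a c) (affineSpan ℝ {a, midpoint ℝ b c}) *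
          dist a (midpoint ℝ b c) = |cross (b - a) (c - a)| / 4 := by
        rw [infDist_affineSpan_mul_dist]
        have : cross (a - midpoint ℝ a c) (midpoint ℝ b c - midpoint ℝ a c) =
            cross (b - a) (c - a) / 4 := by simp [cross, midpoint_apply]; ring
        rw [this, abs_div]; norm_num
      have hw : diminishedWidth ε φ (midpoint ℝ a c) a (midpoint ℝ b c) ≤
          (1 - ε) * Metric.infDist (midpoint ℝ a c) (affineSpan ℝ {a, midpoint ℝ b c}) :=
        min_le_left _ _
      calc |τ b - τ c| * dist a (midpoint ℝ b c)
          ≤ 4 * ((1 - ε) * Metric.infDist (midpoint ℝ a c)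
              (affineSpan ℝ {a, midpoint ℝ b c})) * s * dist a (midpoint ℝ b c) := by
            refine mul_le_mul_of_nonneg_right (c4.trans ?_) dist_nonneg
            gcongr
        _ = 4 * (1 - ε) * s * (Metric.infDist (midpoint ℝ a c)
              (affineSpan ℝ {a, midpoint ℝ b c}) * dist a (midpoint ℝ b c)) := by ring
        _ = _ := by rw [hH]; ring
    · rw [le_div_iff₀ (by positivity)] at hδ4
      have : 0 < ε * s * |cross (b - a) (c - a)| := by positivity
      linarith
  · simp only [SatisfiesAdaptiveConstraint]
    rw [advance_self, advance_of_ne _ _ hab.symm, advance_of_ne _ _ hac.symm]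
    refine ⟨?_, ?_, ?_, c4⟩
    · rw [show τ a + δ - τ b = τ a - τ b + δ by ring]
      exact abs_add_le_of_nonpos c1 (by linarith) hδ hδ1
    · rw [show τ a + δ - (τ b + τ c) / 2 = τ a - (τ b + τ c) / 2 + δ by ring]
      exact abs_add_le_of_nonpos c2 (by linarith) hδ hδ2
    · rw [show τ a + δ - τ c = τ a - τ c + δ by ring]
      exact abs_add_le_of_nonpos c3 (by linarith) hδ hδ3

theorem exists_progress_left (hε0 : 0 < ε) (hεφ : ε < φ) (hφ : φ < (1 + ε) / 2) (hε : ε < 1)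
    (hs : 0 < s) {t : MarkedTriangle} (ht : t.Nondegenerate) :
    ∃ η > 0, ∀ (τ : Space 2 → ℝ) (δ : ℝ), IsProgressiveOn ε φ s τ t →
      (∀ q ∈ t.verts, τ t.left ≤ τ q) → 0 ≤ δ → δ ≤ η →
      IsProgressiveOn ε φ s (advance τ t.left δ) t := by
  classical
  obtain ⟨a, b, c⟩ := t
  have hnd : cross (b - a) (c - a) ≠ 0 := ht
  obtain ⟨hab, hac, hbc⟩ := ne_of_cross_ne_zero hnd
  have hA : 0 < |cross (b - a) (c - a)| := abs_pos.2 hnd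
  have hd : 0 < dist a c := dist_pos.2 hac
  have hφ1 : φ < 1 := by linarith
  have hcb : cross (a - b) (c - b) = -cross (b - a) (c - a) := by simp [cross]; ring
  have w1 : 0 < diminishedWidth ε φ (midpoint ℝ b c) c a := by
    refine diminishedWidth_pos hε hφ1 ?_
    have : cross (c - midpoint ℝ b c) (a - midpoint ℝ b c) = cross (b - a) (c - a) / 2 := by
      simp [cross, midpoint_apply]; ring
    rw [this]; positivity
  have w4 : 0 < diminishedWidth ε φ (midpoint ℝ a c) a (midpoint ℝ b c) := by
    refine diminishedWidth_pos hε hφ1 ?_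
    have : cross (a - midpoint ℝ a c) (midpoint ℝ b c - midpoint ℝ a c) =
        cross (b - a) (c - a) / 4 := by simp [cross, midpoint_apply]; ring
    rw [this]; positivity
  have wlt := sub_pos.2 (diminishedWidth_midpoint_lt hεφ hφ hnd)
  -- The second term is the strict slack between two diminished widths; it protects the inequality
  -- that involves the mean over the base.
  refine ⟨min (min (2 * diminishedWidth ε φ (midpoint ℝ b c) c a * s)
      ((diminishedWidth ε φ a b c - diminishedWidth ε φ (midpoint ℝ b c) a b) * s))
    (min (4 * diminishedWidth ε φ (midpoint ℝ a c) a (midpoint ℝ b c) * s)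
      (ε * s * |cross (b - a) (c - a)| / (2 * dist a c))), by positivity, ?_⟩
  rintro τ δ ⟨hg, c1, c2, c3, c4⟩ hmin hδ hδη
  simp only [le_min_iff] at hδη
  obtain ⟨⟨hδ1, hδ2⟩, hδ3, hδ4⟩ := hδη
  have ha := hmin a (apex_mem ⟨a, b, c⟩)
  have hc := hmin c (right_mem ⟨a, b, c⟩)
  dsimp only at c1 c2 c3 c4 ha hc
  have hverts : verts ⟨a, b, c⟩ = {b, a, c} := by
    rw [verts, Finset.insert_comm]
  refine ⟨?_, ?_⟩
  · rw [hverts] at hg ⊢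
    -- Here `x` is the end `a` of the opposite edge: the third inequality bounds the time difference
    -- along `ac` by the altitude of the midpoint of `bc` over `ab`.
    refine exists_gradient_advance_triangle (x := a) (β := (1 - ε) * s) ?_ ?_ ?_ hg ha hc hδ ?_
    · rwa [hcb, neg_ne_zero]
    · rw [hull, Finset.coe_pair, convexHull_pair]
      exact left_mem_segment ℝ a c
    · rw [hcb, abs_neg]
      have hH := infDist_midpoint_mul_dist a b c
      have hw : diminishedWidth ε φ (midpoint ℝ b c) a b ≤
          (1 - ε) * Metric.infDist (midpoint ℝ b c) (affineSpan ℝ {a, b}) := min_le_left _ _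
      calc |τ a - τ c| * dist b a
          ≤ 2 * ((1 - ε) * Metric.infDist (midpoint ℝ b c) (affineSpan ℝ {a, b})) * s *
              dist b a := by
            refine mul_le_mul_of_nonneg_right (c3.trans ?_) dist_nonneg
            gcongr
        _ = 2 * (1 - ε) * s * (Metric.infDist (midpoint ℝ b c) (affineSpan ℝ {a, b}) *
              dist a b) := by rw [dist_comm b a]; ring
        _ = _ := by rw [hH]; ring
    · rw [hcb, abs_neg]
      rw [le_div_iff₀ (by positivity)] at hδ4
      have : 0 < ε * s * |cross (b - a) (c - a)| := by positivity
      linarith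
  · simp only [SatisfiesAdaptiveConstraint]
    rw [advance_self, advance_of_ne _ _ hab, advance_of_ne _ _ hbc.symm]
    refine ⟨?_, ?_, c3, ?_⟩
    · rw [show τ a - (τ b + δ) = τ a - τ b - δ by ring]
      exact abs_sub_le_of_nonneg c1 (by linarith) hδ hδ1
    -- The upper bound is kept because the mean over the base rises. For the lower bound, `τ b ≤ τ
    -- a` bounds the old difference below by `(τ a - τ c) / 2`, so by the third inequality; the
    -- slack covers the change by `δ / 2`.
    · rw [abs_le] at c2 c3 ⊢
      constructor <;> linarith
    · rw [show τ b + δ - τ c = τ b - τ c + δ by ring]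
      exact abs_add_le_of_nonpos c4 (by linarith) hδ hδ3

theorem exists_progress_on (hε0 : 0 < ε) (hεφ : ε < φ) (hφ : φ < (1 + ε) / 2) (hε : ε < 1)
    (hs : 0 < s) {t : MarkedTriangle} (ht : t.Nondegenerate) :
    ∃ η > 0, ∀ (τ : Space 2 → ℝ) (p : Space 2) (δ : ℝ), IsProgressiveOn ε φ s τ t → p ∈ t.verts →
      (∀ q ∈ t.verts, τ p ≤ τ q) → 0 ≤ δ → δ ≤ η →
      IsProgressiveOn ε φ s (advance τ p δ) t := by
  obtain ⟨η₁, hη₁, h₁⟩ := exists_progress_apex hε0 hεφ (by linarith) hs ht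
  obtain ⟨η₂, hη₂, h₂⟩ := exists_progress_left hε0 hεφ hφ hε hs ht
  obtain ⟨η₃, hη₃, h₃⟩ := exists_progress_left hε0 hεφ hφ hε hs ht.swap
  refine ⟨min η₁ (min η₂ η₃), lt_min hη₁ (lt_min hη₂ hη₃), fun τ p δ hτ hp hmin hδ hδη => ?_⟩
  simp only [le_min_iff] at hδη
  rcases mem_verts.1 hp with rfl | rfl | rfl
  · exact h₁ τ δ hτ hmin hδ hδη.1
  · exact h₂ τ δ hτ hmin hδ hδη.2.1
  · rw [← isProgressiveOn_swap ht] at hτ ⊢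
    exact h₃ τ δ hτ (by rw [verts_swap]; exact hmin) hδ hδη.2.2

end Progress

/-! ### Fronts of the adaptive algorithm -/

/-- The vertex sets of the triangles of a triangulation. -/
def triangleSimplices (𝒯 : Finset MarkedTriangle) : Set (Finset (Space 2)) :=
  MarkedTriangle.verts '' (𝒯 : Set MarkedTriangle)

theorem verts_mem_triangleSimplices {𝒯 : Finset MarkedTriangle} {t : MarkedTriangle} (ht : t ∈ 𝒯) :
    t.verts ∈ triangleSimplices 𝒯 := ⟨t, ht, rfl⟩

/-- The front as a function on the whole space domain. -/
noncomputable def AdaptiveFront.value (F : AdaptiveFront) : Space 2 → ℝ :=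
  frontValue (triangleSimplices F.tri) F.time

theorem IsConformingTriangulation.triangleSimplices {𝒯 : Finset MarkedTriangle}
    (h : IsConformingTriangulation 𝒯) :
    ∀ σ ∈ triangleSimplices 𝒯, ∀ σ' ∈ triangleSimplices 𝒯,
      hull σ ∩ hull σ' ⊆ convexHull ℝ ((σ : Set (Space 2)) ∩ σ') := by
  rintro _ ⟨t, ht, rfl⟩ _ ⟨t', ht', rfl⟩
  exact (h t ht t' ht').subset

theorem AdaptiveFront.value_eq {F : AdaptiveFront} (h : IsConformingTriangulation F.tri)
    {t : MarkedTriangle} (ht : t ∈ F.tri) {A : Space 2 →ᵃ[ℝ] ℝ} (hA : ∀ v ∈ t.verts, A v = F.time v)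
    {x : Space 2} (hx : x ∈ hull t.verts) : F.value x = A x :=
  frontValue_eq h.triangleSimplices (verts_mem_triangleSimplices ht) hA hx

section AdaptiveInvariant

variable {K : Geometry.SimplicialComplex ℝ (Space 2)} {𝒯₀ : Finset MarkedTriangle}
  {ε φ κ s : ℝ} {F F' : AdaptiveFront}

theorem AdaptiveFront.value_vertex (hF : IsForest 𝒯₀) (hT : IsTriangulation K 𝒯₀ F.tri)
    {t : MarkedTriangle} (ht : t ∈ F.tri) {v : Space 2} (hv : v ∈ t.verts) :
    F.value v = F.time v :=
  frontValue_vertex hT.conforming.triangleSimplices (verts_mem_triangleSimplices ht)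
    (hT.nondegenerate hF ht).indep hv

namespace MarkedTriangle

theorem Nondegenerate.isGradient_of_affine {t c : MarkedTriangle} (ht : t.Nondegenerate)
    (hc : c.Nondegenerate) {A : Space 2 →ᵃ[ℝ] ℝ} {g : Space 2} (hg : IsGradient A c.verts g) :
    IsGradient A t.verts g := by
  have hspan : vectorSpan ℝ (t.verts : Set (Space 2)) = ⊤ := by
    have := ht.indep.vectorSpan_eq_top_of_card_eq_finrank_add_one (by simp [ht.card])
    simpa using this
  refine ⟨by rw [hspan]; trivial, ?_⟩
  let B : Space 2 →ᵃ[ℝ] ℝ := (innerSL ℝ g).toLinearMap.toAffineMap +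
    AffineMap.const ℝ (Space 2) (A c.apex - inner ℝ g c.apex)
  have hB : ∀ x, B x = inner ℝ g x + (A c.apex - inner ℝ g c.apex) := fun x => by simp [B]
  have hAB := hc.affine_eq (A := A) (B := B) fun v hv => by
    have := hg.2 c.apex c.apex_mem v hv
    rw [inner_sub_right] at this
    rw [hB]; linarith
  intro u _ v _
  rw [hAB, hAB, hB, hB, inner_sub_right]
  ring

/-- For affine times, being progressive does not depend on the level of subdivision. This carries
the invariant through refinement and coarsening alike. -/
theorem DescendsIn.isProgressiveOn_iff {n : ℕ} {t c : MarkedTriangle} (h : DescendsIn n t c)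
    (ht : t.Nondegenerate) (A : Space 2 →ᵃ[ℝ] ℝ) :
    IsProgressiveOn ε φ s A c ↔ IsProgressiveOn ε φ s A t := by
  rw [IsProgressiveOn, IsProgressiveOn, satisfiesAdaptiveConstraint_descendsIn ht h]
  refine and_congr_left' ⟨?_, ?_⟩
  · rintro ⟨g, hg, hgs⟩
    exact ⟨g, ht.isGradient_of_affine (ht.descendsIn h) hg, hgs⟩
  · rintro ⟨g, hg, hgs⟩
    exact ⟨g, (ht.descendsIn h).isGradient_of_affine ht hg, hgs⟩

end MarkedTriangle

theorem BisectedEdge.exists_base {𝒯 : Finset MarkedTriangle} {R : Set MarkedTriangle}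
    {e : Sym2 (Space 2)} (h : BisectedEdge 𝒯 R e) : ∃ t ∈ 𝒯, e = t.base := by
  cases h with
  | base ht _ => exact ⟨_, ht, rfl⟩
  | propagate ht _ _ => exact ⟨_, ht, rfl⟩

theorem IsRefinement.time_eq {R : Set MarkedTriangle} (h : IsRefinement F R F')
    {t q : MarkedTriangle} (ht : t ∈ F.tri)
    (hq : q ∈ t.subdivide {e | BisectedEdge F.tri R e}) {A : Space 2 →ᵃ[ℝ] ℝ}
    (hA : ∀ v ∈ t.verts, A v = F.time v) {v : Space 2} (hv : v ∈ q.verts) : A v = F'.time v := by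
  rcases subdivide_mem_verts hq hv with hvt | ⟨x, y, hxy, hM, rfl⟩
  · rw [h.2.1 t ht v hvt, hA v hvt]
  · obtain ⟨hx, hy⟩ := mem_verts_of_mk_mem_edges hxy
    rw [h.2.2 x y hM, affine_midpoint, hA x hx, hA y hy]

theorem exists_isRefinement (hF : IsForest 𝒯₀) (hT : IsTriangulation K 𝒯₀ F.tri)
    (R : Set MarkedTriangle) : ∃ F', IsRefinement F R F' := by
  -- The old front, as a function on the domain, supplies the times of the new vertices.
  refine ⟨⟨refineTriangulation F.tri R, F.value⟩, rfl,
    fun t ht v hv => AdaptiveFront.value_vertex hF hT ht hv, fun u v huv => ?_⟩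
  obtain ⟨t, ht, hbase⟩ := huv.exists_base
  obtain ⟨A, hA⟩ := exists_affine_interpolant (hT.nondegenerate hF ht).indep F.time
  have hmem : s(u, v) ∈ t.edges := mem_edges.2 (Or.inl hbase)
  obtain ⟨hu, hv⟩ := mem_verts_of_mk_mem_edges hmem
  have hmid : midpoint ℝ u v ∈ hull t.verts :=
    (convex_convexHull ℝ _).midpoint_mem (mem_hull hu) (mem_hull hv)
  change F.value (midpoint ℝ u v) = _
  rw [AdaptiveFront.value_eq hT.conforming ht hA hmid, affine_midpoint, hA u hu, hA v hv]

theorem IsRefinement.isTriangulation (hF : IsForest 𝒯₀) (hT : IsTriangulation K 𝒯₀ F.tri)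
    {R : Set MarkedTriangle} (h : IsRefinement F R F') : IsTriangulation K 𝒯₀ F'.tri := by
  rw [h.1]
  exact hT.refine hF R

theorem IsRefinement.value_eq (hF : IsForest 𝒯₀) (hT : IsTriangulation K 𝒯₀ F.tri)
    {R : Set MarkedTriangle} (h : IsRefinement F R F') {x : Space 2} (hx : x ∈ K.space) :
    F'.value x = F.value x := by
  have hT' := h.isTriangulation hF hT
  obtain ⟨t, ht, hxt⟩ := hT.cover x hx
  obtain ⟨q, hq, hxq⟩ := subdivide_cover (M := {e | BisectedEdge F.tri R e}) hxt
  obtain ⟨A, hA⟩ := exists_affine_interpolant (hT.nondegenerate hF ht).indep F.time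
  have hqF : q ∈ F'.tri := by
    rw [h.1]
    exact mem_refineTriangulation.2 ⟨t, ht, hq⟩
  rw [AdaptiveFront.value_eq hT.conforming ht hA hxt,
    AdaptiveFront.value_eq hT'.conforming hqF (fun v hv => h.time_eq ht hq hA hv) hxq]

theorem IsRefinement.isAdaptivelyProgressive (hF : IsForest 𝒯₀) (hT : IsTriangulation K 𝒯₀ F.tri)
    (hP : IsAdaptivelyProgressive ε φ s F.tri F.time) {R : Set MarkedTriangle}
    (h : IsRefinement F R F') : IsAdaptivelyProgressive ε φ s F'.tri F'.time := by
  intro q hq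
  rw [h.1] at hq
  obtain ⟨t, ht, hqt⟩ := mem_refineTriangulation.1 hq
  obtain ⟨A, hA⟩ := exists_affine_interpolant (hT.nondegenerate hF ht).indep F.time
  obtain ⟨k, hk⟩ := subdivide_exists_descendsIn hqt
  have h1 : IsProgressiveOn ε φ s A t :=
    IsProgressiveOn.congr (hP t ht) fun v hv => (hA v hv).symm
  exact ((hk.isProgressiveOn_iff (hT.nondegenerate hF ht) A).2 h1).congr
    fun v hv => h.time_eq ht hqt hA hv

theorem IsCoarsening.isAdaptivelyProgressive (hF : IsForest 𝒯₀) {𝒯 𝒯' : Finset MarkedTriangle}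
    (hT : IsTriangulation K 𝒯₀ 𝒯) {τ : Space 2 → ℝ} (hP : IsAdaptivelyProgressive ε φ s 𝒯 τ)
    (h : IsCoarsening 𝒯₀ 𝒯 τ 𝒯') : IsAdaptivelyProgressive ε φ s 𝒯' τ := by
  intro t' ht'
  obtain ⟨A, hA', hA⟩ := h.2.2.2.2 t' ht'
  obtain ⟨t, ht, hd⟩ := h.2.2.2.1 t' ht'
  obtain ⟨k, hk⟩ := hd.exists_descendsIn
  have h1 : IsProgressiveOn ε φ s A t := IsProgressiveOn.congr (hP t ht) (hA t ht hd)
  exact ((hk.isProgressiveOn_iff ((hT.coarsen h).nondegenerate hF ht') A).1 h1).congr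
    fun v hv => (hA' v hv).symm

/-- The invariant of the adaptive algorithm. -/
structure AdaptiveFront.IsValid (K : Geometry.SimplicialComplex ℝ (Space 2))
    (𝒯₀ : Finset MarkedTriangle) (ε φ s : ℝ) (F : AdaptiveFront) : Prop where
  triangulation : IsTriangulation K 𝒯₀ F.tri
  progressive : IsAdaptivelyProgressive ε φ s F.tri F.time

theorem AdaptiveStep.isValid (hF : IsForest 𝒯₀) (hV : F.IsValid K 𝒯₀ ε φ s)
    {accepts : Finset (SpaceTime 2) → Prop} {p : Space 2} {new : Set (Finset (SpaceTime 2))}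
    (h : AdaptiveStep 𝒯₀ accepts ε φ κ s F p new F') : F'.IsValid K 𝒯₀ ε φ s := by
  obtain ⟨δ, hδ, ⟨-, -, htime, hc⟩ | ⟨-, -, hr⟩⟩ := h
  · refine ⟨hV.triangulation.coarsen hc, ?_⟩
    refine IsCoarsening.isAdaptivelyProgressive hF hV.triangulation ?_ hc
    rw [htime]
    exact hδ.progressive
  · exact ⟨hr.isTriangulation hF hV.triangulation,
      hr.isAdaptivelyProgressive hF hV.triangulation hV.progressive⟩

theorem isValid_init (hK : IsSpaceMesh K) (hM : IsMarking K 𝒯₀) (hε : ε < 1) (hφ : φ < 1)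
    (hs : 0 < s) : AdaptiveFront.IsValid K 𝒯₀ ε φ s ⟨𝒯₀, fun _ => 0⟩ := by
  refine ⟨hM.isTriangulation hK, fun t ht => ⟨⟨0, isGradient_zero _, by simpa using hs⟩, ?_⟩⟩
  have hw : ∀ a b c : Space 2, 0 ≤ diminishedWidth ε φ a b c := by
    intro a b c
    have h1 : 0 ≤ 1 - ε := by linarith
    have h2 : 0 ≤ 1 - φ := by linarith
    exact le_min (mul_nonneg h1 Metric.infDist_nonneg) (le_min
      (mul_nonneg h2 Metric.infDist_nonneg) (mul_nonneg h2 Metric.infDist_nonneg))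
  simp only [SatisfiesAdaptiveConstraint, sub_self, add_zero, zero_div, abs_zero]
  have hw2 : ∀ k : ℝ, 0 ≤ k → ∀ a b c : Space 2, 0 ≤ k * diminishedWidth ε φ a b c * s :=
    fun k hk a b c => mul_nonneg (mul_nonneg hk (hw a b c)) hs.le
  exact ⟨hw2 2 (by norm_num) _ _ _, mul_nonneg (hw _ _ _) hs.le, hw2 2 (by norm_num) _ _ _,
    hw2 4 (by norm_num) _ _ _⟩

theorem IsReachableAdaptiveFront.isValid (hK : IsSpaceMesh K) (hM : IsMarking K 𝒯₀) (hε : ε < 1)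
    (hφ : φ < 1) (hs : 0 < s) (h : IsReachableAdaptiveFront 𝒯₀ ε φ κ s F) :
    F.IsValid K 𝒯₀ ε φ s := by
  induction h with
  | refl => exact isValid_init hK hM hε hφ hs
  | tail _ hstep ih =>
    obtain ⟨accepts, p, new, hstep⟩ := hstep
    exact hstep.isValid hM.isForest ih

theorem AdaptiveFront.exists_isLocalMin (hne : F.tri.Nonempty) : ∃ p, F.IsLocalMin p := by
  classical
  obtain ⟨t, ht⟩ := hne
  obtain ⟨p, hp, hmin⟩ := Finset.exists_min_image (F.tri.biUnion MarkedTriangle.verts) F.time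
    ⟨t.apex, Finset.mem_biUnion.2 ⟨t, ht, t.apex_mem⟩⟩
  exact ⟨p, by simpa using hp, fun t ht _ q hq => hmin q (Finset.mem_biUnion.2 ⟨t, ht, hq⟩)⟩

theorem AdaptiveFront.IsValid.exists_isLocalMin (hV : F.IsValid K 𝒯₀ ε φ s)
    (hK : IsSpaceMesh K) : ∃ p, F.IsLocalMin p := by
  obtain ⟨x, hx⟩ := hK.connected.nonempty
  obtain ⟨t, ht, -⟩ := hV.triangulation.cover x hx
  exact AdaptiveFront.exists_isLocalMin ⟨t, ht⟩

/-- The admissible progress depends on the triangle but not on the times, so finitely many triangles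
share one. For a single step `𝒟` is the current triangulation, for bounds on entire runs it is the
set of all triangles of bounded generation. -/
theorem exists_uniform_adaptive_progress (hε0 : 0 < ε) (hεφ : ε < φ) (hφ : φ < (1 + ε) / 2)
    (hε : ε < 1) (hs : 0 < s) {𝒟 : Set MarkedTriangle} (h𝒟 : 𝒟.Finite)
    (hnd : ∀ t ∈ 𝒟, t.Nondegenerate) :
    ∃ η > 0, ∀ F : AdaptiveFront, ↑F.tri ⊆ 𝒟 → IsAdaptivelyProgressive ε φ s F.tri F.time →
      ∀ p, F.IsLocalMin p → IsAdaptivelyProgressive ε φ s F.tri (advance F.time p η) := by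
  choose! η hη hadv using fun t (ht : t ∈ 𝒟) => exists_progress_on hε0 hεφ hφ hε hs (hnd t ht)
  obtain ⟨θ, hθ, hθη⟩ := exists_pos_le_of_finite h𝒟 η hη
  refine ⟨θ, hθ, fun F hF𝒟 hF p hp t ht => ?_⟩
  by_cases hpt : p ∈ t.verts
  · exact hadv t (hF𝒟 ht) F.time p θ (hF t ht) hpt (hp.2 t ht hpt) hθ.le (hθη t (hF𝒟 ht))
  · exact IsProgressiveOn.congr (hF t ht) fun v hv =>
      (advance_of_ne F.time θ (ne_of_mem_of_not_mem hv hpt)).symm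

theorem AdaptiveFront.IsValid.exists_pitch (hF : IsForest 𝒯₀) (hV : F.IsValid K 𝒯₀ ε φ s)
    (hε0 : 0 < ε) (hεφ : ε < φ) (hφ : φ < (1 + ε) / 2) (hε : ε < 1) (hκ0 : 0 < κ) (hκ : κ < 1)
    (hs : 0 < s) {p : Space 2} (hp : F.IsLocalMin p) : ∃ δ, IsAdaptivePitch ε φ κ s F p δ := by
  obtain ⟨η, hη, hadv⟩ := exists_uniform_adaptive_progress hε0 hεφ hφ hε hs
    F.tri.finite_toSet fun t ht => hV.triangulation.nondegenerate hF ht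
  obtain ⟨t, ht, hpt⟩ := hp.1
  have hcard := (hV.triangulation.nondegenerate hF ht).card
  obtain ⟨q, hq, hqp⟩ : ∃ q ∈ t.verts, q ≠ p := by
    by_contra hcon
    push Not at hcon
    have : t.verts.card ≤ ({p} : Finset (Space 2)).card :=
      Finset.card_le_card fun v hv => Finset.mem_singleton.2 (hcon v hv)
    simp [hcard] at this
  obtain ⟨δ, hδ, hpos, hmax⟩ := exists_pos_near_max
    (Adm := {δ | IsAdaptivelyProgressive ε φ s F.tri (advance F.time p δ)})
    (B := F.time q - F.time p + s * dist q p) hη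
    (hadv F subset_rfl hV.progressive p hp) (by
      intro δ hδ
      obtain ⟨⟨g, hg, hgs⟩, -⟩ := hδ t ht
      have h1 := hg.abs_sub_le hq hpt
      rw [advance_self, advance_of_ne _ _ hqp] at h1
      have h2 : ‖g‖ * dist q p ≤ s * dist q p := mul_le_mul_of_nonneg_right hgs.le dist_nonneg
      linarith [le_abs_self (F.time p + δ - F.time q)]) hκ0 hκ
  exact ⟨δ, hp, hpos, hδ, hmax⟩

theorem AdaptiveFront.IsValid.exists_step (hF : IsForest 𝒯₀) (hV : F.IsValid K 𝒯₀ ε φ s)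
    (hε0 : 0 < ε) (hεφ : ε < φ) (hφ : φ < (1 + ε) / 2) (hε : ε < 1) (hκ0 : 0 < κ) (hκ : κ < 1)
    (hs : 0 < s) (accepts : Finset (SpaceTime 2) → Prop) {p : Space 2} (hp : F.IsLocalMin p) :
    ∃ new F', AdaptiveStep 𝒯₀ accepts ε φ κ s F p new F' := by
  obtain ⟨δ, hδ⟩ := hV.exists_pitch hF hε0 hεφ hφ hε hκ0 hκ hs hp
  by_cases hacc : ∀ e ∈ F.patch p δ, accepts e
  · exact ⟨F.patch p δ, ⟨F.tri, advance F.time p δ⟩, δ, hδ, Or.inl ⟨hacc, rfl, rfl,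
      hV.triangulation.isCoarsening_self hF _⟩⟩
  · push Not at hacc
    obtain ⟨F', hF'⟩ := exists_isRefinement hF hV.triangulation
      {t | t ∈ F.tri ∧ p ∈ t.verts ∧ ¬ accepts (tentElement F.time p δ t.verts)}
    exact ⟨∅, F', δ, hδ, Or.inr ⟨hacc, rfl, hF'⟩⟩

theorem exists_adaptiveRun (hK : IsSpaceMesh K) (hM : IsMarking K 𝒯₀) (hε0 : 0 < ε) (hεφ : ε < φ)
    (hφ : φ < (1 + ε) / 2) (hε : ε < 1) (hκ0 : 0 < κ) (hκ : κ < 1) (hs : 0 < s)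
    (accepts : ℕ → Finset (SpaceTime 2) → Prop) :
    ∃ F new, IsAdaptiveRun 𝒯₀ accepts ε φ κ s F new := by
  have key : ∀ (i : ℕ) (F : {F : AdaptiveFront // F.IsValid K 𝒯₀ ε φ s}),
      ∃ (F' : {F : AdaptiveFront // F.IsValid K 𝒯₀ ε φ s}) (new : Set (Finset (SpaceTime 2))),
        ∃ p, AdaptiveStep 𝒯₀ (accepts i) ε φ κ s F p new F' := by
    rintro i ⟨F, hV⟩
    obtain ⟨p, hp⟩ := hV.exists_isLocalMin hK
    obtain ⟨new, F', h⟩ := hV.exists_step hM.isForest hε0 hεφ hφ hε hκ0 hκ hs (accepts i) hp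
    exact ⟨⟨F', h.isValid hM.isForest hV⟩, new, p, h⟩
  choose next new hstep using key
  let G : ℕ → {F : AdaptiveFront // F.IsValid K 𝒯₀ ε φ s} := fun n =>
    Nat.rec ⟨⟨𝒯₀, fun _ => 0⟩, isValid_init hK hM hε (by linarith) hs⟩ (fun i F => next i F) n
  exact ⟨fun i => (G i).1, fun i => new i (G i), rfl, fun i => hstep i (G i)⟩

theorem IsAdaptiveRun.isValid (hK : IsSpaceMesh K) (hM : IsMarking K 𝒯₀) (hε : ε < 1) (hφ : φ < 1)
    (hs : 0 < s) {accepts : ℕ → Finset (SpaceTime 2) → Prop} {F : ℕ → AdaptiveFront}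
    {new : ℕ → Set (Finset (SpaceTime 2))} (h : IsAdaptiveRun 𝒯₀ accepts ε φ κ s F new) (i : ℕ) :
    (F i).IsValid K 𝒯₀ ε φ s := by
  induction i with
  | zero => rw [h.init]; exact isValid_init hK hM hε hφ hs
  | succ i ih =>
    obtain ⟨p, hp⟩ := h.step i
    exact hp.isValid hM.isForest ih

end AdaptiveInvariant

/-! ### Runs of the adaptive algorithm -/

section AdaptiveRuns

variable {K : Geometry.SimplicialComplex ℝ (Space 2)} {𝒯₀ : Finset MarkedTriangle}
  {ε φ κ s : ℝ}

theorem IsMarking.exists_hull_subset (hM : IsMarking K 𝒯₀) {n : ℕ} {t : MarkedTriangle}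
    (ht : HasGeneration 𝒯₀ n t) : ∃ ρ ∈ K.faces, hull t.verts ⊆ hull ρ := by
  obtain ⟨r, hr, hd⟩ := ht
  exact ⟨r.verts, (hM.1 r hr).1, hd.hull_subset⟩

theorem IsTriangulation.iUnion_hull (hM : IsMarking K 𝒯₀) {𝒯 : Finset MarkedTriangle}
    (hT : IsTriangulation K 𝒯₀ 𝒯) : ⋃ σ ∈ triangleSimplices 𝒯, hull σ = K.space := by
  apply Subset.antisymm
  · refine iUnion₂_subset ?_
    rintro _ ⟨t, ht, rfl⟩
    obtain ⟨n, hn⟩ := hT.generation t ht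
    obtain ⟨ρ, hρ, hsub⟩ := hM.exists_hull_subset hn
    exact hsub.trans (K.convexHull_subset_space hρ)
  · intro x hx
    obtain ⟨t, ht, hxt⟩ := hT.cover x hx
    exact mem_biUnion (verts_mem_triangleSimplices ht) hxt

/-- A refinement does not change the front as a function and counts as an idle step. After an
accepted tent, each old triangle lies in a triangle of the coarsened mesh on which the new front is
affine. -/
theorem IsAdaptiveRun.isFrontSequence (hK : IsSpaceMesh K) (hM : IsMarking K 𝒯₀)
    (hε : ε < 1) (hφ : φ < 1) (hs : 0 < s) {accepts : ℕ → Finset (SpaceTime 2) → Prop}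
    {F : ℕ → AdaptiveFront} {new : ℕ → Set (Finset (SpaceTime 2))}
    (hrun : IsAdaptiveRun 𝒯₀ accepts ε φ κ s F new) {p : ℕ → Space 2} {δ : ℕ → ℝ}
    (hstep : ∀ i, IsAdaptivePitch ε φ κ s (F i) (p i) (δ i) ∧
      (((∀ e ∈ (F i).patch (p i) (δ i), accepts i e) ∧ new i = (F i).patch (p i) (δ i) ∧
        (F (i + 1)).time = advance (F i).time (p i) (δ i) ∧
        IsCoarsening 𝒯₀ (F i).tri (F (i + 1)).time (F (i + 1)).tri) ∨
      ((∃ e ∈ (F i).patch (p i) (δ i), ¬ accepts i e) ∧ new i = ∅ ∧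
        IsRefinement (F i) {t | t ∈ (F i).tri ∧ p i ∈ t.verts ∧
          ¬ accepts i (tentElement (F i).time (p i) (δ i) t.verts)} (F (i + 1))))) :
    IsFrontSequence K (fun i => triangleSimplices (F i).tri) (fun i => (F i).value) p δ new := by
  have hF := hM.isForest
  have hT : ∀ i, IsTriangulation K 𝒯₀ (F i).tri :=
    fun i => (hrun.isValid hK hM hε hφ hs i).triangulation
  have hnd : ∀ i, ∀ t ∈ (F i).tri, t.Nondegenerate := fun i t ht => (hT i).nondegenerate hF ht
  refine ⟨?_, ?_, ?_, ?_, ?_, ?_, ?_, ?_, ?_⟩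
  · rintro i _ ⟨t, ht, rfl⟩
    exact (hnd i t ht).card
  · rintro i _ ⟨t, ht, rfl⟩
    exact (hnd i t ht).indep
  · rintro i _ ⟨t, ht, rfl⟩
    obtain ⟨n, hn⟩ := (hT i).generation t ht
    exact hM.exists_hull_subset hn
  · intro i x hx
    obtain ⟨t, ht, hxt⟩ := (hT i).cover x hx
    exact ⟨_, verts_mem_triangleSimplices ht, hxt⟩
  · exact fun i => (hT i).conforming.triangleSimplices
  · rintro i j _ ⟨t, ht, rfl⟩ _ ⟨t', ht', rfl⟩ a ha b hb
    obtain ⟨n, hn⟩ := (hT i).generation t ht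
    obtain ⟨n', hn'⟩ := (hT j).generation t' ht'
    exact hF.exists_inter hn hn' ha hb
  · rintro i _ ⟨t, ht, rfl⟩
    obtain ⟨A, hA⟩ := exists_affine_interpolant (hnd i t ht).indep (F i).time
    exact ⟨A, fun x hx => AdaptiveFront.value_eq (hT i).conforming ht hA hx⟩
  · intro x hx
    obtain ⟨t, ht, hxt⟩ := (hT 0).cover x hx
    have h0 : ∀ v ∈ t.verts, (AffineMap.const ℝ (Space 2) (0 : ℝ)) v = (F 0).time v := by
      intro v _
      rw [hrun.init]; rfl
    exact AdaptiveFront.value_eq (hT 0).conforming ht h0 hxt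
  · intro i
    obtain ⟨hpitch, ⟨-, hnew, htime, hc⟩ | ⟨-, hnew, hr⟩⟩ := hstep i
    · right
      have hval : ∀ t ∈ (F i).tri, ∀ v ∈ t.verts, (F i).value v = (F i).time v :=
        fun t ht v hv => AdaptiveFront.value_vertex hF (hT i) ht hv
      refine ⟨hpitch.pos, ?_, ?_⟩
      · rw [hnew]
        ext e
        constructor
        · rintro ⟨t, ht, hpt, rfl⟩
          exact ⟨t.verts, verts_mem_triangleSimplices ht, hpt,
            tentElement_congr hpt fun v hv => (hval t ht v hv).symm⟩
        · rintro ⟨_, ⟨t, ht, rfl⟩, hpt, rfl⟩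
          exact ⟨t, ht, hpt, tentElement_congr hpt (hval t ht)⟩
      · rintro _ ⟨t, ht, rfl⟩
        obtain ⟨t', ht', hd⟩ := hc.2.2.1 t ht
        obtain ⟨A, hA', hA⟩ := hc.2.2.2.2 t' ht'
        obtain ⟨k, hk⟩ := hd.exists_descendsIn
        have hval' : ∀ x ∈ hull t.verts, (F (i + 1)).value x = A x := fun x hx =>
          AdaptiveFront.value_eq (hT (i + 1)).conforming ht' (fun v hv => (hA' v hv).symm)
            (hk.hull_subset hx)
        refine ⟨fun v hv => ?_, A, hval'⟩
        rw [hval' v (mem_hull hv), ← hA t ht hd v hv, htime]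
        by_cases hvp : v = p i
        · rw [hvp, advance_self, advance_self, hval t ht (p i) (hvp ▸ hv)]
        · rw [advance_of_ne _ _ hvp, advance_of_ne _ _ hvp, hval t ht v hv]
    · left
      exact ⟨hnew, fun x hx => hr.value_eq hF (hT i) hx⟩

theorem IsAdaptiveRun.exists_steps {accepts : ℕ → Finset (SpaceTime 2) → Prop}
    {F : ℕ → AdaptiveFront} {new : ℕ → Set (Finset (SpaceTime 2))}
    (hrun : IsAdaptiveRun 𝒯₀ accepts ε φ κ s F new) : ∃ (p : ℕ → Space 2) (δ : ℕ → ℝ),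
    ∀ i, IsAdaptivePitch ε φ κ s (F i) (p i) (δ i) ∧
      (((∀ e ∈ (F i).patch (p i) (δ i), accepts i e) ∧ new i = (F i).patch (p i) (δ i) ∧
        (F (i + 1)).time = advance (F i).time (p i) (δ i) ∧
        IsCoarsening 𝒯₀ (F i).tri (F (i + 1)).time (F (i + 1)).tri) ∨
      ((∃ e ∈ (F i).patch (p i) (δ i), ¬ accepts i e) ∧ new i = ∅ ∧
        IsRefinement (F i) {t | t ∈ (F i).tri ∧ p i ∈ t.verts ∧
          ¬ accepts i (tentElement (F i).time (p i) (δ i) t.verts)} (F (i + 1)))) := by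
  choose p δ h using hrun.step
  exact ⟨p, δ, h⟩

theorem exists_gradient_advance_value (hF : IsForest 𝒯₀) {F : AdaptiveFront}
    (hT : IsTriangulation K 𝒯₀ F.tri) {p : Space 2} {δ : ℝ}
    (hpitch : IsAdaptivePitch ε φ κ s F p δ) :
    ∀ σ ∈ triangleSimplices F.tri, ∃ g, IsGradient (advance F.value p δ) σ g ∧ ‖g‖ < s := by
  rintro _ ⟨t, ht, rfl⟩
  obtain ⟨⟨g, hg, hgs⟩, -⟩ := hpitch.progressive t ht
  refine ⟨g, hg.congr fun v hv => ?_, hgs⟩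
  by_cases hvp : v = p
  · rw [hvp, advance_self, advance_self, AdaptiveFront.value_vertex hF hT ht (hvp ▸ hv)]
  · rw [advance_of_ne _ _ hvp, advance_of_ne _ _ hvp, AdaptiveFront.value_vertex hF hT ht hv]

theorem IsAdaptiveRun.accepted {accepts : ℕ → Finset (SpaceTime 2) → Prop}
    {F : ℕ → AdaptiveFront} {new : ℕ → Set (Finset (SpaceTime 2))}
    (hrun : IsAdaptiveRun 𝒯₀ accepts ε φ κ s F new) {i : ℕ} {e : Finset (SpaceTime 2)}
    (he : e ∈ new i) : accepts i e := by
  obtain ⟨p, δ, -, ⟨hacc, hnew, -⟩ | ⟨-, hnew, -⟩⟩ := hrun.step i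
  · exact hacc e (hnew ▸ he)
  · rw [hnew] at he
    exact absurd he (notMem_empty e)

/-- A bound for the diameter of an element in terms of the size of the triangle below it. -/
theorem spacetimeDiam_tentElement_le {F : AdaptiveFront}
    (hP : IsAdaptivelyProgressive ε φ s F.tri F.time) {p : Space 2} {δ : ℝ}
    (hpitch : IsAdaptivePitch ε φ κ s F p δ) {t : MarkedTriangle} (ht : t ∈ F.tri)
    (hnd : t.Nondegenerate) (hpt : p ∈ t.verts) (hs : 0 < s) {X : ℝ} (hX : EdgeBound X t) :
    spacetimeDiam (tentElement F.time p δ t.verts) ≤ 4 * ((1 + 2 * s) * X) := by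
  have hX0 : 0 ≤ X := dist_nonneg.trans hX.left
  have hold : ∀ u ∈ t.verts, ∀ v ∈ t.verts, |F.time u - F.time v| ≤ 2 * s * X := by
    intro u hu v hv
    obtain ⟨⟨g, hg, hgs⟩, -⟩ := hP t ht
    refine (hg.abs_sub_le hv hu).trans ?_
    have := hX.dist_le hv hu
    calc ‖g‖ * dist v u ≤ s * (2 * X) := mul_le_mul hgs.le this dist_nonneg hs.le
      _ = _ := by ring
  -- A vertex `q` that keeps its time relates the raised vertex to the others, through the gradient
  -- of the new front.
  obtain ⟨q, hq, hqp⟩ : ∃ q ∈ t.verts, q ≠ p := by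
    by_contra hcon
    push Not at hcon
    have : t.verts.card ≤ ({p} : Finset (Space 2)).card :=
      Finset.card_le_card fun v hv => Finset.mem_singleton.2 (hcon v hv)
    simp [hnd.card] at this
  have hnew : |F.time p + δ - F.time q| ≤ 2 * s * X := by
    obtain ⟨⟨g, hg, hgs⟩, -⟩ := hpitch.progressive t ht
    have h1 := hg.abs_sub_le hq hpt
    rw [advance_self, advance_of_ne _ _ hqp] at h1
    refine h1.trans ?_
    have := hX.dist_le hq hpt
    calc ‖g‖ * dist q p ≤ s * (2 * X) := mul_le_mul hgs.le this dist_nonneg hs.le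
      _ = _ := by ring
  have htop : ∀ v ∈ t.verts, |F.time p + δ - F.time v| ≤ 4 * s * X := by
    intro v hv
    have := abs_sub_le (F.time p + δ) (F.time q) (F.time v)
    have := hold q hq v hv
    linarith
  have hvert : ∀ P ∈ tentElement F.time p δ t.verts, ∀ Q ∈ tentElement F.time p δ t.verts,
      dist P Q ≤ 2 * ((1 + 2 * s) * X) := by
    intro P hP Q hQ
    have e1 : 0 ≤ s * X := by positivity
    rw [Prod.dist_eq, max_le_iff]
    rcases mem_tentElement.1 hP with rfl | ⟨u, hu, rfl⟩ <;>
      rcases mem_tentElement.1 hQ with rfl | ⟨v, hv, rfl⟩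
    · simp only [dist_self]; constructor <;> positivity
    · refine ⟨(hX.dist_le hpt hv).trans (by linarith), ?_⟩
      rw [Real.dist_eq]
      exact (htop v hv).trans (by linarith)
    · refine ⟨(hX.dist_le hu hpt).trans (by linarith), ?_⟩
      rw [dist_comm, Real.dist_eq]
      exact (htop u hu).trans (by linarith)
    · refine ⟨(hX.dist_le hu hv).trans (by linarith), ?_⟩
      rw [Real.dist_eq]
      exact (hold u hu v hv).trans (by linarith)
  refine Metric.diam_le_of_forall_dist_le (by positivity) ?_
  rintro _ ⟨P, hP, rfl⟩ _ ⟨Q, hQ, rfl⟩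
  obtain ⟨P', hP', Q', hQ', hle⟩ := convexHull_exists_dist_ge2 hP hQ
  have hPQ := hle.trans (hvert P' hP' Q' hQ')
  rw [Prod.dist_eq, max_le_iff] at hPQ
  -- The estimate so far is for the maximum metric; the Euclidean one is larger by at most `√2`,
  -- here replaced by 2.
  rw [WithLp.prod_dist_eq_of_L2]
  refine Real.sqrt_le_iff.2 ⟨by positivity, ?_⟩
  have h1 : dist P.1 Q.1 ^ 2 ≤ (2 * ((1 + 2 * s) * X)) ^ 2 :=
    pow_le_pow_left₀ dist_nonneg hPQ.1 2
  have h2 : dist P.2 Q.2 ^ 2 ≤ (2 * ((1 + 2 * s) * X)) ^ 2 :=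
    pow_le_pow_left₀ dist_nonneg hPQ.2 2
  change dist P.1 Q.1 ^ 2 + dist P.2 Q.2 ^ 2 ≤ _
  nlinarith [sq_nonneg ((1 + 2 * s) * X)]

theorem exists_edgeBound_of_finset (𝒯₀ : Finset MarkedTriangle) :
    ∃ X > 0, ∀ r ∈ 𝒯₀, EdgeBound X r := by
  choose Y hY hb using exists_edgeBound
  obtain ⟨X, hX, hle⟩ := exists_upper_bound_of_finite 𝒯₀.finite_toSet Y
  refine ⟨X, hX, fun r hr => ?_⟩
  have := hle r hr
  exact ⟨(hb r).left.trans this, (hb r).right.trans this, (hb r).base.trans (by linarith)⟩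

/-- If small elements are accepted, then only triangles of bounded generation are rejected, so the
generations of all triangles of all fronts are bounded. -/
theorem exists_generation_bound (hK : IsSpaceMesh K) (hM : IsMarking K 𝒯₀) (hε : ε < 1)
    (hφ : φ < 1) (hs : 0 < s) {μ : ℝ} (hμ : 0 < μ) :
    ∃ N, ∀ accepts : ℕ → Finset (SpaceTime 2) → Prop, AcceptsSmall accepts μ →
      ∀ F new, IsAdaptiveRun 𝒯₀ accepts ε φ κ s F new → ∀ i, GenerationLE 𝒯₀ N (F i).tri := by
  have hF := hM.isForest
  obtain ⟨X, hX, hbound⟩ := exists_edgeBound_of_finset 𝒯₀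
  -- After `2 * (N + 1)` bisections all elements are smaller than `μ`, so only triangles of
  -- generation at most `2 * N + 1` are rejected, and generations stay within `2 * N + 2`.
  obtain ⟨N, hN⟩ : ∃ N : ℕ, 4 * ((1 + 2 * s) * (X / 2 ^ (N + 1))) < μ := by
    obtain ⟨N, hN⟩ := pow_unbounded_of_one_lt (4 * ((1 + 2 * s) * X) / μ) (one_lt_two (α := ℝ))
    refine ⟨N, ?_⟩
    rw [div_lt_iff₀ hμ] at hN
    have h2 : (2 : ℝ) ^ N ≤ 2 ^ (N + 1) := pow_le_pow_right₀ one_le_two (Nat.le_succ N)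
    rw [← mul_div_assoc, ← mul_div_assoc, div_lt_iff₀ (by positivity)]
    nlinarith
  refine ⟨2 * N + 2, fun accepts hacc F new hrun i => ?_⟩
  induction i with
  | zero =>
    rw [hrun.init]
    intro t ht n hn
    rw [hF.generation_unique hn ⟨t, ht, .refl t⟩]
    omega
  | succ i ih =>
    have hV := hrun.isValid hK hM hε hφ hs i
    obtain ⟨p, δ, hpitch, ⟨-, -, -, hc⟩ | ⟨-, -, hr⟩⟩ := hrun.step i
    · exact IsTriangulation.coarsen_generationLE ih hc
    · rw [hr.1]
      refine hV.triangulation.refine_generationLE hF ih ?_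
      rintro t ht ⟨-, hpt, hrej⟩ n ⟨r, hr, hrt⟩
      by_contra hcon
      have hnd := hV.triangulation.nondegenerate hF ht
      refine hrej (hacc i _ ?_ ?_ ?_)
      · rw [tentElement_card hpitch.pos, hnd.card]
      · exact tentElement_affineIndependent hpitch.pos hpt hnd.indep
      · exact (spacetimeDiam_tentElement_le hV.progressive hpitch ht hnd hpt hs
          ((hbound r hr).descendsIn (N + 1) (by omega) hrt)).trans_lt hN

/-- Rejections without end would enlarge the set of ancestors in every iteration, inside a finite
set. Coarsening may shrink it, but happens only after an accepted tent. -/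
theorem IsAdaptiveRun.exists_accepted (hK : IsSpaceMesh K) (hM : IsMarking K 𝒯₀) (hε : ε < 1)
    (hφ : φ < 1) (hs : 0 < s) {accepts : ℕ → Finset (SpaceTime 2) → Prop} {F : ℕ → AdaptiveFront}
    {new : ℕ → Set (Finset (SpaceTime 2))} (hrun : IsAdaptiveRun 𝒯₀ accepts ε φ κ s F new) {N : ℕ}
    (hN : ∀ i, GenerationLE 𝒯₀ N (F i).tri) (n : ℕ) : ∃ i ≥ n, (new i).Nonempty := by
  by_contra hcon
  push Not at hcon
  have hss : ∀ i ≥ n, ancestors 𝒯₀ N (F i).tri ⊂ ancestors 𝒯₀ N (F (i + 1)).tri := by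
    intro i hi
    have hT := (hrun.isValid hK hM hε hφ hs i).triangulation
    obtain ⟨p, δ, hpitch, ⟨-, hnew, -⟩ | ⟨⟨e, ⟨t, ht, hpt, rfl⟩, hrej⟩, -, hr⟩⟩ := hrun.step i
    -- A local minimum lies in some triangle, so an accepted tent is never empty.
    · obtain ⟨t, ht, hpt⟩ := hpitch.localMin.1
      have : tentElement (F i).time p δ t.verts ∈ new i := hnew ▸ ⟨t, ht, hpt, rfl⟩
      rw [hcon i hi] at this
      exact absurd this (notMem_empty _)
    · have hN' := hN (i + 1)
      rw [hr.1] at hN' ⊢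
      exact hT.ancestors_ssubset hM.isForest hN' ht ⟨ht, hpt, hrej⟩
  have hcard : ∀ j, j ≤ (ancestors 𝒯₀ N (F (n + j)).tri).ncard := by
    intro j
    induction j with
    | zero => exact Nat.zero_le _
    | succ j ih =>
      have := ncard_lt_ncard (hss (n + j) (by omega)) (ancestors_finite _ _ _)
      rw [← add_assoc]
      omega
  have hle : ∀ 𝒯, (ancestors 𝒯₀ N 𝒯).ncard ≤ {t | ∃ n ≤ N, HasGeneration 𝒯₀ n t}.ncard :=
    fun 𝒯 => ncard_le_ncard (fun _ h => h.1) (finite_hasGeneration 𝒯₀ N)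
  have h1 := hcard ({t | ∃ n ≤ N, HasGeneration 𝒯₀ n t}.ncard + 1)
  have h2 := hle (F (n + ({t | ∃ n ≤ N, HasGeneration 𝒯₀ n t}.ncard + 1))).tri
  omega

theorem IsAdaptiveRun.isSimplicialFamily (hK : IsSpaceMesh K) (hM : IsMarking K 𝒯₀)
    (hε : ε < 1) (hφ : φ < 1) (hs : 0 < s) {accepts : ℕ → Finset (SpaceTime 2) → Prop}
    {F : ℕ → AdaptiveFront} {new : ℕ → Set (Finset (SpaceTime 2))}
    (hrun : IsAdaptiveRun 𝒯₀ accepts ε φ κ s F new) : IsSimplicialFamily K (⋃ i, new i) := by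
  obtain ⟨p, δ, hstep⟩ := hrun.exists_steps
  exact (hrun.isFrontSequence hK hM hε hφ hs hstep).isSimplicialFamily

theorem IsAdaptiveRun.exists_causalOutflowFacet (hK : IsSpaceMesh K) (hM : IsMarking K 𝒯₀)
    (hε : ε < 1) (hφ : φ < 1) (hs : 0 < s) {accepts : ℕ → Finset (SpaceTime 2) → Prop}
    {F : ℕ → AdaptiveFront} {new : ℕ → Set (Finset (SpaceTime 2))}
    (hrun : IsAdaptiveRun 𝒯₀ accepts ε φ κ s F new) {S : SpaceTime 2 → ℝ}
    (hS : ∀ P ∈ K.space ×ˢ Ici (0 : ℝ), s ≤ S P) {e : Finset (SpaceTime 2)}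
    (he : e ∈ ⋃ i, new i) : ∃ F, IsCausalOutflowFacet S e F := by
  obtain ⟨p, δ, hstep⟩ := hrun.exists_steps
  refine (hrun.isFrontSequence hK hM hε hφ hs hstep).exists_causalOutflowFacet hS
    (fun i _ => ?_) he
  exact exists_gradient_advance_value hM.isForest
    (hrun.isValid hK hM hε hφ hs i).triangulation (hstep i).1

theorem exists_meshCriteria_of_adaptiveRun (hK : IsSpaceMesh K) (hM : IsMarking K 𝒯₀)
    (hε0 : 0 < ε) (hεφ : ε < φ) (hφ : φ < (1 + ε) / 2) (hε : ε < 1) (hκ0 : 0 < κ)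
    (hs : 0 < s) {μ : ℝ} (hμ : 0 < μ) :
    ∃ c : ℝ, 0 < c ∧
      ∀ accepts : ℕ → Finset (SpaceTime 2) → Prop, AcceptsSmall accepts μ →
      ∀ S : SpaceTime 2 → ℝ, (∀ P ∈ K.space ×ˢ Set.Ici (0 : ℝ), s ≤ S P) →
      ∀ F new, IsAdaptiveRun 𝒯₀ accepts ε φ κ s F new →
        MeshCriteria K S c (⋃ i, new i) ∧
        ∀ T : ℝ, 0 ≤ T → ∃ n,
          (∀ t ∈ (F n).tri, ∀ v ∈ t.verts, T ≤ (F n).time v) ∧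
          (⋃ i ∈ Set.Iio n, new i).Finite ∧
          K.space ×ˢ Set.Icc (0 : ℝ) T ⊆ ⋃ e ∈ ⋃ i ∈ Set.Iio n, new i, hull e := by
  classical
  have hF := hM.isForest
  have hφ1 : φ < 1 := by linarith
  obtain ⟨N, hN⟩ := exists_generation_bound (κ := κ) hK hM hε hφ1 hs hμ
  -- The finite reservoir of triangles from which all fronts are built; it makes `η`, `V` and `B`
  -- independent of the run.
  set 𝒟 : Set MarkedTriangle := {t | ∃ n ≤ N, HasGeneration 𝒯₀ n t} with h𝒟
  have hfin : 𝒟.Finite := finite_hasGeneration 𝒯₀ N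
  obtain ⟨η, hη, hadv⟩ := exists_uniform_adaptive_progress hε0 hεφ hφ hε hs hfin
    (by rintro t ⟨n, -, hn⟩; exact hF.nondegenerate_of_hasGeneration hn)
  obtain ⟨X, hX, hbound⟩ := exists_edgeBound_of_finset 𝒯₀
  set V : Finset (Space 2) := hfin.toFinset.biUnion MarkedTriangle.verts with hV
  -- Descendants inherit the edge bound `X`, so times within a triangle differ by at most `s * (2 *
  -- X)`, and `V` contains the vertices of all fronts.
  set B : ℝ := V.card * (s * (2 * X)) + 1 with hB
  have hB0 : 0 < B := by positivity
  refine ⟨κ * η / (2 * B), by positivity, fun accepts hacc S hS F new hrun => ?_⟩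
  have hgen := hN accepts hacc F new hrun
  have hval := hrun.isValid hK hM hε hφ1 hs
  have hT := fun i => (hval i).triangulation
  have hsub : ∀ i, ↑(F i).tri ⊆ 𝒟 := by
    intro i t ht
    obtain ⟨n, hn⟩ := (hT i).generation t ht
    exact ⟨n, hgen i t ht n hn, hn⟩
  have hmemV : ∀ i, ∀ t ∈ (F i).tri, t.verts ⊆ V := fun i t ht v hv =>
    Finset.mem_biUnion.2 ⟨t, hfin.mem_toFinset.2 (hsub i ht), hv⟩
  obtain ⟨p, δ, hstep⟩ := hrun.exists_steps
  have H := hrun.isFrontSequence hK hM hε hφ1 hs hstep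
  have hδη : ∀ i, κ * η ≤ δ i := fun i => (hstep i).1.nearMax η
    (hadv (F i) (hsub i) (hval i).progressive (p i) (hstep i).1.localMin)
  have hspread : ∀ i, ∀ x ∈ K.space, ∀ y ∈ K.space, (F i).value x ≤ (F i).value y + B := by
    intro i x hx y hy
    obtain ⟨t, ht, hxt⟩ := (hT i).cover x hx
    obtain ⟨t', ht', hyt'⟩ := (hT i).cover y hy
    refine frontValue_spread (hT i).conforming.triangleSimplices ?_ ?_
      (verts_mem_triangleSimplices ht) (verts_mem_triangleSimplices ht') hxt hyt'
    · rintro _ ⟨q, hq, rfl⟩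
      exact ((hT i).nondegenerate hF hq).indep
    · intro σ hσ σ' hσ' u hu v hv
      have := spread_le_of_isPreconnected (b := s * (2 * X)) (V := V) (τ := (F i).time)
        ((F i).tri.finite_toSet.image _)
        (hT i).conforming.triangleSimplices
        (by
          have h := (hT i).iUnion_hull hM
          rw [triangleSimplices] at h
          rw [h]; exact hK.connected.isPreconnected)
        (by
          rintro _ ⟨q, hq, rfl⟩ u hu v hv
          obtain ⟨⟨g, hg, hgs⟩, -⟩ := (hval i).progressive q hq
          obtain ⟨n, r, hr, hrq⟩ := (hT i).generation q hq
          have hb := (hbound r hr).descendsIn 0 (by omega) hrq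
          rw [pow_zero, div_one] at hb
          have h1 := (le_abs_self _).trans (hg.abs_sub_le hv hu)
          have h2 : ‖g‖ * dist v u ≤ s * (2 * X) :=
            mul_le_mul hgs.le (hb.dist_le hv hu) dist_nonneg hs.le
          linarith)
        (by rintro _ ⟨q, hq, rfl⟩; exact hmemV i q hq) hσ hσ' hu hv
      linarith
  have hVspace : (V : Set (Space 2)) ⊆ K.space := by
    intro v hv
    obtain ⟨t, ht, hvt⟩ := Finset.mem_biUnion.1 hv
    obtain ⟨n, -, hn⟩ := hfin.mem_toFinset.1 ht
    obtain ⟨ρ, hρ, hρt⟩ := hM.exists_hull_subset hn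
    exact K.convexHull_subset_space hρ (hρt (mem_hull hvt))
  have htime : ∀ T : ℝ, ∃ n, ∀ x ∈ K.space, T ≤ (F n).value x := by
    refine H.exists_forall_le (by positivity : 0 < κ * η) V hVspace (fun n => ?_) hspread
    obtain ⟨i, hi, hne⟩ := hrun.exists_accepted hK hM hε hφ1 hs hgen n
    obtain ⟨t, ht, hpt⟩ := (hstep i).1.localMin.1
    exact ⟨i, hi, hne, hmemV i t ht hpt, hδη i⟩
  have hCfin : ∀ i, (triangleSimplices (F i).tri).Finite := fun i => (F i).tri.finite_toSet.image _
  refine ⟨H.meshCriteria hS (fun i _ => exists_gradient_advance_value hF (hT i) (hstep i).1) hCfin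
    (by positivity) (fun i _ => hδη i)
    (fun i e he P hP Q hQ => H.abs_time_sub_le (by norm_num) hspread he hP hQ) htime, ?_⟩
  intro T hT0
  obtain ⟨n, hn⟩ := htime (T + 1)
  refine ⟨n, fun t ht v hv => ?_, ?_, ?_⟩
  · obtain ⟨m, hm⟩ := (hT n).generation t ht
    obtain ⟨ρ, hρ, hρt⟩ := hM.exists_hull_subset hm
    have := hn v (K.convexHull_subset_space hρ (hρt (mem_hull hv)))
    rw [AdaptiveFront.value_vertex hF (hT n) ht hv] at this
    linarith
  · exact (finite_Iio n).biUnion fun i _ => H.finite_new hCfin i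
  · rintro ⟨x, t⟩ ⟨hx, ht⟩
    obtain ⟨i, hi, e, he, hxe⟩ := H.exists_element_of_lt (n := n) hx ht.1
      (by linarith [hn x hx, ht.2])
    simp only [mem_iUnion]
    exact ⟨e, ⟨i, hi, he⟩, hxe⟩

end AdaptiveRuns

/-- In the first part, `ε` and `κ` are the parameters of the algorithm in arbitrary dimension and
`s` is a positive lower bound for the causal slope `S`. The second part is about the adaptive
algorithm in the plane, with parameters `ε`, `φ`, `κ`. -/
theorem mainTheorem1 :
    (∀ (d : ℕ), 1 ≤ d → ∀ (K : Geometry.SimplicialComplex ℝ (Space d)), IsSpaceMesh K →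
      ∀ (ε κ s : ℝ), 0 < ε → ε < 1 → 0 < κ → κ < 1 → 0 < s →
        -- the algorithm never gets stuck
        (∀ τ, IsReachableFront K ε κ s τ →
          (∃ p, IsLocalMinVertex K τ p) ∧
          ∀ p, IsLocalMinVertex K τ p → ∃ δ, IsPitch K ε κ s τ p δ) ∧
        (∃ τ p δ, IsTentRun K ε κ s τ p δ) ∧
        -- every run builds a mesh that satisfies the criteria
        ∃ c : ℝ, 0 < c ∧
          ∀ S : SpaceTime d → ℝ, (∀ P ∈ K.space ×ˢ Set.Ici (0 : ℝ), s ≤ S P) →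
          ∀ τ p δ, IsTentRun K ε κ s τ p δ →
            MeshCriteria K S c (tentMesh K τ p δ) ∧
            (∀ f ∈ K.faces, f.map ⟨fun v => (v, (0 : ℝ)), Prod.mk_left_injective 0⟩ ∈
              allFaces (tentMesh K τ p δ)) ∧
            ∀ T : ℝ, ∃ n, ∀ v, {v} ∈ K.faces → T ≤ τ n v) ∧
    (∀ (K : Geometry.SimplicialComplex ℝ (Space 2)), IsSpaceMesh K →
      ∀ (𝒯₀ : Finset MarkedTriangle), IsMarking K 𝒯₀ →
      ∀ (ε φ κ s : ℝ), 0 < ε → ε < φ → φ < (1 + ε) / 2 → (1 + ε) / 2 < 1 →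
        0 < κ → κ < 1 → 0 < s →
        -- the algorithm never gets stuck
        (∀ F, IsReachableAdaptiveFront 𝒯₀ ε φ κ s F →
          (∃ p, F.IsLocalMin p) ∧
          ∀ accepts p, F.IsLocalMin p → ∃ new F', AdaptiveStep 𝒯₀ accepts ε φ κ s F p new F') ∧
        -- for every error indicator
        (∀ accepts : ℕ → Finset (SpaceTime 2) → Prop,
          (∃ F new, IsAdaptiveRun 𝒯₀ accepts ε φ κ s F new) ∧
          ∀ F new, IsAdaptiveRun 𝒯₀ accepts ε φ κ s F new →
            IsSimplicialFamily K (⋃ i, new i) ∧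
            (∀ S : SpaceTime 2 → ℝ, (∀ P ∈ K.space ×ˢ Set.Ici (0 : ℝ), s ≤ S P) →
              ∀ e ∈ ⋃ i, new i, ∃ F, IsCausalOutflowFacet S e F) ∧
            (∀ i, ∀ e ∈ new i, accepts i e) ∧
            ∀ allowedDiam : ℕ → Finset (SpaceTime 2) → ℝ,
              (∀ i e, accepts i e → spacetimeDiam e ≤ allowedDiam i e) →
              ∀ i, ∀ e ∈ new i, spacetimeDiam e ≤ allowedDiam i e) ∧
        -- for every error indicator that accepts all tetrahedra below a minimum size
        ∀ μ : ℝ, 0 < μ → ∃ c : ℝ, 0 < c ∧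
          ∀ accepts : ℕ → Finset (SpaceTime 2) → Prop, AcceptsSmall accepts μ →
          ∀ S : SpaceTime 2 → ℝ, (∀ P ∈ K.space ×ˢ Set.Ici (0 : ℝ), s ≤ S P) →
          ∀ F new, IsAdaptiveRun 𝒯₀ accepts ε φ κ s F new →
            MeshCriteria K S c (⋃ i, new i) ∧
            ∀ T : ℝ, 0 ≤ T → ∃ n,
              (∀ t ∈ (F n).tri, ∀ v ∈ t.verts, T ≤ (F n).time v) ∧
              (⋃ i ∈ Set.Iio n, new i).Finite ∧
              K.space ×ˢ Set.Icc (0 : ℝ) T ⊆ ⋃ e ∈ ⋃ i ∈ Set.Iio n, new i, hull e) := by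
  refine ⟨fun d hd K hK ε κ s hε0 hε hκ0 hκ hs => ⟨fun τ hτ => ⟨hK.exists_localMin τ, fun p hp => ?_⟩,
    hK.exists_tentRun hd hε0 hε hκ0 hκ hs, exists_meshCriteria_of_tentRun hK hd hε0 hε hκ0 hs⟩, ?_⟩
  · exact hK.exists_pitch hd hε0 hε hκ0 hκ hs (hτ.isProgressive hK.finite hε hs) hp
  · intro K hK 𝒯₀ hM ε φ κ s hε0 hεφ hφ hε1 hκ0 hκ hs
    have hε : ε < 1 := by linarith
    have hφ1 : φ < 1 := by linarith
    refine ⟨fun F hF => ?_, fun accepts => ⟨?_, fun F new hrun => ⟨?_, ?_, ?_, ?_⟩⟩, ?_⟩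
    · have hV := hF.isValid hK hM hε hφ1 hs
      exact ⟨hV.exists_isLocalMin hK, fun accepts p hp =>
        hV.exists_step hM.isForest hε0 hεφ hφ hε hκ0 hκ hs accepts hp⟩
    · exact exists_adaptiveRun hK hM hε0 hεφ hφ hε hκ0 hκ hs accepts
    · exact hrun.isSimplicialFamily hK hM hε hφ1 hs
    · exact fun S hS e he => hrun.exists_causalOutflowFacet hK hM hε hφ1 hs hS he
    · exact fun i e he => hrun.accepted he
    · exact fun allowedDiam hallowed i e he => hallowed i e (hrun.accepted he)
    · exact fun μ hμ => exists_meshCriteria_of_adaptiveRun hK hM hε0 hεφ hφ hε hκ0 hs hμ
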